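/- Fix an infinitely differentiable function $w\ge 0$ on $\mathbb{R}$ with $\operatorname{supp} w\subset[\tfrac12,2]$ and $w(s)=1-w(s/2)$ for $s\in[1,2]$. For $n\in\mathbb{Z}$ let $W_n$ be the function on $\mathbb{R}^2$ with $\int_{\mathbb{R}^2} W_n(x)e^{-i(x,t)}\,dx=w(\|t\|/2^n)$, where $\|\cdot\|$ is the Euclidean norm, and for a tempered distribution $f$ put $f_n=f*W_n$. The Besov class $B^1_{\infty,1}(\mathbb{R}^2)$ consists of the tempered distributions $f$ on $\mathbb{R}^2$ such that $$\|f\|_{B^1_{\infty,1}}=\sum_{n\in\mathbb{Z}}2^n\|f_n\|_{L^\infty}<\infty$$ and $\partial_j f=\sum_{n\in\mathbb{Z}}\partial_j f_n$ in the space of tempered distributions for $j=1,2$. Every such $f$ is a continuous (in fact, Lipschitz) function, and it is regarded as such. For bounded self-adjoint operators $A$ and $B$ on a complex Hilbert space, with spectral measures $E_A$ and $E_B$, let $$f(A,B)=\iint f(x,y)\,dE_A(x)\,dE_B(y)$$ be the double operator integral in the sense of Birman and Solomyak. That is, for an operator $S$ of trace class, $K_S=\iint f(x,y)\,dE_B(y)\,S\,dE_A(x)$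 is the integral of $f$ with respect to the spectral measure on the Hilbert–Schmidt class whose value at $\Delta\times\Lambda$ is $S\mapsto E_B(\Delta)SE_A(\Lambda)$. The function $f$ is a Schur multiplier with respect to $(E_A,E_B)$ if $K_S$ is of trace class for every $S$ of trace class, and then $f(A,B)$ is the bounded operator with $\operatorname{trace}(f(A,B)S)=\operatorname{trace}(K_S)$ for all such $S$. For $1\le p<\infty$, $\|T\|_{\mathcal{S}_p}=\big(\sum_{n\ge0}s_n(T)^p\big)^{1/p}$ is the Schatten–von Neumann norm, where $s_n(T)$ are the singular values of $T$, and $\mathcal{S}_p$ is the class of operators for which it is finite. **Theorem 7.2.** Let $p\in[1,2]$. Then there is a positive number $C$ such that, for every complex Hilbert space, all $f\in B^1_{\infty,1}(\mathbb{R}^2)$ and all bounded self-adjoint operators $A_1,A_2,B_1,B_2$ on the space with $A_2-A_1\in\mathcal{S}_p$ and $B_2-B_1\in\mathcal{S}_p$, the function $f$ is a Schur multiplier with respect to $(E_{A_1},E_{B_1})$ and $(E_{A_2},E_{B_2})$, so that $f(A_1,B_1)$ and $f(A_2,B_2)$ are well defined, and $$\|f(A_1,B_1)-f(A_2,B_2)\|_{\mathcal{S}_p}\le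 C\,\|f\|_{B^1_{\infty,1}}\max\big\{\|A_1-A_2\|_{\mathcal{S}_p},\ \|B_1-B_2\|_{\mathcal{S}_p}\big\}.$$ -/

import Mathlib

open MeasureTheory Set
open scoped ENNReal NNReal FourierTransform InnerProductSpace SchwartzMap

universe u

namespace NoncommFun

/-! ### The Besov class of functions on the plane -/

section Besov

/-- The plane with its Euclidean norm. -/
abbrev Plane : Type := EuclideanSpace ℝ (Fin 2)

/-- The smooth cut-off functions `w` on the line from which the Littlewood–Paley kernels are
built. -/
structure IsCutoff (w : ℝ → ℝ) : Prop where
  smooth : ContDiff ℝ ((⊤ : ℕ∞) : WithTop ℕ∞) w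
  nonneg : ∀ s, 0 ≤ w s
  supp : tsupport w ⊆ Icc (1 / 2) 2
  partition : ∀ s ∈ Icc (1 : ℝ) 2, w s = 1 - w (s / 2)

/-- The kernel `W_n`: `∫ W_n(x) e^{-i(x,t)} dx = w(‖t‖ / 2^n)`. Mathlib's Fourier transform has the
character `e^{-2πi(x,ξ)}`, so that `t = 2πξ`. -/
noncomputable def kernelW (w : ℝ → ℝ) (n : ℤ) : Plane → ℂ :=
  𝓕⁻ (fun ξ : Plane => ((w (2 * Real.pi * ‖ξ‖ / 2 ^ n) : ℝ) : ℂ))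

/-- The Littlewood–Paley piece `f_n = f * W_n`. -/
noncomputable def lpPiece (w : ℝ → ℝ) (f : Plane → ℂ) (n : ℤ) : Plane → ℂ :=
  fun x => ∫ y, f (x - y) * kernelW w n y

/-- The quantity `∑_{n ∈ ℤ} 2^n ‖f * W_n‖_{L^∞}`, i.e. the (semi)norm of `f` in `B^1_{∞,1}(ℝ²)`. -/
noncomputable def besovNorm (w : ℝ → ℝ) (f : Plane → ℂ) : ℝ≥0∞ :=
  ∑' n : ℤ, (2 : ℝ≥0∞) ^ n * eLpNorm (lpPiece w f n) ∞ volume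

/-- The value on a Schwartz function `φ` of the `j`-th distributional partial derivative of `g`. -/
noncomputable def distribPartial (g : Plane → ℂ) (j : Fin 2) (φ : 𝓢(Plane, ℂ)) : ℂ :=
  -∫ x, g x * fderiv ℝ φ x (EuclideanSpace.single j 1)

/-- The (modified homogeneous) Besov class `B^1_{∞,1}(ℝ²)`. Its elements are tempered distributions
that are continuous (indeed Lipschitz) functions, and they are taken here as such functions;
`growth` only makes sure that the function defines a tempered distribution. The field `derivs` says
that `∂_j f = ∑_n ∂_j f_n` in the space of tempered distributions; it excludes the polynomials of
positive degree. -/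
structure MemBesov (w : ℝ → ℝ) (f : Plane → ℂ) : Prop where
  continuous : Continuous f
  growth : ∃ (M : ℝ) (N : ℕ), ∀ x, ‖f x‖ ≤ M * (1 + ‖x‖) ^ N
  summable : besovNorm w f < ∞
  derivs : ∀ (j : Fin 2) (φ : 𝓢(Plane, ℂ)),
    HasSum (fun n : ℤ => distribPartial (lpPiece w f n) j φ) (distribPartial f j φ)

end Besov

/-! ### Schatten–von Neumann classes, spectral measures and double operator integrals -/

section Operators

variable {H : Type u} [NormedAddCommGroup H] [InnerProductSpace ℂ H]

/-- The singular value `s_n(T)`, `n ≥ 0`: the distance from `T` to the operators of rank at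
most `n`. -/
noncomputable def singularValue (T : H →L[ℂ] H) (n : ℕ) : ℝ :=
  ⨅ R : {R : H →L[ℂ] H // LinearMap.rank (R : H →ₗ[ℂ] H) ≤ n}, ‖T - R.1‖

/-- The Schatten–von Neumann norm `‖T‖_{S_p} = (∑_n s_n(T)^p)^{1/p}`, infinite if `T ∉ S_p`. -/
noncomputable def schattenNorm (p : ℝ) (T : H →L[ℂ] H) : ℝ≥0∞ :=
  (∑' n : ℕ, ENNReal.ofReal (singularValue T n) ^ p) ^ (1 / p)

/-- The class `S_p`. -/
def MemSchatten (p : ℝ) (T : H →L[ℂ] H) : Prop :=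
  schattenNorm p T < ∞

/-- `K` has trace `t`: the series `∑ ⟨K e_i, e_i⟩` has the sum `t` for every orthonormal basis. -/
def HasTrace (K : H →L[ℂ] H) (t : ℂ) : Prop :=
  ∀ (s : Set H) (b : HilbertBasis s ℂ H), HasSum (fun i => ⟪b i, K (b i)⟫_ℂ) t

variable [CompleteSpace H]

/-- Spectral measures on the Borel subsets of the line: countably additive (in the strong operator
topology), with values in the orthogonal projections. Values on non-Borel sets are irrelevant. -/
structure IsSpectralMeasure (E : Set ℝ → H →L[ℂ] H) : Prop where
  proj : ∀ S, MeasurableSet S → IsStarProjection (E S)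
  univ : E univ = 1
  inter : ∀ S T, MeasurableSet S → MeasurableSet T → E (S ∩ T) = E S * E T
  iUnion : ∀ S : ℕ → Set ℝ, (∀ i, MeasurableSet (S i)) → Pairwise (Function.onFun Disjoint S) →
    ∀ x, HasSum (fun i => E (S i) x) (E (⋃ i, S i) x)

/-- `A = ∫ t dE(t)`, that is, `⟨A x, x⟩ = ∫ t dμ_x(t)` for all `x`, where `μ_x = ⟨E(·) x, x⟩`. -/
def Resolves (E : Set ℝ → H →L[ℂ] H) (A : H →L[ℂ] H) : Prop :=
  ∀ x : H, ∃ μ : Measure ℝ, IsFiniteMeasure μ ∧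
    (∀ S, MeasurableSet S → ((μ.real S : ℝ) : ℂ) = ⟪x, E S x⟫_ℂ) ∧
    Integrable (fun t : ℝ => t) μ ∧ ⟪x, A x⟫_ℂ = ((∫ t, t ∂μ : ℝ) : ℂ)

open scoped Classical in
/-- The spectral measure `E_A` of a self-adjoint operator `A` (junk value `0` for operators that
have none). -/
noncomputable def spectralMeasure (A : H →L[ℂ] H) : Set ℝ → H →L[ℂ] H :=
  if h : ∃ E : Set ℝ → H →L[ℂ] H, IsSpectralMeasure E ∧ Resolves E A then h.choose else 0

/-- `K = ∬ Φ(x,y) dE₁(x) T dE₂(y) = (∫ Φ dℰ) T`, where `ℰ(Λ × Δ) T = E₁(Λ) T E₂(Δ)` and `T` is of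
Hilbert–Schmidt class: for all vectors `h` and `k`, the matrix entry `⟨K h, k⟩` is the integral
of `Φ` with respect to the complex measure `ν = ⟨(ℰ(·) T) h, k⟩`. -/
def IsDoubleIntegralHS (E₁ E₂ : Set ℝ → H →L[ℂ] H) (Φ : ℝ × ℝ → ℂ) (T K : H →L[ℂ] H) : Prop :=
  ∀ h k : H, ∃ ν : ComplexMeasure (ℝ × ℝ),
    (∀ Λ Δ : Set ℝ, MeasurableSet Λ → MeasurableSet Δ →
      ν (Λ ×ˢ Δ) = ⟪k, E₁ Λ (T (E₂ Δ h))⟫_ℂ) ∧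
    VectorMeasure.Integrable ν Φ ∧
    ⟪k, K h⟫_ℂ = VectorMeasure.integral ν Φ (ContinuousLinearMap.mul ℝ ℂ)

/-- `Φ` is a Schur multiplier of the space of bounded operators with respect to `E₁` and `E₂`: the
transposed transformer `S ↦ ∬ Φ(x,y) dE₂(y) S dE₁(x)` maps the trace class `S_1` into itself. -/
def IsSchurMultiplier (E₁ E₂ : Set ℝ → H →L[ℂ] H) (Φ : ℝ × ℝ → ℂ) : Prop :=
  ∀ S : H →L[ℂ] H, MemSchatten 1 S →
    ∃ K : H →L[ℂ] H, MemSchatten 1 K ∧ IsDoubleIntegralHS E₂ E₁ (fun z => Φ z.swap) S K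

/-- `W = ∬ Φ(x,y) dE₁(x) T dE₂(y)` for a bounded operator `T` and a Schur multiplier `Φ`, defined by
duality: `trace (W S) = trace (T K)` with `K = ∬ Φ(x,y) dE₂(y) S dE₁(x)`, for all `S` in `S_1`. -/
def IsDoubleIntegral (E₁ E₂ : Set ℝ → H →L[ℂ] H) (Φ : ℝ × ℝ → ℂ) (T W : H →L[ℂ] H) : Prop :=
  IsSchurMultiplier E₁ E₂ Φ ∧
    ∀ S K : H →L[ℂ] H, MemSchatten 1 S → IsDoubleIntegralHS E₂ E₁ (fun z => Φ z.swap) S K →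
      ∃ t : ℂ, HasTrace (W * S) t ∧ HasTrace (T * K) t

/-- `W` is the function `f(A,B) = ∬ f(x,y) dE_A(x) dE_B(y)` of the pair `(A, B)`. -/
def IsFunctionOfPair (f : Plane → ℂ) (A B W : H →L[ℂ] H) : Prop :=
  IsDoubleIntegral (spectralMeasure A) (spectralMeasure B) (fun z => f !₂[z.1, z.2]) 1 W

open scoped Classical in
/-- The operator `f(A,B)` (junk value `0` if it is not defined). -/
noncomputable def functionOfPair (f : Plane → ℂ) (A B : H →L[ℂ] H) : H →L[ℂ] H :=
  if h : ∃ W : H →L[ℂ] H, IsFunctionOfPair f A B W then h.choose else 0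

end Operators

end NoncommFun

/-! The function is split as `f = ∑ f_n` up to constants, where `f_n` has its spectrum in a ball of
radius comparable to `2^n`. By Bernstein's inequality (`exists_isExpType_lpPiece`) each `f_n` is of
exponential type comparable to `2^n` in each variable. It then suffices to prove, for `g` of
exponential type `M` bounded together with its normalised derivatives by `G`, that `‖g(A₁,B) -
g(A₂,B)‖_{S_p} ≤ const · M · G · ‖A₁ - A₂‖_{S_p}`. Taking adjoints exchanges the variables, the two
differences are joined through the pair `(A₂, B₁)`, and the sum over `n` produces the Besov norm
(`functionOfPair_sub_le`).

The one-variable estimate is `IsExpType.diagNorm_sub_le`. The difference is the triple operator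
integral of the divided difference `(g(x,y) - g(x',y))/(x - x')` against `dE_{A₁}(x) (A₁ - A₂)
dE_{A₂}(x') dE_B(y)`; for Riemann sums this is the algebraic identity
`doubleStepOp_sub_doubleStepOp`. The `x` and `x'` axes are cut into cells of length `1/M`. On blocks
`(j,k)` near the diagonal the divided difference is expanded in a Taylor series about a cell
endpoint. Far from it, `1/(x - x')` is expanded in powers of `1/(j-k)` and only `g` is Taylor
expanded. Every term is then a kernel `κ(j,k) a(x) b(x') e(y)`, with `e` depending on only one of
`j`, `k`. The matrix `κ` is bounded on `ℓ²`, by Hilbert's inequality (`formBound_hilbert`) or by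
summability of its diagonals.

Such a kernel acts as `T ↦ ∑ α_j T X_j`, where the `α_j` come from disjoint spectral cells and form
both a row and a column contraction, while the `X_j` are bounded only as a row. This is enough
exactly for an interpolation between the Schur tests for `p = 1` and `p = 2`
(`diagNorm_sum_mul_mul_le`), and here `p ≤ 2` is used. The estimate is made for `diagNorm`, which
dominates the Schatten norm up to the factor 4 and has the triangle inequality and lower
semicontinuity for free. The role of the Schmidt expansion of `T` is played by
`exists_orthonormal_expansion`.

That `f(A,B)` exists is a separate matter. On a square `[-R,R]²` the function `f` is an absolutely
convergent series of products `a(x) b(y)`: by `IsExpType.hasNuclearBound_sub` the nuclear norm of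
`f_n` minus a constant is at most a multiple of `R · 2^n ‖f_n‖_∞`. Such functions are Schur
multipliers, and `f(A,B)` is the norm limit of Riemann sums (`IsNuclearSeries.functionOfPair_spec`).
-/

namespace NoncommFun

/-! ### Singular values, and a Schatten-type norm defined by diagonals. -/

section Schatten

open Filter Topology

variable {H : Type u} [NormedAddCommGroup H] [InnerProductSpace ℂ H]

instance (n : ℕ) : Nonempty {R : H →L[ℂ] H // LinearMap.rank (R : H →ₗ[ℂ] H) ≤ n} :=
  ⟨⟨0, by simp⟩⟩

lemma bddBelow_singularValue (T : H →L[ℂ] H) (n : ℕ) :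
    BddBelow (range fun R : {R : H →L[ℂ] H // LinearMap.rank (R : H →ₗ[ℂ] H) ≤ n} => ‖T - R.1‖) :=
  ⟨0, by rintro _ ⟨R, rfl⟩; positivity⟩

lemma singularValue_le (T R : H →L[ℂ] H) (n : ℕ) (h : LinearMap.rank (R : H →ₗ[ℂ] H) ≤ n) :
    singularValue T n ≤ ‖T - R‖ :=
  ciInf_le (bddBelow_singularValue T n) ⟨R, h⟩

lemma singularValue_nonneg (T : H →L[ℂ] H) (n : ℕ) : 0 ≤ singularValue T n :=
  le_ciInf fun _ => norm_nonneg _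

lemma singularValue_antitone (T : H →L[ℂ] H) : Antitone (singularValue T) := by
  intro m n hmn
  refine le_ciInf fun R => singularValue_le T R.1 n (R.2.trans (by exact_mod_cast hmn))

lemma exists_rank_le_norm_sub_lt (T : H →L[ℂ] H) (n : ℕ) {ε : ℝ} (hε : 0 < ε) :
    ∃ R : H →L[ℂ] H, LinearMap.rank (R : H →ₗ[ℂ] H) ≤ n ∧ ‖T - R‖ < singularValue T n + ε := by
  obtain ⟨R, hR⟩ := exists_lt_of_ciInf_lt (show singularValue T n < singularValue T n + ε by linarith)
  exact ⟨R.1, R.2, hR⟩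

lemma singularValue_zero (T : H →L[ℂ] H) : singularValue T 0 = ‖T‖ := by
  refine le_antisymm (by simpa using singularValue_le T 0 0 (by simp)) (le_ciInf ?_)
  rintro ⟨R, hR⟩
  have : R = 0 := by
    have h0 : LinearMap.rank (R : H →ₗ[ℂ] H) = 0 := by simpa using hR
    rw [LinearMap.rank, Submodule.rank_eq_zero, LinearMap.range_eq_bot] at h0
    ext x
    simpa using congrArg (fun f => f x) h0
  simp [this]

lemma singularValue_neg (T : H →L[ℂ] H) (n : ℕ) : singularValue (-T) n = singularValue T n := by
  have key : ∀ S : H →L[ℂ] H, singularValue (-S) n ≤ singularValue S n := by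
    intro S
    refine le_ciInf fun R => ?_
    refine (singularValue_le (-S) (-R.1) n ?_).trans (le_of_eq ?_)
    · have : ((-R.1 : H →L[ℂ] H) : H →ₗ[ℂ] H) = -(R.1 : H →ₗ[ℂ] H) := rfl
      rw [this, LinearMap.rank, LinearMap.range_neg]
      exact R.2
    · rw [← norm_neg]; congr 1; abel
  refine le_antisymm (key T) ?_
  simpa using key (-T)

lemma schattenNorm_neg (p : ℝ) (T : H →L[ℂ] H) : schattenNorm p (-T) = schattenNorm p T := by
  simp [schattenNorm, singularValue_neg]

/-- The largest `ℓ^p` norm of a diagonal `⟨Z e_n, f_n⟩` over finite orthonormal systems. -/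
noncomputable def diagNorm (p : ℝ) (Z : H →L[ℂ] H) : ℝ≥0∞ :=
  ⨆ (N : ℕ) (e : {e : Fin N → H // Orthonormal ℂ e}) (f : {f : Fin N → H // Orthonormal ℂ f}),
    (∑ n, ‖⟪f.1 n, Z (e.1 n)⟫_ℂ‖ₑ ^ p) ^ (1 / p)

lemma le_diagNorm (p : ℝ) (Z : H →L[ℂ] H) {N : ℕ} {e f : Fin N → H} (he : Orthonormal ℂ e)
    (hf : Orthonormal ℂ f) : (∑ n, ‖⟪f n, Z (e n)⟫_ℂ‖ₑ ^ p) ^ (1 / p) ≤ diagNorm p Z :=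
  le_iSup_of_le N (le_iSup_of_le ⟨e, he⟩ (le_iSup_of_le (⟨f, hf⟩ : {_f : Fin N → H // _}) le_rfl))

lemma diagNorm_le {p : ℝ} {Z : H →L[ℂ] H} {c : ℝ≥0∞}
    (h : ∀ (N : ℕ) (e f : Fin N → H), Orthonormal ℂ e → Orthonormal ℂ f →
      (∑ n, ‖⟪f n, Z (e n)⟫_ℂ‖ₑ ^ p) ^ (1 / p) ≤ c) : diagNorm p Z ≤ c :=
  iSup_le fun N => iSup_le fun e => iSup_le fun f => h N e.1 f.1 e.2 f.2

/-- Minkowski's inequality for each fixed pair of systems. This is why `diagNorm` is used: with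
singular values defined by approximation, `schattenNorm` has no equally direct triangle inequality.
-/
lemma diagNorm_add_le {p : ℝ} (hp : 1 ≤ p) (Z Y : H →L[ℂ] H) :
    diagNorm p (Z + Y) ≤ diagNorm p Z + diagNorm p Y := by
  refine diagNorm_le fun N e f he hf => ?_
  refine le_trans ?_ (add_le_add (le_diagNorm p Z he hf) (le_diagNorm p Y he hf))
  refine le_trans ?_ (ENNReal.Lp_add_le _ _ _ hp)
  gcongr with n
  simp only [add_apply, inner_add_right]
  exact enorm_add_le _ _

lemma diagNorm_zero {p : ℝ} (hp : 1 ≤ p) : diagNorm p (0 : H →L[ℂ] H) = 0 := by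
  refine le_antisymm (diagNorm_le fun N e f he hf => ?_) bot_le
  have : 0 < p := by linarith
  simp [ENNReal.zero_rpow_of_pos, this]

lemma diagNorm_sum_le {p : ℝ} (hp : 1 ≤ p) {ι : Type*} (s : Finset ι) (Z : ι → H →L[ℂ] H) :
    diagNorm p (∑ i ∈ s, Z i) ≤ ∑ i ∈ s, diagNorm p (Z i) := by
  classical
  induction s using Finset.induction_on with
  | empty => simp [diagNorm_zero hp]
  | insert a s ha ih =>
    rw [Finset.sum_insert ha, Finset.sum_insert ha]
    exact (diagNorm_add_le hp _ _).trans (by gcongr)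

lemma diagNorm_smul_le {p : ℝ} (hp : 1 ≤ p) (c : ℂ) (Z : H →L[ℂ] H) :
    diagNorm p (c • Z) ≤ ‖c‖ₑ * diagNorm p Z := by
  have hp0 : 0 < p := by linarith
  refine diagNorm_le fun N e f he hf => ?_
  refine le_trans (le_of_eq ?_) (mul_le_mul_right (le_diagNorm p Z he hf) _)
  simp only [smul_apply, inner_smul_right, enorm_mul,
    ENNReal.mul_rpow_of_nonneg _ _ hp0.le, ← Finset.mul_sum]
  rw [ENNReal.mul_rpow_of_nonneg _ _ (by positivity), ← ENNReal.rpow_mul, mul_one_div_cancel hp0.ne',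
    ENNReal.rpow_one]

/-- A supremum of norm-continuous functions is lower semicontinuous. Bounds for Riemann sums thus
pass to the operator integrals. -/
lemma diagNorm_le_of_tendsto {p : ℝ} {ι : Type*} {l : Filter ι} [l.NeBot]
    {Z : ι → H →L[ℂ] H} {Y : H →L[ℂ] H} (h : Tendsto Z l (𝓝 Y)) {c : ℝ≥0∞}
    (hc : ∀ᶠ i in l, diagNorm p (Z i) ≤ c) : diagNorm p Y ≤ c := by
  refine diagNorm_le fun N e f he hf => ?_
  have hcont : Continuous fun Z : H →L[ℂ] H => (∑ n, ‖⟪f n, Z (e n)⟫_ℂ‖ₑ ^ p) ^ (1 / p) := by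
    refine (ENNReal.continuous_rpow_const).comp ?_
    refine continuous_finsetSum _ fun n _ => ENNReal.continuous_rpow_const.comp ?_
    exact continuous_enorm.comp (continuous_const.inner
      (ContinuousLinearMap.apply ℂ H (e n)).continuous)
  refine le_of_tendsto ((hcont.tendsto Y).comp h) ?_
  filter_upwards [hc] with i hi using (le_diagNorm p (Z i) he hf).trans hi

lemma diagNorm_tsum_le {p : ℝ} (hp : 1 ≤ p) {ι : Type*} {Z : ι → H →L[ℂ] H} {Y : H →L[ℂ] H}
    (h : HasSum Z Y) : diagNorm p Y ≤ ∑' i, diagNorm p (Z i) :=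
  diagNorm_le_of_tendsto h (Eventually.of_forall fun s =>
    (diagNorm_sum_le hp s Z).trans (ENNReal.sum_le_tsum s))

lemma diagNorm_adjoint_le [CompleteSpace H] (p : ℝ) (Z : H →L[ℂ] H) :
    diagNorm p (star Z) ≤ diagNorm p Z := by
  refine diagNorm_le fun N e f he hf => ?_
  refine le_trans (le_of_eq ?_) (le_diagNorm p Z hf he)
  congr 1
  refine Finset.sum_congr rfl fun n _ => ?_
  rw [ContinuousLinearMap.star_eq_adjoint, ContinuousLinearMap.adjoint_inner_right,
    ← inner_conj_symm, RCLike.enorm_conj]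

lemma rank_le_of_range_le {R : H →L[ℂ] H} {V : Submodule ℂ H} [FiniteDimensional ℂ V]
    (h : ∀ x, R x ∈ V) : LinearMap.rank (R : H →ₗ[ℂ] H) ≤ Module.finrank ℂ V := by
  rw [LinearMap.rank, Module.finrank_eq_rank]
  exact Submodule.rank_mono (by rintro _ ⟨x, rfl⟩; exact h x)

/-- Compressing `Z` to the orthogonal complements of the two spans changes it by rank at most `2N`,
so the compression has norm at least `s_{2N}(Z)`. A vector on which this norm is nearly attained,
and its image, give the new pair. -/
lemma exists_extend_orthonormal {Z : H →L[ℂ] H} {N : ℕ} {e f : Fin N → H} (he : Orthonormal ℂ e)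
    (hf : Orthonormal ℂ f) {c : ℝ} (hc0 : 0 ≤ c) (hc : c < singularValue Z (2 * N)) :
    ∃ e' f' : H, Orthonormal ℂ (Fin.snoc (α := fun _ => H) e e') ∧
      Orthonormal ℂ (Fin.snoc (α := fun _ => H) f f') ∧ c ≤ ‖⟪f', Z e'⟫_ℂ‖ := by
  set P := Submodule.span ℂ (range e) with hP
  set Q := Submodule.span ℂ (range f) with hQ
  have : FiniteDimensional ℂ P := FiniteDimensional.span_of_finite ℂ (finite_range e)
  have : FiniteDimensional ℂ Q := FiniteDimensional.span_of_finite ℂ (finite_range f)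
  set p : H →L[ℂ] H := P.starProjection
  set q : H →L[ℂ] H := Q.starProjection
  set Z' : H →L[ℂ] H := (1 - q) * Z * (1 - p) with hZ'
  have hrank : LinearMap.rank ((Z - Z' : H →L[ℂ] H) : H →ₗ[ℂ] H) ≤ ((2 * N : ℕ) : Cardinal) := by
    have : Z - Z' = q * Z + (1 - q) * Z * p := by rw [hZ']; noncomm_ring
    rw [this]
    have h1 : LinearMap.rank ((q * Z : H →L[ℂ] H) : H →ₗ[ℂ] H) ≤ N := by
      refine (rank_le_of_range_le (V := Q) fun x => ?_).trans ?_
      · exact Submodule.starProjection_apply_mem Q _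
      · exact_mod_cast (finrank_range_le_card f).trans (by simp)
    have h2 : LinearMap.rank (((1 - q) * Z * p : H →L[ℂ] H) : H →ₗ[ℂ] H) ≤ N := by
      have : LinearMap.rank (p : H →ₗ[ℂ] H) ≤ N := by
        refine (rank_le_of_range_le (V := P) fun x => ?_).trans ?_
        · exact Submodule.starProjection_apply_mem P _
        · exact_mod_cast (finrank_range_le_card e).trans (by simp)
      exact (LinearMap.rank_comp_le_right (p : H →ₗ[ℂ] H)
        (((1 - q) * Z : H →L[ℂ] H) : H →ₗ[ℂ] H)).trans this
    refine (LinearMap.rank_add_le _ _).trans ?_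
    refine (add_le_add h1 h2).trans ?_
    push_cast
    rw [two_mul]
  have hZn : c < ‖Z'‖ := by
    refine hc.trans_le ?_
    simpa using singularValue_le Z (Z - Z') (2 * N) hrank
  obtain ⟨x, hx⟩ : ∃ x, c * ‖x‖ < ‖Z' x‖ := by
    by_contra! hcon
    exact absurd (ContinuousLinearMap.opNorm_le_bound _ hc0 hcon) (not_le.2 hZn)
  -- The new vectors are `y` and `z`, normalised.
  set y := (1 - p) x with hy
  set z := Z' x with hz
  have hz0 : z ≠ 0 := by
    intro h0; rw [h0, norm_zero] at hx; exact absurd hx (not_lt.2 (by positivity))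
  have hzy : z = (1 - q) (Z y) := rfl
  have hy0 : y ≠ 0 := by
    intro h0; apply hz0; rw [hzy, h0]; simp
  have hyP : y ∈ Pᗮ := by
    simp [hy, p]
  have hzQ : z ∈ Qᗮ := by
    simp [hzy, q]
  have hyx : ‖y‖ ≤ ‖x‖ := by
    have : y = Pᗮ.starProjection x := by
      simp [hy, p, Submodule.starProjection_orthogonal]
    rw [this]; exact Submodule.norm_starProjection_apply_le _ _
  have snoc_on : ∀ {g : Fin N → H} {w : H}, Orthonormal ℂ g → w ≠ 0 →
      w ∈ (Submodule.span ℂ (range g))ᗮ →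
      Orthonormal ℂ (Fin.snoc (α := fun _ => H) g (((‖w‖⁻¹ : ℝ) : ℂ) • w)) := by
    intro g w hg hw hwg
    have hin : ∀ i, ⟪g i, w⟫_ℂ = 0 := fun i =>
      (Submodule.mem_orthogonal _ _).1 hwg _ (Submodule.subset_span ⟨i, rfl⟩)
    constructor
    · intro i
      refine Fin.lastCases ?_ (fun j => ?_) i
      · simp [norm_smul, hw]
      · simpa using hg.1 j
    · intro i j hij
      induction i using Fin.lastCases with
      | last =>
        induction j using Fin.lastCases with
        | last => exact absurd rfl hij
        | cast j => simp [inner_smul_left, inner_eq_zero_symm.1 (hin j)]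
      | cast i =>
        induction j using Fin.lastCases with
        | last => simp [inner_smul_right, hin i]
        | cast j => simpa using hg.2 (fun h => hij (by rw [h]))
  refine ⟨((‖y‖⁻¹ : ℝ) : ℂ) • y, ((‖z‖⁻¹ : ℝ) : ℂ) • z, snoc_on he hy0 hyP, snoc_on hf hz0 hzQ, ?_⟩
  -- The component of `Z y` in the span of `f` is orthogonal to `z`, so the new entry is `‖z‖ /
  -- ‖y‖`, and `‖y‖ ≤ ‖x‖`.
  have hin : ⟪z, Z y⟫_ℂ = (‖z‖ : ℂ) ^ 2 := by
    have : Z y = z + q (Z y) := by rw [hzy]; simp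
    rw [this, inner_add_right, inner_self_eq_norm_sq_to_K]
    have : ⟪z, q (Z y)⟫_ℂ = 0 :=
      (Submodule.mem_orthogonal' _ _).1 hzQ _ (Submodule.starProjection_apply_mem Q _)
    rw [this, add_zero]; rfl
  have hyn : 0 < ‖y‖ := norm_pos_iff.2 hy0
  have hzn : 0 < ‖z‖ := norm_pos_iff.2 hz0
  rw [map_smul, inner_smul_left, inner_smul_right, hin]
  simp only [Complex.conj_ofReal, norm_mul, Complex.norm_real, norm_inv, norm_norm, norm_pow]
  have : ‖z‖⁻¹ * (‖y‖⁻¹ * ‖z‖ ^ 2) = ‖z‖ / ‖y‖ := by field_simp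
  rw [this, le_div_iff₀ hyn]
  exact (mul_le_mul_of_nonneg_left hyx hc0).trans hx.le

/-- Greedy choice of pairs. Halving the singular value gives the strict inequality needed at each
step, which is why positivity is assumed. -/
lemma exists_orthonormal_singularValue_le (Z : H →L[ℂ] H) (N : ℕ)
    (h : ∀ n < N, 0 < singularValue Z (2 * n)) :
    ∃ e f : Fin N → H, Orthonormal ℂ e ∧ Orthonormal ℂ f ∧
      ∀ n : Fin N, singularValue Z (2 * n) / 2 ≤ ‖⟪f n, Z (e n)⟫_ℂ‖ := by
  induction N with
  | zero => exact ⟨Fin.elim0, Fin.elim0, ⟨fun i => i.elim0, fun i => i.elim0⟩,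
      ⟨fun i => i.elim0, fun i => i.elim0⟩, fun i => i.elim0⟩
  | succ N ih =>
    obtain ⟨e, f, he, hf, hef⟩ := ih fun n hn => h n (by omega)
    have h0 := h N (by omega)
    obtain ⟨e', f', he', hf', hc⟩ := exists_extend_orthonormal (c := singularValue Z (2 * N) / 2)
      he hf (by positivity) (half_lt_self h0)
    refine ⟨_, _, he', hf', fun n => ?_⟩
    induction n using Fin.lastCases with
    | last => simpa using hc
    | cast j => simpa using hef j

/-- The singular values of even index are controlled by the greedy systems, with a loss of 2. Those
of odd index are dominated by their even predecessors, which costs a further `2^{1/p} ≤ 2`. -/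
lemma schattenNorm_le_diagNorm {p : ℝ} (hp : 1 ≤ p) (Z : H →L[ℂ] H) :
    schattenNorm p Z ≤ 4 * diagNorm p Z := by
  have hp0 : 0 < p := by linarith
  set s : ℕ → ℝ≥0∞ := fun n => ENNReal.ofReal (singularValue Z n) with hs
  have hanti : Antitone s := fun m n hmn => ENNReal.ofReal_le_ofReal (singularValue_antitone Z hmn)
  have main : ∀ N : ℕ, ∑ n ∈ Finset.range N, s (2 * n) ^ p ≤ (2 * diagNorm p Z) ^ p := by
    intro N
    induction N with
    | zero => simp
    | succ N ih =>
      -- If the last singular value vanishes, its term is zero and the previous case applies.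
      -- Otherwise all earlier ones are positive and a single greedy system bounds the whole sum.
      rcases (singularValue_nonneg Z (2 * N)).eq_or_lt with h0 | h0
      · rw [Finset.sum_range_succ]
        simp only [hs, ← h0]
        simpa [hp0] using ih
      · obtain ⟨e, f, he, hf, hef⟩ := exists_orthonormal_singularValue_le Z (N + 1) (fun n hn =>
          h0.trans_le (singularValue_antitone Z (by omega)))
        have h1 := le_diagNorm p Z he hf
        rw [ENNReal.mul_rpow_of_nonneg _ _ hp0.le]
        rw [one_div, ENNReal.rpow_inv_le_iff hp0] at h1
        rw [Finset.sum_range (fun n => s (2 * n) ^ p)]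
        calc ∑ n : Fin (N + 1), s (2 * n) ^ p
            ≤ ∑ n : Fin (N + 1), 2 ^ p * ‖⟪f n, Z (e n)⟫_ℂ‖ₑ ^ p := by
              gcongr with n
              rw [← ENNReal.mul_rpow_of_nonneg _ _ hp0.le]
              gcongr
              have := hef n
              rw [show (2 : ℝ≥0∞) = ENNReal.ofReal 2 by simp, ← ofReal_norm,
                ← ENNReal.ofReal_mul (by norm_num)]
              exact ENNReal.ofReal_le_ofReal (by linarith)
          _ = 2 ^ p * ∑ n : Fin (N + 1), ‖⟪f n, Z (e n)⟫_ℂ‖ₑ ^ p := by rw [Finset.mul_sum]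
          _ ≤ _ := by gcongr
  have hall : ∑' n, s n ^ p ≤ 2 * (2 * diagNorm p Z) ^ p := by
    refine ENNReal.tsum_le_of_sum_range_le fun N => ?_
    have h2 : ∀ N, ∑ n ∈ Finset.range (2 * N), s n ^ p ≤ 2 * ∑ n ∈ Finset.range N, s (2 * n) ^ p := by
      intro N
      induction N with
      | zero => simp
      | succ N ih =>
        rw [show 2 * (N + 1) = 2 * N + 1 + 1 by ring, Finset.sum_range_succ, Finset.sum_range_succ,
          Finset.sum_range_succ, mul_add, add_assoc, two_mul (s (2 * N) ^ p)]
        gcongr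
        exact hanti (by omega)
    calc _ ≤ ∑ n ∈ Finset.range (2 * N), s n ^ p :=
          Finset.sum_le_sum_of_subset (Finset.range_subset_range.2 (by omega))
      _ ≤ _ := (h2 N).trans (by gcongr; exact main N)
  calc schattenNorm p Z ≤ (2 * (2 * diagNorm p Z) ^ p) ^ (1 / p) := by
        unfold schattenNorm; gcongr
    _ ≤ (2 ^ p * (2 * diagNorm p Z) ^ p) ^ (1 / p) := by
        gcongr
        calc (2 : ℝ≥0∞) = 2 ^ (1 : ℝ) := by simp
          _ ≤ 2 ^ p := ENNReal.rpow_le_rpow_of_exponent_le (by norm_num) hp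
    _ = 4 * diagNorm p Z := by
        rw [← ENNReal.mul_rpow_of_nonneg _ _ hp0.le, ← ENNReal.rpow_mul, mul_one_div_cancel hp0.ne',
          ENNReal.rpow_one, ← mul_assoc]
        norm_num

end Schatten

end NoncommFun

namespace NoncommFun

/-! ### The Schatten estimate for row and column transformers, and orthonormal expansions of
operators. -/

section Factorization

open Filter Topology

lemma tsum_rpow_mul_rpow_le {ι : Type*} {θ : ℝ} (h0 : 0 ≤ θ) (h1 : θ ≤ 1) (a b : ι → ℝ≥0∞) :
    ∑' i, a i ^ θ * b i ^ (1 - θ) ≤ (∑' i, a i) ^ θ * (∑' i, b i) ^ (1 - θ) := by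
  rcases h0.eq_or_lt with rfl | h0
  · simp
  rcases h1.eq_or_lt with rfl | h1
  · simp
  have h2 : 0 < 1 - θ := by linarith
  have hpq : (1 / θ).HolderConjugate (1 / (1 - θ)) := by
    rw [Real.holderConjugate_iff]
    exact ⟨by rw [lt_div_iff₀ h0]; linarith, by field_simp; ring⟩
  refine ENNReal.summable.tsum_le_of_sum_le fun s => ?_
  refine (ENNReal.inner_le_Lp_mul_Lq s _ _ hpq).trans ?_
  simp only [← ENNReal.rpow_mul, one_div, inv_inv, mul_inv_cancel₀ h0.ne', mul_inv_cancel₀ h2.ne',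
    ENNReal.rpow_one]
  gcongr <;> exact ENNReal.sum_le_tsum s

lemma sum_rpow_mul_rpow_le {ι : Type*} [Fintype ι] {θ : ℝ} (h0 : 0 ≤ θ) (h1 : θ ≤ 1)
    (a b : ι → ℝ≥0∞) :
    ∑ i, a i ^ θ * b i ^ (1 - θ) ≤ (∑ i, a i) ^ θ * (∑ i, b i) ^ (1 - θ) := by
  simpa [tsum_fintype] using tsum_rpow_mul_rpow_le h0 h1 a b

/-- Interpolation between the Schur tests on `ℓ^1` and `ℓ^2`. -/
lemma sum_rpow_le_of_doubly_substochastic {κ ι : Type*} [Fintype κ] {p : ℝ} (hp : p ∈ Icc (1 : ℝ) 2)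
    (s : ι → ℝ≥0∞) (x y : κ → ι → ℝ≥0∞) (D : ℝ≥0∞) (hx : ∀ m, ∑ n, x n m ≤ D ^ (2 : ℝ))
    (hy : ∀ m, ∑ n, y n m ≤ 1) (hy' : ∀ n, ∑' m, y n m ≤ 1) :
    ∑ n, (∑' m, s m * (x n m ^ (1 / 2 : ℝ) * y n m ^ (1 / 2 : ℝ))) ^ p ≤ D ^ p * ∑' m, s m ^ p := by
  have hp0 : 0 < p := by linarith [hp.1]
  have h1p : 1 / p ≤ 1 := by rw [div_le_one hp0]; exact hp.1
  have h2p : 1 / 2 ≤ 1 / p := one_div_le_one_div_of_le hp0 hp.2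
  have hstep : ∀ n, (∑' m, s m * (x n m ^ (1 / 2 : ℝ) * y n m ^ (1 / 2 : ℝ))) ^ p ≤
      ∑' m, s m ^ p * (x n m ^ (p / 2) * y n m ^ (1 - p / 2)) := by
    intro n
    -- Hölder in `m` with the weight `y n ·`, of total mass at most 1. The exponent of `y` splits as
    -- `1/2 = (1 - p/2)/p + (1 - 1/p)`, and `1 - p/2 ≥ 0` is where `p ≤ 2` enters.
    have h := tsum_rpow_mul_rpow_le (by positivity) h1p
      (fun m => s m ^ p * (x n m ^ (p / 2) * y n m ^ (1 - p / 2))) (y n)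
    have h' : ∑' m, s m * (x n m ^ (1 / 2 : ℝ) * y n m ^ (1 / 2 : ℝ)) ≤
        (∑' m, s m ^ p * (x n m ^ (p / 2) * y n m ^ (1 - p / 2))) ^ (1 / p) := by
      calc _ = ∑' m, (s m ^ p * (x n m ^ (p / 2) * y n m ^ (1 - p / 2))) ^ (1 / p)
              * y n m ^ (1 - 1 / p) := by
            refine tsum_congr fun m => ?_
            rw [ENNReal.mul_rpow_of_nonneg _ _ (by positivity),
              ENNReal.mul_rpow_of_nonneg _ _ (by positivity), ← ENNReal.rpow_mul,
              ← ENNReal.rpow_mul, ← ENNReal.rpow_mul, mul_one_div_cancel hp0.ne', ENNReal.rpow_one,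
              mul_assoc, mul_assoc, ← ENNReal.rpow_add_of_nonneg]
            · congr 3
              · field_simp
              · field_simp; ring
            · have : (1 - p / 2) * (1 / p) = 1 / p - 1 / 2 := by field_simp
              rw [this]; linarith
            · linarith
        _ ≤ _ := h
        _ ≤ (∑' m, s m ^ p * (x n m ^ (p / 2) * y n m ^ (1 - p / 2))) ^ (1 / p) * 1 := by
            gcongr
            exact ENNReal.rpow_le_one (hy' n) (by linarith)
        _ = _ := mul_one _
    rwa [one_div p, ENNReal.le_rpow_inv_iff hp0] at h'
  calc _ ≤ ∑ n, ∑' m, s m ^ p * (x n m ^ (p / 2) * y n m ^ (1 - p / 2)) :=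
        Finset.sum_le_sum fun n _ => hstep n
    _ = ∑' m, s m ^ p * ∑ n, (x n m ^ (p / 2) * y n m ^ (1 - p / 2)) := by
        rw [← Summable.tsum_finsetSum fun _ _ => ENNReal.summable]
        simp_rw [Finset.mul_sum]
    _ ≤ ∑' m, s m ^ p * D ^ p := by
        refine ENNReal.tsum_le_tsum fun m => mul_le_mul_right ?_ _
        -- Hölder in `n` with exponent `p/2`; only the sums of `x` over `n` are needed, never those
        -- over `m`.
        refine (sum_rpow_mul_rpow_le (by linarith) (by linarith [hp.2]) _ _).trans ?_
        calc _ ≤ (D ^ (2 : ℝ)) ^ (p / 2) * 1 := by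
              gcongr
              · exact hx m
              · exact ENNReal.rpow_le_one (hy m) (by linarith [hp.2])
          _ = D ^ p := by rw [← ENNReal.rpow_mul, mul_one]; congr 1; ring
    _ = _ := by rw [ENNReal.tsum_mul_right, mul_comm]

variable {H : Type u} [NormedAddCommGroup H] [InnerProductSpace ℂ H] [CompleteSpace H]

lemma enorm_sq_eq_ofReal {E : Type*} [SeminormedAddCommGroup E] (x : E) :
    ‖x‖ₑ ^ (2 : ℝ) = ENNReal.ofReal (‖x‖ ^ 2) := by
  rw [← ofReal_norm, ENNReal.ofReal_rpow_of_nonneg (norm_nonneg _) (by norm_num)]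
  norm_num

omit [CompleteSpace H] in
lemma tsum_enorm_inner_sq_le {ι : Type*} {v : ι → H} (hv : Orthonormal ℂ v) (h : H) :
    ∑' i, ‖⟪v i, h⟫_ℂ‖ₑ ^ (2 : ℝ) ≤ ‖h‖ₑ ^ (2 : ℝ) := by
  refine ENNReal.summable.tsum_le_of_sum_le fun s => ?_
  simp_rw [enorm_sq_eq_ofReal]
  rw [← ENNReal.ofReal_sum_of_nonneg fun _ _ => by positivity]
  exact ENNReal.ofReal_le_ofReal (hv.sum_inner_products_le h)

omit [CompleteSpace H] in
lemma enorm_inner_symm (x y : H) : ‖⟪x, y⟫_ℂ‖ₑ = ‖⟪y, x⟫_ℂ‖ₑ := by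
  rw [← inner_conj_symm, RCLike.enorm_conj]

lemma sum_enorm_sq_le {κ : Type*} [Fintype κ] {E : Type*} [SeminormedAddCommGroup E] {w : κ → E}
    {D c : ℝ} (hD : 0 ≤ D) (hc : 0 ≤ c) (h : ∑ j, ‖w j‖ ^ 2 ≤ D ^ 2 * c ^ 2) :
    ∑ j, ‖w j‖ₑ ^ (2 : ℝ) ≤ (ENNReal.ofReal D * ENNReal.ofReal c) ^ (2 : ℝ) := by
  simp_rw [enorm_sq_eq_ofReal]
  rw [← ENNReal.ofReal_sum_of_nonneg fun _ _ => by positivity, ← ENNReal.ofReal_mul hD,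
    ENNReal.ofReal_rpow_of_nonneg (by positivity) (by norm_num)]
  refine ENNReal.ofReal_le_ofReal (h.trans (le_of_eq ?_))
  rw [← mul_pow]; norm_num

/-- The `S_p` bound for `T ↦ ∑ α_j T X_j`, where `(α_j)` is a row and column contraction and `(X_j)`
a row of norm `D`. -/
lemma diagNorm_sum_mul_mul_le {p : ℝ} (hp : p ∈ Icc (1 : ℝ) 2) {κ : Type*} [Fintype κ]
    (α X : κ → H →L[ℂ] H) (T : H →L[ℂ] H) {ι : Type*} {v : ι → H} (hv : Orthonormal ℂ v)
    (hT : ∀ h, HasSum (fun i => ⟪star T (v i), h⟫_ℂ • v i) (T h)) {D : ℝ} (hD : 0 ≤ D)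
    (hα : ∀ h, ∑ j, ‖α j h‖ ^ 2 ≤ ‖h‖ ^ 2) (hα' : ∀ h, ∑ j, ‖star (α j) h‖ ^ 2 ≤ ‖h‖ ^ 2)
    (hX : ∀ h, ∑ j, ‖star (X j) h‖ ^ 2 ≤ D ^ 2 * ‖h‖ ^ 2) :
    diagNorm p (∑ j, α j * T * X j) ≤
      ENNReal.ofReal D * (∑' i, ‖star T (v i)‖ₑ ^ p) ^ (1 / p) := by
  have hp0 : 0 < p := by linarith [hp.1]
  refine diagNorm_le fun N e f he hf => ?_
  -- The normalised vectors `T* v_m`; the value is zero when `T* v_m = 0`, since `0⁻¹ = 0`.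
  set u : ι → H := fun m => ((‖star T (v m)‖⁻¹ : ℝ) : ℂ) • star T (v m) with hu
  have hu1 : ∀ m, ‖u m‖ ≤ 1 := fun m => by
    simp only [hu, norm_smul, Complex.norm_real, norm_inv, norm_norm]
    exact inv_mul_le_one
  have hTu : ∀ m, star T (v m) = ((‖star T (v m)‖ : ℝ) : ℂ) • u m := fun m => by
    rcases eq_or_ne (star T (v m)) 0 with h0 | h0
    · simp [hu, h0]
    · rw [hu, smul_smul, ← Complex.ofReal_mul, mul_inv_cancel₀ (norm_ne_zero_iff.2 h0)]; simp
  -- By Bessel for `e` and the row bound for the `X_j`, the sums of `x` over `n` are at most `D²`.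
  -- By Bessel for `f` and `v`, with the column and row bounds for the `α_j`, the matrix `y` is
  -- doubly substochastic.
  set x : Fin N → ι → ℝ≥0∞ := fun n m => ∑ j, ‖⟪u m, X j (e n)⟫_ℂ‖ₑ ^ (2 : ℝ) with hxdef
  set y : Fin N → ι → ℝ≥0∞ := fun n m => ∑ j, ‖⟪star (α j) (f n), v m⟫_ℂ‖ₑ ^ (2 : ℝ) with hydef
  have hbound := sum_rpow_le_of_doubly_substochastic hp (fun m => ‖star T (v m)‖ₑ) x y
    (ENNReal.ofReal D) ?_ ?_ ?_
  · rw [one_div, ENNReal.rpow_inv_le_iff hp0, ENNReal.mul_rpow_of_nonneg _ _ hp0.le,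
      ← ENNReal.rpow_mul, inv_mul_cancel₀ hp0.ne', ENNReal.rpow_one]
    refine le_trans (Finset.sum_le_sum fun n _ => ?_) hbound
    refine ENNReal.rpow_le_rpow ?_ hp0.le
    have h1 : HasSum (fun m => ∑ j, ⟪star T (v m), X j (e n)⟫_ℂ * ⟪star (α j) (f n), v m⟫_ℂ)
        ⟪f n, (∑ j, α j * T * X j) (e n)⟫_ℂ := by
      have : ⟪f n, (∑ j, α j * T * X j) (e n)⟫_ℂ = ∑ j, ⟪star (α j) (f n), T (X j (e n))⟫_ℂ := by
        rw [sum_apply, inner_sum]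
        refine Finset.sum_congr rfl fun j _ => ?_
        rw [ContinuousLinearMap.star_eq_adjoint, ContinuousLinearMap.adjoint_inner_left]
        rfl
      rw [this]
      refine hasSum_sum fun j _ => ?_
      have := (hT (X j (e n))).mapL (innerSL ℂ (star (α j) (f n)))
      simpa [inner_smul_right] using this
    rw [← h1.tsum_eq]
    refine enorm_tsum_le_tsum_enorm.trans (ENNReal.tsum_le_tsum fun m => ?_)
    refine (enorm_sum_le _ _).trans ?_
    -- Cauchy–Schwarz in the index `j`.
    have h2 := sum_rpow_mul_rpow_le (θ := 1 / 2) (by norm_num) (by norm_num)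
      (fun j => ‖⟪u m, X j (e n)⟫_ℂ‖ₑ ^ (2 : ℝ)) (fun j => ‖⟪star (α j) (f n), v m⟫_ℂ‖ₑ ^ (2 : ℝ))
    rw [show (1 - 1 / 2 : ℝ) = 1 / 2 by norm_num] at h2
    refine le_trans (le_of_eq ?_) (mul_le_mul_right h2 _)
    rw [Finset.mul_sum]
    refine Finset.sum_congr rfl fun j _ => ?_
    rw [← ENNReal.rpow_mul, ← ENNReal.rpow_mul]
    norm_num
    conv_lhs => rw [hTu m]
    rw [inner_smul_left, enorm_mul, mul_assoc]
    congr 1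
    rw [RCLike.enorm_conj, ← ofReal_norm, ← ofReal_norm, Complex.norm_real, norm_norm]
  · intro m
    simp only [hxdef]
    rw [Finset.sum_comm]
    calc _ ≤ ∑ j, ‖star (X j) (u m)‖ₑ ^ (2 : ℝ) := by
          refine Finset.sum_le_sum fun j _ => ?_
          refine le_trans (le_of_eq ?_) (tsum_enorm_inner_sq_le he (star (X j) (u m)))
          rw [tsum_fintype]
          refine Finset.sum_congr rfl fun n _ => ?_
          rw [ContinuousLinearMap.star_eq_adjoint, ContinuousLinearMap.adjoint_inner_right,
            enorm_inner_symm]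
      _ ≤ (ENNReal.ofReal D * ENNReal.ofReal ‖u m‖) ^ (2 : ℝ) :=
          sum_enorm_sq_le hD (norm_nonneg _) (hX _)
      _ ≤ (ENNReal.ofReal D * 1) ^ (2 : ℝ) := by
          gcongr
          simpa using ENNReal.ofReal_le_ofReal (hu1 m)
      _ = _ := by rw [mul_one]
  · intro m
    simp only [hydef]
    rw [Finset.sum_comm]
    calc _ ≤ ∑ j, ‖α j (v m)‖ₑ ^ (2 : ℝ) := by
          refine Finset.sum_le_sum fun j _ => ?_
          refine le_trans (le_of_eq ?_) (tsum_enorm_inner_sq_le hf (α j (v m)))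
          rw [tsum_fintype]
          refine Finset.sum_congr rfl fun n _ => ?_
          rw [ContinuousLinearMap.star_eq_adjoint, ContinuousLinearMap.adjoint_inner_left]
      _ ≤ (ENNReal.ofReal 1 * ENNReal.ofReal ‖v m‖) ^ (2 : ℝ) :=
          sum_enorm_sq_le zero_le_one (norm_nonneg _) (by simpa using hα (v m))
      _ = 1 := by simp [hv.1 m]
  · intro n
    simp only [hydef]
    rw [Summable.tsum_finsetSum fun _ _ => ENNReal.summable]
    calc _ ≤ ∑ j, ‖star (α j) (f n)‖ₑ ^ (2 : ℝ) := by
          refine Finset.sum_le_sum fun j _ => ?_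
          refine le_trans (le_of_eq ?_) (tsum_enorm_inner_sq_le hv (star (α j) (f n)))
          exact tsum_congr fun m => by rw [enorm_inner_symm]
      _ ≤ (ENNReal.ofReal 1 * ENNReal.ofReal ‖f n‖) ^ (2 : ℝ) :=
          sum_enorm_sq_le zero_le_one (norm_nonneg _) (by simpa using hα' (f n))
      _ = 1 := by simp [hf.1 n]

/-- `R*` kills the orthogonal complement of the range of `R`, so `T* y = (T - R)* y`. -/
lemma norm_star_apply_le_of_orthogonal (T R : H →L[ℂ] H) {y : H} (hy : ∀ x, ⟪y, R x⟫_ℂ = 0) :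
    ‖star T y‖ ≤ ‖T - R‖ * ‖y‖ := by
  have : star R y = 0 := by
    refine ext_inner_right ℂ fun x => ?_
    rw [ContinuousLinearMap.star_eq_adjoint, ContinuousLinearMap.adjoint_inner_left, hy,
      inner_zero_left]
  have h2 : star T y = star (T - R) y := by rw [star_sub, sub_apply, this, sub_zero]
  rw [h2]
  exact ((star (T - R)).le_opNorm y).trans (by rw [norm_star])

/-- A dyadic substitute for the Schmidt expansion. Let `R_k` be nearly optimal approximations of
rank at most `2^k`, `V_k` the sum of the ranges of `R_0, …, R_{k-1}`, and `W_k` the orthogonal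
complement of `V_k` in `V_{k+1}`. Unit vectors of `W_{k+1}` are orthogonal to the range of `R_k`, so
`T*` has norm about `s_{2^k}` on them, and Cauchy condensation sums the blocks. -/
lemma exists_orthonormal_expansion {p : ℝ} (hp : p ∈ Icc (1 : ℝ) 2) (T : H →L[ℂ] H)
    (hT : MemSchatten p T) :
    ∃ (ι : Type) (_ : Countable ι) (v : ι → H), Orthonormal ℂ v ∧
      (∀ h, HasSum (fun i => ⟪star T (v i), h⟫_ℂ • v i) (T h)) ∧
      ∑' i, ‖star T (v i)‖ₑ ^ p ≤ 100 * schattenNorm p T ^ p := by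
  have hp0 : 0 < p := by linarith [hp.1]
  rcases eq_or_ne T 0 with rfl | hT0
  · exact ⟨Empty, inferInstance, Empty.elim, ⟨fun i => i.elim, fun i => i.elim⟩,
      fun h => by simp [hasSum_empty], by simp⟩
  have hδ : 0 < ‖T‖ := norm_pos_iff.2 hT0
  set s : ℕ → ℝ := singularValue T with hs
  set S : ℝ≥0∞ := ∑' n, ENNReal.ofReal (s n) ^ p with hS
  have hST : schattenNorm p T ^ p = S := by
    rw [schattenNorm, ← ENNReal.rpow_mul, one_div_mul_cancel hp0.ne', ENNReal.rpow_one]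
  have hSfin : S ≠ ∞ := by
    rw [← hST]; exact ENNReal.rpow_ne_top_of_nonneg hp0.le hT.ne
  -- The error `‖T‖ / 4^k` beats the at most `2^(k+2)` vectors of block `k + 1` and leaves a
  -- geometric series.
  choose R hRrank hR using fun k : ℕ =>
    exists_rank_le_norm_sub_lt T (2 ^ k) (ε := ‖T‖ / 4 ^ k) (by positivity)
  have hRfd : ∀ k, FiniteDimensional ℂ (LinearMap.range (R k : H →ₗ[ℂ] H)) := fun k =>
    Module.rank_lt_aleph0_iff.1 ((hRrank k).trans_lt (Cardinal.natCast_lt_aleph0))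
  have hRdim : ∀ k, Module.finrank ℂ (LinearMap.range (R k : H →ₗ[ℂ] H)) ≤ 2 ^ k := fun k =>
    Module.finrank_le_of_rank_le (hRrank k)
  set V : ℕ → Submodule ℂ H := fun k =>
    (Finset.range k).sup fun i => LinearMap.range (R i : H →ₗ[ℂ] H) with hV
  have hVsucc : ∀ k, V (k + 1) = LinearMap.range (R k : H →ₗ[ℂ] H) ⊔ V k := fun k => by
    simp only [hV, Finset.range_add_one, Finset.sup_insert]
  have hVmono : Monotone V := fun i j hij => Finset.sup_mono (Finset.range_mono hij)
  have hVfd : ∀ k, FiniteDimensional ℂ (V k) := fun k => by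
    exact inferInstanceAs (FiniteDimensional ℂ
      ((Finset.range k).sup fun i => LinearMap.range (R i : H →ₗ[ℂ] H) : Submodule ℂ H))
  have hVdim : ∀ k, Module.finrank ℂ (V k) ≤ 2 ^ k := by
    intro k
    induction k with
    | zero =>
      have : V 0 = ⊥ := rfl
      rw [this, finrank_bot]
      exact Nat.zero_le _
    | succ k ih =>
      rw [hVsucc]
      refine (Submodule.finrank_add_le_finrank_add_finrank _ _).trans ?_
      rw [pow_succ]
      linarith [hRdim k]
  set W : ℕ → Submodule ℂ H := fun k => (V k)ᗮ ⊓ V (k + 1) with hW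
  have hWV : ∀ k, W k ≤ V (k + 1) := fun k => inf_le_right
  have hWfd : ∀ k, FiniteDimensional ℂ (W k) := fun k => Submodule.finiteDimensional_of_le (hWV k)
  have hWdim : ∀ k, Module.finrank ℂ (W k) ≤ 2 ^ (k + 1) := fun k =>
    (Submodule.finrank_mono (hWV k)).trans (hVdim _)
  have hWlt : ∀ i j, i < j → W i ⟂ W j := by
    intro i j hij
    rw [Submodule.isOrtho_iff_inner_eq]
    intro x hx y hy
    exact (Submodule.mem_orthogonal _ _).1 hy.1 _ (hVmono hij (hWV i hx))
  have hOF : OrthogonalFamily ℂ (fun k => W k) fun k => (W k).subtypeₗᵢ :=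
    OrthogonalFamily.of_pairwise fun i j hij => by
      rcases lt_or_gt_of_ne hij with h | h
      · exact hWlt i j h
      · exact (hWlt j i h).symm
  set v : (Σ k, Fin (Module.finrank ℂ (W k))) → H :=
    fun a => (stdOrthonormalBasis ℂ (W a.1) a.2 : H) with hv
  have hvo : Orthonormal ℂ v :=
    hOF.orthonormal_sigma_orthonormal fun k => (stdOrthonormalBasis ℂ (W k)).orthonormal
  have hvW : ∀ a, v a ∈ W a.1 := fun a => (stdOrthonormalBasis ℂ (W a.1) a.2).2
  -- A vector orthogonal to all blocks is orthogonal to every range `R_k`, hence `‖T* y‖ ≤ (s_{2^k}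
  -- + ‖T‖ / 4^k) ‖y‖ → 0`.
  have hker : ∀ y, (∀ a, ⟪v a, y⟫_ℂ = 0) → star T y = 0 := by
    intro y hy
    have hyW : ∀ k, ∀ z ∈ W k, ⟪z, y⟫_ℂ = 0 := by
      intro k z hz
      have h1 := congrArg (Subtype.val) ((stdOrthonormalBasis ℂ (W k)).sum_repr ⟨z, hz⟩)
      simp only [Submodule.coe_sum, Submodule.coe_smul] at h1
      rw [← h1, sum_inner]
      refine Finset.sum_eq_zero fun i _ => ?_
      rw [inner_smul_left]
      exact mul_eq_zero_of_right _ (hy ⟨k, i⟩)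
    have hyV : ∀ k, ∀ z ∈ V k, ⟪z, y⟫_ℂ = 0 := by
      intro k
      induction k with
      | zero => intro z hz; simp [hV] at hz; simp [hz]
      | succ k ih =>
        intro z hz
        have h1 : (V k).starProjection z ∈ V k := Submodule.starProjection_apply_mem _ _
        have h2 : z - (V k).starProjection z ∈ W k :=
          ⟨(V k).sub_starProjection_mem_orthogonal z,
            Submodule.sub_mem _ hz (hVmono (Nat.le_succ k) h1)⟩
        have := hyW k _ h2
        rwa [inner_sub_left, ih _ h1, sub_zero] at this
    have hlim : Filter.Tendsto (fun k : ℕ => (s (2 ^ k) + ‖T‖ / 4 ^ k) * ‖y‖) atTop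
        (𝓝 ((0 + 0) * ‖y‖)) := by
      refine Tendsto.mul_const _ (Tendsto.add ?_ ?_)
      · have h1 := ENNReal.tendsto_atTop_zero_of_tsum_ne_top hSfin
        have h2 : Tendsto (fun n => ENNReal.ofReal (s n)) atTop (𝓝 0) := by
          have := (ENNReal.continuous_rpow_const (y := 1 / p)).tendsto 0 |>.comp h1
          simp only [Function.comp_def, ← ENNReal.rpow_mul, mul_one_div_cancel hp0.ne',
            ENNReal.rpow_one] at this
          rwa [ENNReal.zero_rpow_of_pos (by positivity)] at this
        have h3 := (ENNReal.tendsto_toReal ENNReal.zero_ne_top).comp h2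
        have h4 : Tendsto s atTop (𝓝 0) := by
          simpa [Function.comp_def, ENNReal.toReal_ofReal (singularValue_nonneg T _), hs] using h3
        exact h4.comp (tendsto_pow_atTop_atTop_of_one_lt (by norm_num))
      · simpa [div_eq_mul_inv] using (tendsto_pow_atTop_nhds_zero_of_lt_one (r := (4 : ℝ)⁻¹)
          (by norm_num) (by norm_num)).const_mul ‖T‖
    have hle : ‖star T y‖ ≤ (0 + 0) * ‖y‖ := by
      refine ge_of_tendsto hlim (Eventually.of_forall fun k => ?_)
      refine (norm_star_apply_le_of_orthogonal T (R k) fun x => ?_).trans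
        (mul_le_mul_of_nonneg_right (hR k).le (norm_nonneg _))
      rw [← inner_conj_symm, hyV (k + 1) (R k x), map_zero]
      rw [hVsucc]
      exact Submodule.mem_sup_left ⟨x, rfl⟩
    exact norm_le_zero_iff.1 (hle.trans (by simp))
  refine ⟨_, inferInstance, v, hvo, fun h => ?_, ?_⟩
  -- Expand `T h` in a Hilbert basis containing the system `v`; the added basis vectors are
  -- annihilated by `T*` and contribute nothing.
  · obtain ⟨w, b, hw, hb⟩ := hvo.toSubtypeRange.exists_hilbertBasis_extension
    have h1 := b.hasSum_repr (T h)
    set g : (Σ k, Fin (Module.finrank ℂ (W k))) → w := fun a => ⟨v a, hw ⟨a, rfl⟩⟩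
    have hg : Function.Injective g := fun a a' haa =>
      hvo.linearIndependent.injective (congrArg Subtype.val haa)
    have hbv : ∀ i : w, ⟪star T (b i), h⟫_ℂ = b.repr (T h) i := fun i => by
      rw [b.repr_apply_apply, ContinuousLinearMap.star_eq_adjoint,
        ContinuousLinearMap.adjoint_inner_left]
    have h2 := (hg.hasSum_iff (f := fun i => b.repr (T h) i • b i) (a := T h) ?_).2 h1
    · have h3 : (fun a => ⟪star T (v a), h⟫_ℂ • v a) = (fun i => b.repr (T h) i • b i) ∘ g := by
        funext a
        simp only [Function.comp_apply, ← hbv, hb]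
        rfl
      rw [h3]
      exact h2
    · intro i hi
      have : star T (b i) = 0 := hker _ fun a => by
        have hne : g a ≠ i := fun h => hi ⟨a, h⟩
        have := b.orthonormal.2 hne
        rw [hb] at this ⊢
        exact this
      rw [← hbv, this, inner_zero_left, zero_smul]
  · rw [hST, ENNReal.tsum_sigma']
    have hs0 : s 0 = ‖T‖ := singularValue_zero T
    have hs0S : ENNReal.ofReal ‖T‖ ^ p ≤ S := by
      rw [← hs0]; exact ENNReal.le_tsum (f := fun n => ENNReal.ofReal (s n) ^ p) 0
    have hblock : ∀ k (c : ℝ≥0∞), (∀ x ∈ W k, ‖x‖ = 1 → ‖star T x‖ₑ ^ p ≤ c) →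
        ∑' i, ‖star T (v ⟨k, i⟩)‖ₑ ^ p ≤ 2 ^ (k + 1) * c := by
      intro k c hc
      rw [tsum_fintype]
      refine (Finset.sum_le_card_nsmul _ _ c fun i _ => hc _ (hvW ⟨k, i⟩) (hvo.1 ⟨k, i⟩)).trans ?_
      rw [nsmul_eq_mul]
      gcongr
      rw [Finset.card_univ, Fintype.card_fin]
      exact_mod_cast hWdim k
    rw [tsum_eq_zero_add' ENNReal.summable]
    have hfirst : ∑' i, ‖star T (v ⟨0, i⟩)‖ₑ ^ p ≤ 2 * S := by
      refine (hblock 0 S fun x _ hx1 => le_trans ?_ hs0S).trans (by norm_num)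
      rw [← ofReal_norm]
      gcongr
      simpa [hx1] using (star T).le_opNorm x
    have hnext : ∀ k, ∑' i, ‖star T (v ⟨k + 1, i⟩)‖ₑ ^ p ≤
        16 * (2 ^ k * ENNReal.ofReal (s (2 ^ k)) ^ p) + 16 * (S * 2⁻¹ ^ k) := by
      intro k
      refine (hblock (k + 1) ((ENNReal.ofReal (s (2 ^ k)) + ENNReal.ofReal ‖T‖ * 4⁻¹ ^ k) ^ p)
        fun x hx hx1 => ?_).trans ?_
      · rw [← ofReal_norm]
        gcongr
        have h1 : ‖star T x‖ ≤ s (2 ^ k) + ‖T‖ * (4 : ℝ)⁻¹ ^ k := by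
          refine (norm_star_apply_le_of_orthogonal T (R k) fun z => ?_).trans ?_
          · refine (Submodule.mem_orthogonal' _ _).1 hx.1 _ ?_
            rw [hVsucc]; exact Submodule.mem_sup_left ⟨z, rfl⟩
          · rw [hx1, mul_one, inv_pow, ← div_eq_mul_inv]; exact (hR k).le
        refine (ENNReal.ofReal_le_ofReal h1).trans (le_of_eq ?_)
        rw [ENNReal.ofReal_add (singularValue_nonneg _ _) (by positivity),
          ENNReal.ofReal_mul (norm_nonneg _), ENNReal.ofReal_pow (by norm_num),
          ENNReal.ofReal_inv_of_pos (by norm_num)]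
        norm_num [hs]
      · have h2p : (2 : ℝ≥0∞) ^ (p - 1) ≤ 2 := by
          calc (2 : ℝ≥0∞) ^ (p - 1) ≤ 2 ^ (1 : ℝ) :=
                ENNReal.rpow_le_rpow_of_exponent_le (by norm_num) (by linarith [hp.2])
            _ = 2 := by simp
        have h4 : ((4 : ℝ≥0∞)⁻¹ ^ k) ^ p ≤ 4⁻¹ ^ k := by
          calc ((4 : ℝ≥0∞)⁻¹ ^ k) ^ p ≤ (4⁻¹ ^ k) ^ (1 : ℝ) :=
                ENNReal.rpow_le_rpow_of_exponent_ge (pow_le_one₀ (by simp) (by norm_num)) hp.1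
            _ = 4⁻¹ ^ k := by simp
        have h24 : (2 : ℝ≥0∞) ^ k * 4⁻¹ ^ k = 2⁻¹ ^ k := by
          rw [← mul_pow]; congr 1
          rw [show (4 : ℝ≥0∞) = 2 * 2 by norm_num, ENNReal.mul_inv (by simp) (by simp), ← mul_assoc,
            ENNReal.mul_inv_cancel (by simp) (by simp), one_mul]
        calc (2 : ℝ≥0∞) ^ (k + 1 + 1) *
              (ENNReal.ofReal (s (2 ^ k)) + ENNReal.ofReal ‖T‖ * 4⁻¹ ^ k) ^ p
            ≤ 2 ^ (k + 1 + 1) * (2 * (ENNReal.ofReal (s (2 ^ k)) ^ p + S * 4⁻¹ ^ k)) := by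
              gcongr
              refine (ENNReal.rpow_add_le_mul_rpow_add_rpow _ _ hp.1).trans ?_
              gcongr
              rw [ENNReal.mul_rpow_of_nonneg _ _ hp0.le]
              gcongr
          _ = 8 * (2 ^ k * ENNReal.ofReal (s (2 ^ k)) ^ p) + 8 * (S * (2 ^ k * 4⁻¹ ^ k)) := by ring
          _ ≤ _ := by rw [h24]; gcongr <;> norm_num
    -- Cauchy condensation for the decreasing sequence `s_n^p`.
    have hcond : ∑' k : ℕ, 2 ^ k * ENNReal.ofReal (s (2 ^ k)) ^ p ≤ 3 * S := by
      refine (ENNReal.tsum_condensed_le (f := fun n => ENNReal.ofReal (s n) ^ p) fun m n _ hmn => ?_).trans ?_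
      · gcongr; exact singularValue_antitone T hmn
      · have : ENNReal.ofReal (s 1) ^ p ≤ S := ENNReal.le_tsum (f := fun n => ENNReal.ofReal (s n) ^ p) 1
        calc _ ≤ S + 2 * S := by gcongr
          _ = 3 * S := by ring
    calc _ ≤ 2 * S + ∑' k : ℕ, (16 * (2 ^ k * ENNReal.ofReal (s (2 ^ k)) ^ p) + 16 * (S * 2⁻¹ ^ k)) :=
          add_le_add hfirst (ENNReal.tsum_le_tsum hnext)
      _ ≤ 2 * S + (16 * (3 * S) + 16 * (S * 2)) := by
          rw [ENNReal.tsum_add, ENNReal.tsum_mul_left, ENNReal.tsum_mul_left, ENNReal.tsum_mul_left,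
            ENNReal.tsum_geometric, ENNReal.one_sub_inv_two, inv_inv]
          gcongr
      _ = 82 * S := by ring
      _ ≤ 100 * S := by gcongr; norm_num

end Factorization

end NoncommFun

namespace NoncommFun

/-! ### Projection-valued set functions with scalar diagonal measures. -/

section ProjectionMeasures

open Filter Topology

variable {H : Type u} [NormedAddCommGroup H] [InnerProductSpace ℂ H] [CompleteSpace H]
  {X : Type*} [MeasurableSpace X]

/-- Multiplicative projection-valued set functions whose diagonal entries are finite measures. -/
structure IsProjectionMeasure (E : Set X → H →L[ℂ] H) : Prop where
  proj : ∀ S, MeasurableSet S → IsStarProjection (E S)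
  inter : ∀ S T, MeasurableSet S → MeasurableSet T → E (S ∩ T) = E S * E T
  meas : ∀ x, ∃ μ : Measure X, IsFiniteMeasure μ ∧
    ∀ S, MeasurableSet S → ((μ.real S : ℝ) : ℂ) = ⟪x, E S x⟫_ℂ

lemma inner_self_of_isStarProjection {P : H →L[ℂ] H} (hP : IsStarProjection P) (x y : H) :
    ⟪x, P y⟫_ℂ = ⟪P x, P y⟫_ℂ := by
  have h1 : P (P y) = P y := congrArg (fun f : H →L[ℂ] H => f y) hP.isIdempotentElem
  have h2 : star P = P := hP.isSelfAdjoint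
  rw [ContinuousLinearMap.star_eq_adjoint] at h2
  rw [← ContinuousLinearMap.adjoint_inner_right, h2, h1]

lemma inner_self_eq_norm_sq_of_isStarProjection {P : H →L[ℂ] H} (hP : IsStarProjection P) (x : H) :
    ⟪x, P x⟫_ℂ = ((‖P x‖ ^ 2 : ℝ) : ℂ) := by
  rw [inner_self_of_isStarProjection hP, inner_self_eq_norm_sq_to_K]; norm_cast

omit [CompleteSpace H] in
lemma eq_of_inner_self_eq {S T : H →L[ℂ] H} (h : ∀ x, ⟪x, S x⟫_ℂ = ⟪x, T x⟫_ℂ) : S = T := by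
  have := (ext_inner_map (S : H →ₗ[ℂ] H) (T : H →ₗ[ℂ] H)).1 fun x => by
    have := congrArg (starRingEnd ℂ) (h x)
    rwa [inner_conj_symm, inner_conj_symm] at this
  ext x
  exact congrArg (fun f : H →ₗ[ℂ] H => f x) this

namespace IsProjectionMeasure

variable {E : Set X → H →L[ℂ] H} (hE : IsProjectionMeasure E)
include hE

lemma measureReal_eq {μ : Measure X} {x : H}
    (h : ∀ S, MeasurableSet S → ((μ.real S : ℝ) : ℂ) = ⟪x, E S x⟫_ℂ) {S : Set X}
    (hS : MeasurableSet S) : μ.real S = ‖E S x‖ ^ 2 := by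
  have := h S hS
  rw [inner_self_eq_norm_sq_of_isStarProjection (hE.proj S hS)] at this
  exact_mod_cast this

lemma empty : E ∅ = 0 := by
  refine eq_of_inner_self_eq fun x => ?_
  obtain ⟨μ, _, h⟩ := hE.meas x
  rw [← h ∅ .empty]; simp

lemma union {S T : Set X} (hS : MeasurableSet S) (hT : MeasurableSet T) (h : Disjoint S T) :
    E (S ∪ T) = E S + E T := by
  refine eq_of_inner_self_eq fun x => ?_
  obtain ⟨μ, _, hμ⟩ := hE.meas x
  rw [add_apply, inner_add_right, ← hμ _ hS, ← hμ _ hT, ← hμ _ (hS.union hT),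
    measureReal_union h hT]
  push_cast; rfl

lemma biUnion_finset {ι : Type*} (s : Finset ι) (S : ι → Set X) (hS : ∀ i, MeasurableSet (S i))
    (hd : Pairwise (Function.onFun Disjoint S)) : E (⋃ i ∈ s, S i) = ∑ i ∈ s, E (S i) := by
  classical
  induction s using Finset.induction_on with
  | empty => simp [hE.empty]
  | insert a s ha ih =>
    rw [Finset.set_biUnion_insert, Finset.sum_insert ha,
      hE.union (hS a) (Finset.measurableSet_biUnion _ fun i _ => hS i), ih]
    rw [disjoint_iUnion₂_right]
    exact fun i hi => hd (by rintro rfl; exact ha hi)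

lemma mul_eq_zero {S T : Set X} (hS : MeasurableSet S) (hT : MeasurableSet T) (h : Disjoint S T) :
    E S * E T = 0 := by
  rw [← hE.inter _ _ hS hT, h.inter_eq, hE.empty]

/-- Scalar countable additivity gives strong countable additivity, because the squared norm of the
remainder is `μ_x` of the remaining union. -/
lemma hasSum_iUnion (S : ℕ → Set X) (hS : ∀ i, MeasurableSet (S i))
    (hd : Pairwise (Function.onFun Disjoint S)) (x : H) :
    HasSum (fun i => E (S i) x) (E (⋃ i, S i) x) := by
  obtain ⟨μ, _, hμ⟩ := hE.meas x
  have hU : MeasurableSet (⋃ i, S i) := .iUnion hS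
  have hsum : HasSum (fun i => μ.real (S i)) (μ.real (⋃ i, S i)) := by
    have h1 := (measure_iUnion hd hS (μ := μ))
    have h2 : ∑' i, μ (S i) ≠ ∞ := by rw [← h1]; exact measure_ne_top _ _
    have := ENNReal.hasSum_toReal h2
    rw [← ENNReal.tsum_toReal_eq (fun i => measure_ne_top _ _), ← h1] at this
    exact this
  have key : ∀ s : Finset ℕ, ‖∑ i ∈ s, E (S i) x - E (⋃ i, S i) x‖ ^ 2 =
      μ.real (⋃ i, S i) - ∑ i ∈ s, μ.real (S i) := by
    intro s
    set V := ⋃ i ∈ s, S i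
    have hV : MeasurableSet V := Finset.measurableSet_biUnion _ fun i _ => hS i
    have hVU : V ⊆ ⋃ i, S i := iUnion₂_subset fun i _ => subset_iUnion S i
    have h1 : E (⋃ i, S i) = E V + E ((⋃ i, S i) \ V) := by
      rw [← hE.union hV (hU.diff hV) disjoint_sdiff_right, union_sdiff_cancel hVU]
    have h2 : ∑ i ∈ s, E (S i) x = E V x := by
      rw [hE.biUnion_finset s S hS hd, sum_apply]
    rw [h1, h2, add_apply, sub_add_cancel_left, norm_neg,
      ← hE.measureReal_eq hμ (hU.diff hV), measureReal_sdiff hVU hV]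
    rw [measureReal_biUnion_finset (fun i _ j _ hij => hd hij) (fun i _ => hS i)]
  rw [HasSum, tendsto_iff_norm_sub_tendsto_zero]
  have h3 : Tendsto (fun s : Finset ℕ => μ.real (⋃ i, S i) - ∑ i ∈ s, μ.real (S i)) atTop
      (𝓝 (μ.real (⋃ i, S i) - μ.real (⋃ i, S i))) := tendsto_const_nhds.sub hsum
  rw [sub_self] at h3
  have h4 := (Real.continuous_sqrt.tendsto 0).comp h3
  rw [Real.sqrt_zero] at h4
  refine h4.congr fun s => ?_
  rw [Function.comp_apply, ← key, Real.sqrt_sq (norm_nonneg _)]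

end IsProjectionMeasure

end ProjectionMeasures

/-! ### Existence of the spectral measure of a bounded self-adjoint operator. -/

section Existence

open Filter Topology

variable {H : Type u} [NormedAddCommGroup H] [InnerProductSpace ℂ H] [CompleteSpace H]
  {A : H →L[ℂ] H}

/-- The scalar spectral measures of a self-adjoint operator. -/
lemma exists_scalar_spectralMeasure (hA : IsSelfAdjoint A) (x : H) :
    ∃ μ : Measure (spectrum ℝ A), IsFiniteMeasure μ ∧ μ.Regular ∧
      ∀ φ : C(spectrum ℝ A, ℝ), ∫ t, φ t ∂μ = (⟪x, cfcHom hA φ x⟫_ℂ).re := by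
  let Λ : CompactlySupportedContinuousMap (spectrum ℝ A) ℝ →ₚ[ℝ] ℝ :=
    PositiveLinearMap.mk₀
      { toFun := fun φ => (⟪x, cfcHom hA (φ : C(spectrum ℝ A, ℝ)) x⟫_ℂ).re
        map_add' := fun φ ψ => by
          have : ((φ + ψ : CompactlySupportedContinuousMap (spectrum ℝ A) ℝ) : C(spectrum ℝ A, ℝ)) =
            (φ : C(spectrum ℝ A, ℝ)) + ψ := rfl
          rw [this, map_add, add_apply, inner_add_right, Complex.add_re]
        map_smul' := fun c φ => by
          have : ((c • φ : CompactlySupportedContinuousMap (spectrum ℝ A) ℝ) : C(spectrum ℝ A, ℝ)) =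
            c • (φ : C(spectrum ℝ A, ℝ)) := rfl
          rw [this, map_smul, smul_apply, inner_smul_right_eq_smul]
          simp }
      fun φ hφ => by
        have h1 : 0 ≤ cfcHom hA (φ : C(spectrum ℝ A, ℝ)) :=
          (cfcHom_nonneg_iff hA).2 fun t => hφ t
        exact (ContinuousLinearMap.nonneg_iff_isPositive _).1 h1 |>.re_inner_nonneg_right x
  refine ⟨RealRMK.rieszMeasure Λ, inferInstance, inferInstance, fun φ => ?_⟩
  have := RealRMK.integral_rieszMeasure Λ
    (CompactlySupportedContinuousMap.continuousMapEquiv φ)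
  exact this

/-- A choice of scalar spectral measures. -/
noncomputable def scalarMeasure (hA : IsSelfAdjoint A) (x : H) : Measure (spectrum ℝ A) :=
  (exists_scalar_spectralMeasure hA x).choose

instance (hA : IsSelfAdjoint A) (x : H) : IsFiniteMeasure (scalarMeasure hA x) :=
  (exists_scalar_spectralMeasure hA x).choose_spec.1

lemma integral_scalarMeasure (hA : IsSelfAdjoint A) (x : H) (φ : C(spectrum ℝ A, ℝ)) :
    ∫ t, φ t ∂(scalarMeasure hA x) = (⟪x, cfcHom hA φ x⟫_ℂ).re :=
  (exists_scalar_spectralMeasure hA x).choose_spec.2.2 φ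

lemma inner_cfcHom_comm (hA : IsSelfAdjoint A) (φ : C(spectrum ℝ A, ℝ)) (x y : H) :
    ⟪cfcHom hA φ x, y⟫_ℂ = ⟪x, cfcHom hA φ y⟫_ℂ := by
  have : star (cfcHom hA φ) = cfcHom hA φ := by
    rw [← map_star]; congr 1
  rw [ContinuousLinearMap.star_eq_adjoint] at this
  rw [← ContinuousLinearMap.adjoint_inner_right, this]

/-- The isometry `φ(A) x ↔ φ` into `L²(μ_x)`, the basis of the extension from continuous functions
to indicators. -/
lemma norm_cfcHom_apply_sq (hA : IsSelfAdjoint A) (φ : C(spectrum ℝ A, ℝ)) (x : H) :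
    ‖cfcHom hA φ x‖ ^ 2 = ∫ t, φ t ^ 2 ∂(scalarMeasure hA x) := by
  have h1 := integral_scalarMeasure hA x (φ ^ 2)
  simp only [ContinuousMap.pow_apply] at h1
  rw [h1, pow_two φ, map_mul, mul_apply_eq_comp, ← inner_cfcHom_comm,
    inner_self_eq_norm_sq_to_K]
  norm_cast

lemma integrable_continuousMap {X : Type*} [TopologicalSpace X] [CompactSpace X]
    [MeasurableSpace X] [OpensMeasurableSpace X] (m : Measure X) [IsFiniteMeasure m] {φ : X → ℝ}
    (hφ : Continuous φ) : Integrable φ m :=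
  hφ.integrable_of_hasCompactSupport (HasCompactSupport.of_compactSpace φ)

/-- Continuous functions with values in `[0,1]`. -/
def UnitValued {X : Type*} [TopologicalSpace X] (φ : C(X, ℝ)) : Prop := ∀ t, 0 ≤ φ t ∧ φ t ≤ 1

lemma integrable_abs_sub_indicator {X : Type*} [TopologicalSpace X] [CompactSpace X]
    [MeasurableSpace X] [OpensMeasurableSpace X] (m : Measure X) [IsFiniteMeasure m] (φ : C(X, ℝ))
    {Δ : Set X} (hΔ : MeasurableSet Δ) : Integrable (fun t => |φ t - Δ.indicator 1 t|) m :=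
  ((integrable_continuousMap m φ.continuous).sub ((integrable_const (1 : ℝ)).indicator hΔ)).abs

/-- Continuous functions are dense in `L¹`, and truncation to `[0,1]` does not increase the distance
to an indicator. -/
lemma exists_unitValued_approx {X : Type*} [MetricSpace X] [CompactSpace X]
    [MeasurableSpace X] [BorelSpace X] (m : Measure X) [IsFiniteMeasure m]
    {Δ : Set X} (hΔ : MeasurableSet Δ) {ε : ℝ} (hε : 0 < ε) :
    ∃ φ : C(X, ℝ), UnitValued φ ∧ ∫ t, |φ t - Δ.indicator 1 t| ∂m ≤ ε := by
  have hint : Integrable (Δ.indicator (1 : X → ℝ)) m := (integrable_const (1 : ℝ)).indicator hΔ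
  obtain ⟨g, hg, hgi⟩ := hint.exists_boundedContinuous_integral_sub_le hε
  refine ⟨⟨fun t => max 0 (min 1 (g t)), by fun_prop⟩, fun t => ⟨by simp, by simp⟩, ?_⟩
  refine le_trans (integral_mono_of_nonneg (ae_of_all _ fun t => abs_nonneg _)
    (hint.sub hgi).norm (ae_of_all _ fun t => ?_)) hg
  simp only [ContinuousMap.coe_mk, Pi.sub_apply, Real.norm_eq_abs]
  have h01 : 0 ≤ Δ.indicator (1 : X → ℝ) t ∧ Δ.indicator (1 : X → ℝ) t ≤ 1 := by
    by_cases h : t ∈ Δ <;> simp [h]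
  rw [abs_sub_comm]
  rcases le_total (g t) 0 with h | h
  · rw [min_eq_right (by linarith), max_eq_left h, abs_of_nonneg (by linarith), sub_zero]
    exact le_abs.2 (Or.inl (by linarith))
  · rcases le_total (g t) 1 with h' | h'
    · rw [min_eq_right h', max_eq_right h]
    · rw [min_eq_left h', max_eq_right zero_le_one, abs_of_nonpos (by linarith)]
      exact le_abs.2 (Or.inr (by linarith))

/-- Approximating in the sum of the scalar measures serves finitely many vectors at once; linearity
and multiplicativity need common approximants. -/
lemma exists_unitValued_seq (hA : IsSelfAdjoint A) {Δ : Set (spectrum ℝ A)} (hΔ : MeasurableSet Δ)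
    (s : Finset H) : ∃ φ : ℕ → C(spectrum ℝ A, ℝ), (∀ n, UnitValued (φ n)) ∧ ∀ x ∈ s, ∀ n,
      ∫ t, |φ n t - Δ.indicator 1 t| ∂(scalarMeasure hA x) ≤ 1 / (n + 1) := by
  choose φ h0 h1 using fun n : ℕ => exists_unitValued_approx (∑ x ∈ s, scalarMeasure hA x) hΔ
    (Nat.one_div_pos_of_nat (α := ℝ) (n := n))
  refine ⟨φ, h0, fun x hx n => le_trans ?_ (h1 n)⟩
  rw [integral_finsetSum_measure fun y _ => integrable_abs_sub_indicator _ _ hΔ]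
  exact Finset.single_le_sum (f := fun y => ∫ t, |φ n t - Δ.indicator 1 t| ∂(scalarMeasure hA y))
    (fun y _ => integral_nonneg fun t => abs_nonneg _) hx

/-- For functions with values in `[0,1]` one has `|φ - ψ|² ≤ |φ - ψ|`, so `L¹` approximation
suffices. -/
lemma norm_cfcHom_sub_sq_le (hA : IsSelfAdjoint A) {φ ψ : C(spectrum ℝ A, ℝ)} (hφ : UnitValued φ)
    (hψ : UnitValued ψ) {Δ : Set (spectrum ℝ A)} (hΔ : MeasurableSet Δ) (x : H) :
    ‖cfcHom hA φ x - cfcHom hA ψ x‖ ^ 2 ≤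
      ∫ t, |φ t - Δ.indicator 1 t| ∂(scalarMeasure hA x) +
      ∫ t, |ψ t - Δ.indicator 1 t| ∂(scalarMeasure hA x) := by
  rw [← sub_apply, ← map_sub, norm_cfcHom_apply_sq,
    ← integral_add (integrable_abs_sub_indicator _ _ hΔ) (integrable_abs_sub_indicator _ _ hΔ)]
  refine integral_mono (integrable_continuousMap _ (by fun_prop))
    ((integrable_abs_sub_indicator _ _ hΔ).add (integrable_abs_sub_indicator _ _ hΔ)) fun t => ?_
  have h1 := hφ t
  have h2 := hψ t
  have h3 : |φ t - ψ t| ≤ 1 := abs_le.2 ⟨by linarith, by linarith⟩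
  calc (φ - ψ) t ^ 2 = |φ t - ψ t| ^ 2 := by rw [sq_abs]; rfl
    _ ≤ |φ t - ψ t| := by nlinarith [abs_nonneg (φ t - ψ t)]
    _ ≤ _ := by
      have := abs_sub_le (φ t) (Δ.indicator 1 t) (ψ t)
      rwa [abs_sub_comm (Δ.indicator 1 t) (ψ t)] at this

/-- The value `E(Δ) x` is the limit of `φ_n(A) x` as `φ_n → 1_Δ` in `L¹(μ_x)`. Stating the estimate
for every `φ` makes it independent of the sequence. -/
lemma exists_spectral_value (hA : IsSelfAdjoint A) {Δ : Set (spectrum ℝ A)} (hΔ : MeasurableSet Δ)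
    (x : H) : ∃ v : H, ∀ φ : C(spectrum ℝ A, ℝ), UnitValued φ →
      ‖cfcHom hA φ x - v‖ ^ 2 ≤ ∫ t, |φ t - Δ.indicator 1 t| ∂(scalarMeasure hA x) := by
  obtain ⟨φ, h0, h1⟩ := exists_unitValued_seq hA hΔ {x}
  replace h1 := h1 x (by simp)
  have hlim : Tendsto (fun n : ℕ => (1 : ℝ) / (n + 1)) atTop (𝓝 0) :=
    tendsto_one_div_add_atTop_nhds_zero_nat
  have hC : CauchySeq fun n => cfcHom hA (φ n) x := by
    refine Metric.cauchySeq_iff'.2 fun ε hε => ?_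
    obtain ⟨N, hN⟩ := exists_nat_one_div_lt (show 0 < ε ^ 2 / 2 by positivity)
    refine ⟨N, fun n hn => ?_⟩
    rw [dist_eq_norm]
    refine lt_of_pow_lt_pow_left₀ 2 hε.le ?_
    have h2 : (1 : ℝ) / (n + 1) ≤ 1 / (N + 1) :=
      one_div_le_one_div_of_le (by positivity) (by gcongr)
    linarith [norm_cfcHom_sub_sq_le hA (h0 n) (h0 N) hΔ x, h1 n, h1 N]
  obtain ⟨v, hv⟩ := cauchySeq_tendsto_of_complete hC
  refine ⟨v, fun ψ hψ => ?_⟩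
  have h2 : Tendsto (fun n => ‖cfcHom hA ψ x - cfcHom hA (φ n) x‖ ^ 2) atTop
      (𝓝 (‖cfcHom hA ψ x - v‖ ^ 2)) := ((tendsto_const_nhds.sub hv).norm).pow 2
  have h3 := (tendsto_const_nhds (x := ∫ t, |ψ t - Δ.indicator 1 t| ∂(scalarMeasure hA x))).add hlim
  rw [add_zero] at h3
  exact le_of_tendsto_of_tendsto' h2 h3 fun n =>
    (norm_cfcHom_sub_sq_le hA hψ (h0 n) hΔ x).trans (by linarith [h1 n])

open scoped Classical in
/-- The value of the spectral projection at a vector. -/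
noncomputable def spectralValue (hA : IsSelfAdjoint A) (Δ : Set (spectrum ℝ A)) (x : H) : H :=
  if hΔ : MeasurableSet Δ then (exists_spectral_value hA hΔ x).choose else 0

lemma norm_cfcHom_sub_spectralValue_sq_le (hA : IsSelfAdjoint A) {Δ : Set (spectrum ℝ A)}
    (hΔ : MeasurableSet Δ) (x : H) {φ : C(spectrum ℝ A, ℝ)} (hφ : UnitValued φ) :
    ‖cfcHom hA φ x - spectralValue hA Δ x‖ ^ 2 ≤
      ∫ t, |φ t - Δ.indicator 1 t| ∂(scalarMeasure hA x) := by
  rw [spectralValue, dif_pos hΔ]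
  exact (exists_spectral_value hA hΔ x).choose_spec φ hφ

lemma tendsto_spectralValue (hA : IsSelfAdjoint A) {Δ : Set (spectrum ℝ A)}
    (hΔ : MeasurableSet Δ) (x : H) {φ : ℕ → C(spectrum ℝ A, ℝ)} (hφ : ∀ n, UnitValued (φ n))
    {c : ℕ → ℝ} (hc : Tendsto c atTop (𝓝 0))
    (h : ∀ n, ∫ t, |φ n t - Δ.indicator 1 t| ∂(scalarMeasure hA x) ≤ c n) :
    Tendsto (fun n => cfcHom hA (φ n) x) atTop (𝓝 (spectralValue hA Δ x)) := by
  rw [tendsto_iff_norm_sub_tendsto_zero]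
  have h1 : Tendsto (fun n => ‖cfcHom hA (φ n) x - spectralValue hA Δ x‖ ^ 2) atTop (𝓝 0) :=
    squeeze_zero (fun n => by positivity)
      (fun n => (norm_cfcHom_sub_spectralValue_sq_le hA hΔ x (hφ n)).trans (h n)) hc
  have h2 := (Real.continuous_sqrt.tendsto 0).comp h1
  simpa [Function.comp_def, Real.sqrt_sq (norm_nonneg _)] using h2

lemma norm_cfcHom_le_one (hA : IsSelfAdjoint A) {φ : C(spectrum ℝ A, ℝ)} (hφ : UnitValued φ)
    (x : H) : ‖cfcHom hA φ x‖ ≤ ‖x‖ := by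
  refine le_of_sq_le_sq ?_ (norm_nonneg x)
  have h1 := norm_cfcHom_apply_sq hA 1 x
  rw [map_one, one_apply_eq_self] at h1
  rw [norm_cfcHom_apply_sq, h1]
  refine integral_mono (integrable_continuousMap _ (by fun_prop))
    (integrable_continuousMap _ (by fun_prop)) fun t => ?_
  have := hφ t
  simp only [ContinuousMap.one_apply]
  nlinarith

lemma exists_seq_tendsto_spectralValue (hA : IsSelfAdjoint A) {Δ : Set (spectrum ℝ A)}
    (hΔ : MeasurableSet Δ) (s : Finset H) : ∃ φ : ℕ → C(spectrum ℝ A, ℝ), (∀ n, UnitValued (φ n)) ∧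
      (∀ x ∈ s, ∀ n, ∫ t, |φ n t - Δ.indicator 1 t| ∂(scalarMeasure hA x) ≤ 1 / (n + 1)) ∧
      ∀ x ∈ s, Tendsto (fun n => cfcHom hA (φ n) x) atTop (𝓝 (spectralValue hA Δ x)) := by
  obtain ⟨φ, h0, h1⟩ := exists_unitValued_seq hA hΔ s
  exact ⟨φ, h0, h1, fun x hx =>
    tendsto_spectralValue hA hΔ x h0 tendsto_one_div_add_atTop_nhds_zero_nat (h1 x hx)⟩

open scoped Classical in
/-- The spectral projections, as operators. -/
noncomputable def spectralProjection (hA : IsSelfAdjoint A) (Δ : Set (spectrum ℝ A)) : H →L[ℂ] H :=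
  if hΔ : MeasurableSet Δ then
    LinearMap.mkContinuous
      { toFun := spectralValue hA Δ
        map_add' := fun x y => by
          obtain ⟨φ, -, -, h⟩ := exists_seq_tendsto_spectralValue hA hΔ {x, y, x + y}
          refine tendsto_nhds_unique (h (x + y) (by simp)) ?_
          simpa using (h x (by simp)).add (h y (by simp))
        map_smul' := fun c x => by
          obtain ⟨φ, -, -, h⟩ := exists_seq_tendsto_spectralValue hA hΔ {x, c • x}
          refine tendsto_nhds_unique (h (c • x) (by simp)) ?_
          simpa using (h x (by simp)).const_smul c }
      1 fun x => by
        obtain ⟨φ, h0, -, h⟩ := exists_seq_tendsto_spectralValue hA hΔ {x}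
        rw [one_mul]
        exact le_of_tendsto' (h x (by simp)).norm fun n => norm_cfcHom_le_one hA (h0 n) x
  else 0

lemma spectralProjection_apply (hA : IsSelfAdjoint A) {Δ : Set (spectrum ℝ A)}
    (hΔ : MeasurableSet Δ) (x : H) : spectralProjection hA Δ x = spectralValue hA Δ x := by
  rw [spectralProjection, dif_pos hΔ]; rfl

lemma spectralProjection_inter (hA : IsSelfAdjoint A) {S T : Set (spectrum ℝ A)}
    (hS : MeasurableSet S) (hT : MeasurableSet T) :
    spectralProjection hA (S ∩ T) = spectralProjection hA S * spectralProjection hA T := by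
  ext x
  rw [mul_apply_eq_comp, spectralProjection_apply hA hS,
    spectralProjection_apply hA hT, spectralProjection_apply hA (hS.inter hT)]
  classical
  set y := spectralValue hA T x
  -- The approximants of `1_S` must work both for `x` and for `y = E(T) x`: then `φ_n ψ_n`
  -- approximates `1_{S ∩ T}` at `x`, while `φ_n(A) ψ_n(A) x` tends to `E(S) y`.
  obtain ⟨φ, hφ0, hφ1, hφ⟩ := exists_seq_tendsto_spectralValue hA hS {x, y}
  obtain ⟨ψ, hψ0, hψ1, hψ⟩ := exists_seq_tendsto_spectralValue hA hT {x}
  have h1 : Tendsto (fun n => cfcHom hA (φ n * ψ n) x) atTop (𝓝 (spectralValue hA (S ∩ T) x)) := by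
    refine tendsto_spectralValue hA (hS.inter hT) x
      (c := fun n => 1 / ((n : ℝ) + 1) + 1 / ((n : ℝ) + 1)) (fun n t => ?_) ?_ fun n => ?_
    · have a := hφ0 n t
      have b := hψ0 n t
      rw [ContinuousMap.mul_apply]
      exact ⟨mul_nonneg a.1 b.1, mul_le_one₀ a.2 b.1 b.2⟩
    · have : Tendsto (fun n : ℕ => (1 : ℝ) / (n + 1)) atTop (𝓝 0) :=
        tendsto_one_div_add_atTop_nhds_zero_nat
      simpa using this.add this
    · refine le_trans ?_ (add_le_add (hφ1 x (by simp) n) (hψ1 x (by simp) n))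
      rw [← integral_add (integrable_abs_sub_indicator _ _ hS)
        (integrable_abs_sub_indicator _ _ hT)]
      refine integral_mono (integrable_abs_sub_indicator _ _ (hS.inter hT))
        ((integrable_abs_sub_indicator _ _ hS).add (integrable_abs_sub_indicator _ _ hT))
        fun t => ?_
      have a := hφ0 n t
      have b := hψ0 n t
      rw [inter_indicator_one]
      simp only [ContinuousMap.mul_apply, Pi.mul_apply]
      have hi : |S.indicator (1 : spectrum ℝ A → ℝ) t| ≤ 1 := by by_cases h : t ∈ S <;> simp [h]
      calc |φ n t * ψ n t - S.indicator 1 t * T.indicator 1 t|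
          = |(φ n t - S.indicator 1 t) * ψ n t + S.indicator 1 t * (ψ n t - T.indicator 1 t)| := by
            ring_nf
        _ ≤ |φ n t - S.indicator 1 t| * |ψ n t| + |S.indicator 1 t| * |ψ n t - T.indicator 1 t| := by
            rw [← abs_mul, ← abs_mul]; exact abs_add_le _ _
        _ ≤ |φ n t - S.indicator 1 t| * 1 + 1 * |ψ n t - T.indicator 1 t| := by
            gcongr
            rw [abs_of_nonneg b.1]; exact b.2
        _ = _ := by ring
  have h2 : Tendsto (fun n => cfcHom hA (φ n * ψ n) x) atTop (𝓝 (spectralValue hA S y)) := by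
    have h3 : Tendsto (fun n => cfcHom hA (φ n) (cfcHom hA (ψ n) x - y)) atTop (𝓝 0) := by
      refine squeeze_zero_norm (fun n => norm_cfcHom_le_one hA (hφ0 n) _) ?_
      have := (hψ x (by simp)).sub_const y
      rw [sub_self] at this
      simpa using this.norm
    have h4 := h3.add (hφ y (by simp))
    rw [zero_add] at h4
    refine h4.congr fun n => ?_
    rw [← map_add, sub_add_cancel, map_mul]; rfl
  exact tendsto_nhds_unique h1 h2

lemma isStarProjection_spectralProjection (hA : IsSelfAdjoint A) {Δ : Set (spectrum ℝ A)}
    (hΔ : MeasurableSet Δ) : IsStarProjection (spectralProjection hA Δ) := by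
  refine ⟨?_, ?_⟩
  · have := spectralProjection_inter hA hΔ hΔ
    rw [inter_self] at this
    exact this.symm
  · rw [ContinuousLinearMap.isSelfAdjoint_iff_isSymmetric]
    classical
    intro x y
    obtain ⟨φ, -, -, h⟩ := exists_seq_tendsto_spectralValue hA hΔ {x, y}
    simp only [ContinuousLinearMap.coe_coe, spectralProjection_apply hA hΔ]
    refine tendsto_nhds_unique ((h x (by simp)).inner tendsto_const_nhds) ?_
    simp_rw [inner_cfcHom_comm]
    exact tendsto_const_nhds.inner (h y (by simp))

lemma scalarMeasure_real (hA : IsSelfAdjoint A) {Δ : Set (spectrum ℝ A)}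
    (hΔ : MeasurableSet Δ) (x : H) :
    (((scalarMeasure hA x).real Δ : ℝ) : ℂ) = ⟪x, spectralProjection hA Δ x⟫_ℂ := by
  obtain ⟨φ, h0, h1, h⟩ := exists_seq_tendsto_spectralValue hA hΔ {x}
  rw [spectralProjection_apply hA hΔ]
  have hre : ∀ n, ⟪x, cfcHom hA (φ n) x⟫_ℂ = ((∫ t, φ n t ∂(scalarMeasure hA x) : ℝ) : ℂ) := by
    intro n
    rw [integral_scalarMeasure]
    refine (Complex.conj_eq_iff_re.1 ?_).symm
    rw [inner_conj_symm, inner_cfcHom_comm]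
  have h2 : Tendsto (fun n => ((∫ t, φ n t ∂(scalarMeasure hA x) : ℝ) : ℂ)) atTop
      (𝓝 (((scalarMeasure hA x).real Δ : ℝ) : ℂ)) := by
    refine (Complex.continuous_ofReal.tendsto _).comp ?_
    rw [tendsto_iff_norm_sub_tendsto_zero]
    refine squeeze_zero (fun n => norm_nonneg _) (fun n => ?_)
      tendsto_one_div_add_atTop_nhds_zero_nat
    refine le_trans ?_ (h1 x (by simp) n)
    rw [← integral_indicator_one hΔ, ← integral_sub (integrable_continuousMap _ (φ n).continuous)
      (show Integrable (Δ.indicator (1 : spectrum ℝ A → ℝ)) _ from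
        (integrable_const (1 : ℝ)).indicator hΔ)]
    exact norm_integral_le_integral_norm _
  refine tendsto_nhds_unique h2 ?_
  simp_rw [← hre]
  exact tendsto_const_nhds.inner (h x (by simp))

lemma isProjectionMeasure_spectralProjection (hA : IsSelfAdjoint A) :
    IsProjectionMeasure (spectralProjection hA) where
  proj _ hS := isStarProjection_spectralProjection hA hS
  inter _ _ hS hT := spectralProjection_inter hA hS hT
  meas x := ⟨scalarMeasure hA x, inferInstance, fun _ hS => scalarMeasure_real hA hS x⟩

/-- The projections on the spectrum are transported to the line. Hence the choice in
`spectralMeasure` is a genuine spectral measure; no uniqueness of it is needed later. -/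
theorem exists_spectralMeasure (hA : IsSelfAdjoint A) :
    ∃ E : Set ℝ → H →L[ℂ] H, IsSpectralMeasure E ∧ Resolves E A := by
  have hP := isProjectionMeasure_spectralProjection hA
  have hm : Measurable (Subtype.val : spectrum ℝ A → ℝ) := measurable_subtype_coe
  refine ⟨fun S => spectralProjection hA (Subtype.val ⁻¹' S), ?_, ?_⟩
  · refine ⟨fun S hS => hP.proj _ (hm hS), ?_, fun S T hS hT => ?_, fun S hS hd x => ?_⟩
    · ext x
      rw [preimage_univ, spectralProjection_apply hA .univ, one_apply_eq_self]
      have := norm_cfcHom_sub_spectralValue_sq_le hA .univ x (φ := 1) (fun t => by simp)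
      simp only [map_one, one_apply_eq_self, ContinuousMap.one_apply, indicator_univ,
        Pi.one_apply, sub_self, abs_zero, integral_zero] at this
      have h2 : ‖x - spectralValue hA univ x‖ = 0 := by nlinarith [norm_nonneg (x - spectralValue hA univ x)]
      exact (sub_eq_zero.1 (norm_eq_zero.1 h2)).symm
    · exact hP.inter _ _ (hm hS) (hm hT)
    · rw [preimage_iUnion]
      exact hP.hasSum_iUnion _ (fun i => hm (hS i)) (fun i j hij => (hd hij).preimage _) x
  · intro x
    refine ⟨(scalarMeasure hA x).map Subtype.val, inferInstance, fun S hS => ?_, ?_, ?_⟩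
    · rw [measureReal_def, Measure.map_apply hm hS]
      exact scalarMeasure_real hA (hm hS) x
    · rw [integrable_map_measure (by fun_prop) hm.aemeasurable]
      exact integrable_continuousMap _ continuous_subtype_val
    · rw [integral_map hm.aemeasurable (by fun_prop)]
      have h1 := integral_scalarMeasure hA x ((ContinuousMap.id ℝ).restrict (spectrum ℝ A))
      rw [cfcHom_id hA] at h1
      simp only [ContinuousMap.restrict_apply, ContinuousMap.id_apply] at h1
      rw [h1]
      refine (Complex.conj_eq_iff_re.1 ?_).symm
      rw [inner_conj_symm]
      exact (ContinuousLinearMap.isSelfAdjoint_iff_isSymmetric.1 hA) x x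

end Existence

end NoncommFun

namespace NoncommFun

/-! ### Riemann sums of integrals with respect to a spectral measure. -/

section StepOperators

open Filter Topology

variable {H : Type u} [NormedAddCommGroup H] [InnerProductSpace ℂ H] [CompleteSpace H]

/-- `E` is a spectral measure of `A`, concentrated on `[-R, R]`. -/
structure IsSpectralOn (E : Set ℝ → H →L[ℂ] H) (A : H →L[ℂ] H) (R : ℕ) : Prop where
  proj : IsProjectionMeasure E
  supp : E (Icc (-R : ℝ) R) = 1
  resolves : Resolves E A

/-- The cells of the grid of mesh `1 / (N + 1)`. -/
def cell (N : ℕ) (i : ℤ) : Set ℝ := {x | ⌊((N : ℝ) + 1) * x⌋ = i}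

/-- The nodes of the grid of mesh `1 / (N + 1)`. -/
noncomputable def node (N : ℕ) (i : ℤ) : ℝ := i / ((N : ℝ) + 1)

/-- The indices of the nodes in `[-R, R]`. -/
noncomputable def gridIndex (R N : ℕ) : Finset ℤ := Finset.Icc (-(R * (N + 1) : ℤ)) (R * (N + 1))

lemma measurableSet_cell (N : ℕ) (i : ℤ) : MeasurableSet (cell N i) :=
  (Int.measurable_floor.comp (measurable_const.mul measurable_id)) (measurableSet_singleton i)

lemma measurableSet_biUnion_cell (R N : ℕ) : MeasurableSet (⋃ i ∈ gridIndex R N, cell N i) :=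
  Finset.measurableSet_biUnion _ fun i _ => measurableSet_cell N i

lemma pairwise_disjoint_cell (N : ℕ) : Pairwise (Function.onFun Disjoint (cell N)) := by
  intro i j hij
  refine Set.disjoint_left.2 fun x hx hy => hij ?_
  exact (show ⌊_⌋ = i from hx).symm.trans hy

lemma node_mem {R N : ℕ} {i : ℤ} (hi : i ∈ gridIndex R N) : node N i ∈ Icc (-R : ℝ) R := by
  have hN : (0 : ℝ) < N + 1 := by positivity
  rw [gridIndex, Finset.mem_Icc] at hi
  rw [node, mem_Icc, le_div_iff₀ hN, div_le_iff₀ hN]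
  constructor
  · have : ((-(R * (N + 1) : ℤ) : ℤ) : ℝ) ≤ i := by exact_mod_cast hi.1
    push_cast at this; linarith
  · exact_mod_cast hi.2

lemma mem_cell_bounds {N : ℕ} {i : ℤ} {x : ℝ} (hx : x ∈ cell N i) :
    node N i ≤ x ∧ x ≤ node N i + 1 / ((N : ℝ) + 1) := by
  have hN : (0 : ℝ) < N + 1 := by positivity
  have hx' : ⌊((N : ℝ) + 1) * x⌋ = i := hx
  have h1 := Int.floor_le (((N : ℝ) + 1) * x)
  have h2 := Int.lt_floor_add_one (((N : ℝ) + 1) * x)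
  rw [hx'] at h1 h2
  rw [node, ← add_div]
  constructor
  · rw [div_le_iff₀ hN]; linarith
  · rw [le_div_iff₀ hN]; linarith

lemma Icc_subset_biUnion_cell (R N : ℕ) : Icc (-R : ℝ) R ⊆ ⋃ i ∈ gridIndex R N, cell N i := by
  intro x hx
  have hN : (0 : ℝ) < N + 1 := by positivity
  refine mem_iUnion₂.2 ⟨⌊((N : ℝ) + 1) * x⌋, ?_, rfl⟩
  rw [gridIndex, Finset.mem_Icc]
  constructor
  · rw [Int.le_floor]
    push_cast
    nlinarith [hx.1]
  · have h1 : ((⌊((N : ℝ) + 1) * x⌋ : ℤ) : ℝ) ≤ ((R * (N + 1) : ℤ) : ℝ) := by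
      refine (Int.floor_le _).trans ?_
      push_cast
      nlinarith [hx.2]
    exact_mod_cast h1

lemma IsSpectralMeasure.isProjectionMeasure {E : Set ℝ → H →L[ℂ] H} {A : H →L[ℂ] H}
    (hE : IsSpectralMeasure E) (hA : Resolves E A) : IsProjectionMeasure E where
  proj := hE.proj
  inter := hE.inter
  meas x := by
    obtain ⟨μ, h1, h2, -⟩ := hA x
    exact ⟨μ, h1, h2⟩

lemma IsProjectionMeasure.eq_one_of_subset {E : Set ℝ → H →L[ℂ] H} (hE : IsProjectionMeasure E)
    {S T : Set ℝ} (hS : MeasurableSet S) (hT : MeasurableSet T) (hST : S ⊆ T) (h : E S = 1) :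
    E T = 1 := by
  have := hE.inter S T hS hT
  rw [inter_eq_left.2 hST, h, one_mul] at this
  exact this.symm

lemma IsProjectionMeasure.compl_eq_zero {E : Set ℝ → H →L[ℂ] H} (hE : IsProjectionMeasure E)
    {S : Set ℝ} (hS : MeasurableSet S) (h : E S = 1) : E Sᶜ = 0 := by
  have := hE.mul_eq_zero hS hS.compl disjoint_compl_right
  rwa [h, one_mul] at this

/-- A half-line on which the coordinate exceeds the norm of the operator carries no mass. -/
lemma eq_zero_of_sign_mul_gt {E : Set ℝ → H →L[ℂ] H} {A : H →L[ℂ] H} (hE : IsSpectralMeasure E)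
    (hA : Resolves E A) {R σ : ℝ} (hσ : |σ| = 1) (hR : ‖A‖ ≤ R) : E {t | R < σ * t} = 0 := by
  have hP := hE.isProjectionMeasure hA
  set S : Set ℝ := {t | R < σ * t} with hS
  have hSm : MeasurableSet S := measurableSet_lt measurable_const (measurable_const.mul measurable_id)
  ext y
  rw [zero_apply]
  set x := E S y with hx
  have hEx : E S x = x := by
    have := congrArg (fun f : H →L[ℂ] H => f y) (hP.proj S hSm).isIdempotentElem
    exact this
  have hEc : E Sᶜ x = 0 := by
    have := congrArg (fun f : H →L[ℂ] H => f y)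
      (hP.mul_eq_zero hSm.compl hSm disjoint_compl_left)
    exact this
  obtain ⟨μ, _, h1, h2, h3⟩ := hA x
  have hμ1 : μ.real univ = ‖x‖ ^ 2 := by
    rw [hP.measureReal_eq h1 .univ, hE.univ]; rfl
  have hμ2 : μ Sᶜ = 0 := by
    have := hP.measureReal_eq h1 hSm.compl
    rw [hEc, norm_zero, zero_pow two_ne_zero, measureReal_eq_zero_iff] at this
    exact this
  have hae : ∀ᵐ t ∂μ, R < σ * t := by
    rw [ae_iff]; exact hμ2
  -- The integral is at most `(‖A‖ - R) ‖x‖²`, while the integrand is positive almost everywhere; so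
  -- the measure vanishes and `x = 0`.
  have hint : ∫ t, (σ * t - R) ∂μ ≤ 0 := by
    rw [integral_sub (h2.const_mul σ) (integrable_const R), integral_const, integral_const_mul, hμ1]
    have h4 : |∫ t, t ∂μ| ≤ ‖A‖ * ‖x‖ ^ 2 := by
      have : |∫ t, t ∂μ| = ‖⟪x, A x⟫_ℂ‖ := by rw [h3, Complex.norm_real, Real.norm_eq_abs]
      rw [this]
      calc _ ≤ ‖x‖ * ‖A x‖ := norm_inner_le_norm _ _
        _ ≤ ‖x‖ * (‖A‖ * ‖x‖) := by gcongr; exact A.le_opNorm x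
        _ = _ := by ring
    have h5 : σ * ∫ t, t ∂μ ≤ |∫ t, t ∂μ| := by
      refine (le_abs_self _).trans ?_
      rw [abs_mul, hσ, one_mul]
    rw [smul_eq_mul]
    nlinarith [sq_nonneg ‖x‖]
  have hzero : μ = 0 := by
    by_contra hne
    have hi : Integrable (fun t => σ * t - R) μ := (h2.const_mul σ).sub (integrable_const R)
    have hpos : 0 < ∫ t, (σ * t - R) ∂μ := by
      rw [integral_pos_iff_support_of_nonneg_ae (f := fun t => σ * t - R) (hae.mono fun t ht => by
        simp only [Pi.zero_apply]; linarith) hi]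
      have : Function.support (fun t => σ * t - R) =ᵐ[μ] univ := by
        refine eventuallyEq_univ.2 (hae.mono fun t ht => ?_)
        show σ * t - R ≠ 0
        linarith
      rw [measure_congr this]
      exact Measure.measure_univ_pos.2 hne
    linarith
  rw [hzero] at hμ1
  simpa using hμ1.symm

lemma IsSpectralMeasure.isSpectralOn {E : Set ℝ → H →L[ℂ] H} {A : H →L[ℂ] H}
    (hE : IsSpectralMeasure E) (hA : Resolves E A) {R : ℕ} (hR : ‖A‖ ≤ R) : IsSpectralOn E A R := by
  have hP := hE.isProjectionMeasure hA
  refine ⟨hP, ?_, hA⟩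
  have h1 := eq_zero_of_sign_mul_gt hE hA (σ := 1) (by simp) hR
  have h2 := eq_zero_of_sign_mul_gt hE hA (σ := -1) (by simp) hR
  have hm1 : MeasurableSet {t : ℝ | (R : ℝ) < 1 * t} :=
    measurableSet_lt measurable_const (measurable_const.mul measurable_id)
  have hm2 : MeasurableSet {t : ℝ | (R : ℝ) < -1 * t} :=
    measurableSet_lt measurable_const (measurable_const.mul measurable_id)
  have hU : (Set.univ : Set ℝ) = Icc (-R : ℝ) R ∪ ({t : ℝ | (R : ℝ) < 1 * t} ∪ {t : ℝ | (R : ℝ) < -1 * t}) := by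
    ext t
    simp only [mem_univ, mem_union, mem_Icc, mem_ofPred_eq, true_iff]
    by_contra! hcon
    obtain ⟨h3, h4, h5⟩ := hcon
    have := h3 (by linarith)
    linarith
  rw [← hE.univ, hU, hP.union measurableSet_Icc (hm1.union hm2), hP.union hm1 hm2, h1, h2, add_zero,
    add_zero]
  · refine Set.disjoint_left.2 fun t ht ht' => ?_
    simp only [mem_ofPred_eq] at ht ht'
    have : (0 : ℝ) ≤ R := by positivity
    linarith
  · refine Set.disjoint_left.2 fun t ht ht' => ?_
    simp only [mem_ofPred_eq, mem_union] at ht'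
    rcases ht' with h | h
    · linarith [ht.2]
    · linarith [ht.1]

lemma spectralMeasure_isSpectralOn {A : H →L[ℂ] H} (hA : IsSelfAdjoint A) {R : ℕ} (hR : ‖A‖ ≤ R) :
    IsSpectralOn (spectralMeasure A) A R := by
  have h := exists_spectralMeasure hA
  have h2 : spectralMeasure A = h.choose := by rw [spectralMeasure, dif_pos h]
  rw [h2]
  exact h.choose_spec.1.isSpectralOn h.choose_spec.2 hR

/-- The Riemann sum `∑ a(x_i) E(I_i)` of the integral of `a` with respect to `E`. -/
noncomputable def stepOp (E : Set ℝ → H →L[ℂ] H) (R N : ℕ) (a : ℝ → ℂ) : H →L[ℂ] H :=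
  ∑ i ∈ gridIndex R N, a (node N i) • E (cell N i)

namespace IsSpectralOn

variable {E : Set ℝ → H →L[ℂ] H} {A : H →L[ℂ] H} {R : ℕ} (hE : IsSpectralOn E A R)
include hE

lemma biUnion_cell (N : ℕ) : E (⋃ i ∈ gridIndex R N, cell N i) = 1 :=
  hE.proj.eq_one_of_subset measurableSet_Icc (measurableSet_biUnion_cell R N)
    (Icc_subset_biUnion_cell R N) hE.supp

lemma sum_cell (N : ℕ) : ∑ i ∈ gridIndex R N, E (cell N i) = 1 := by
  rw [← hE.proj.biUnion_finset _ _ (measurableSet_cell N) (pairwise_disjoint_cell N),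
    hE.biUnion_cell]

lemma cell_mul_cell (N : ℕ) (i j : ℤ) :
    E (cell N i) * E (cell N j) = if i = j then E (cell N i) else 0 := by
  split_ifs with h
  · subst h; exact (hE.proj.proj _ (measurableSet_cell N i)).isIdempotentElem
  · exact hE.proj.mul_eq_zero (measurableSet_cell N i) (measurableSet_cell N j)
      (pairwise_disjoint_cell N h)

lemma stepOp_one (N : ℕ) : stepOp E R N 1 = 1 := by
  simp [stepOp, hE.sum_cell]

lemma stepOp_mul (N : ℕ) (a b : ℝ → ℂ) :
    stepOp E R N (a * b) = stepOp E R N a * stepOp E R N b := by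
  simp only [stepOp, Pi.mul_apply]
  rw [Finset.sum_mul_sum]
  refine Finset.sum_congr rfl fun i hi => ?_
  rw [Finset.sum_eq_single_of_mem i hi fun j _ hj => ?_]
  · rw [smul_mul_smul_comm, hE.cell_mul_cell, if_pos rfl]
  · rw [smul_mul_smul_comm, hE.cell_mul_cell, if_neg hj.symm, smul_zero]

/-- `a ↦ ∑ a(x_i) E(I_i)` is a homomorphism. -/
noncomputable def stepHom (N : ℕ) : (ℝ → ℂ) →ₐ[ℂ] (H →L[ℂ] H) :=
  AlgHom.ofLinearMap
    { toFun := stepOp E R N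
      map_add' := fun a b => by simp [stepOp, add_smul, Finset.sum_add_distrib]
      map_smul' := fun c a => by simp [stepOp, mul_smul, Finset.smul_sum] }
    (hE.stepOp_one N) (hE.stepOp_mul N)

lemma stepHom_apply (N : ℕ) (a : ℝ → ℂ) : hE.stepHom N a = stepOp E R N a := rfl

lemma star_stepOp (N : ℕ) (a : ℝ → ℂ) :
    star (stepOp E R N a) = stepOp E R N (fun x => starRingEnd ℂ (a x)) := by
  simp only [stepOp, star_sum, star_smul]
  refine Finset.sum_congr rfl fun i _ => ?_
  rw [(hE.proj.proj _ (measurableSet_cell N i)).isSelfAdjoint]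
  rfl

/-- The cells have orthogonal projections, so the step operator is diagonal and Parseval applies. -/
lemma norm_stepOp_apply_sq (N : ℕ) (a : ℝ → ℂ) (h : H) :
    ‖stepOp E R N a h‖ ^ 2 = ∑ i ∈ gridIndex R N, ‖a (node N i)‖ ^ 2 * ‖E (cell N i) h‖ ^ 2 := by
  have h1 : (((‖stepOp E R N a h‖ ^ 2 : ℝ)) : ℂ) =
      ⟪h, stepOp E R N (fun x => starRingEnd ℂ (a x) * a x) h⟫_ℂ := by
    have h2 : stepOp E R N (fun x => starRingEnd ℂ (a x) * a x) =
        star (stepOp E R N a) * stepOp E R N a := by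
      rw [hE.star_stepOp, ← hE.stepHom_apply, ← hE.stepHom_apply, ← hE.stepHom_apply, ← map_mul]
      rfl
    rw [h2, mul_apply_eq_comp, ContinuousLinearMap.star_eq_adjoint,
      ContinuousLinearMap.adjoint_inner_right, inner_self_eq_norm_sq_to_K]
    norm_cast
  have h3 : ⟪h, stepOp E R N (fun x => starRingEnd ℂ (a x) * a x) h⟫_ℂ =
      ((∑ i ∈ gridIndex R N, ‖a (node N i)‖ ^ 2 * ‖E (cell N i) h‖ ^ 2 : ℝ) : ℂ) := by
    rw [stepOp, sum_apply, inner_sum]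
    push_cast
    refine Finset.sum_congr rfl fun i _ => ?_
    rw [Pi.smul_apply, inner_smul_right,
      inner_self_eq_norm_sq_of_isStarProjection (hE.proj.proj _ (measurableSet_cell N i)),
      Complex.conj_mul']
    push_cast; rfl
  exact_mod_cast h1.trans h3

lemma sum_norm_cell_sq (N : ℕ) (h : H) : ∑ i ∈ gridIndex R N, ‖E (cell N i) h‖ ^ 2 = ‖h‖ ^ 2 := by
  have := hE.norm_stepOp_apply_sq N 1 h
  rw [← hE.stepHom_apply, map_one] at this
  simpa using this.symm

/-- A pointwise `ℓ²` bound for a family of functions becomes the same bound for the column of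
operators; the row and column bounds of the block decomposition come from here. -/
lemma sum_norm_stepOp_sq_le {κ : Type*} [Fintype κ] (N : ℕ) (a : κ → ℝ → ℂ) {c : ℝ}
    (hc : ∀ x ∈ Icc (-R : ℝ) R, ∑ j, ‖a j x‖ ^ 2 ≤ c) (h : H) :
    ∑ j, ‖stepOp E R N (a j) h‖ ^ 2 ≤ c * ‖h‖ ^ 2 := by
  simp_rw [hE.norm_stepOp_apply_sq]
  rw [Finset.sum_comm, ← hE.sum_norm_cell_sq N h, Finset.mul_sum]
  refine Finset.sum_le_sum fun i hi => ?_
  rw [← Finset.sum_mul]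
  gcongr
  exact hc _ (node_mem hi)

lemma norm_stepOp_le (N : ℕ) {a : ℝ → ℂ} {c : ℝ} (hc0 : 0 ≤ c)
    (hc : ∀ x ∈ Icc (-R : ℝ) R, ‖a x‖ ≤ c) : ‖stepOp E R N a‖ ≤ c := by
  refine ContinuousLinearMap.opNorm_le_bound _ hc0 fun h => ?_
  refine le_of_sq_le_sq ?_ (by positivity)
  have := hE.sum_norm_stepOp_sq_le (κ := Unit) N (fun _ => a) (c := c ^ 2)
    (fun x hx => by simpa using pow_le_pow_left₀ (norm_nonneg _) (hc x hx) 2) h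
  simpa [mul_pow] using this

/-- The node is the left endpoint of its cell, so `0 ≤ t - node ≤ 1/(N+1)` there. The difference
therefore lies between `0` and `1/(N+1)` in the operator order. -/
lemma norm_sub_stepOp_le (N : ℕ) :
    ‖A - stepOp E R N (fun x => (x : ℂ))‖ ≤ 1 / ((N : ℝ) + 1) := by
  set D := A - stepOp E R N (fun x => (x : ℂ)) with hD
  set δ : ℝ := 1 / ((N : ℝ) + 1) with hδ
  have hδ0 : 0 ≤ δ := by positivity
  have key : ∀ x, ∃ r : ℝ, ⟪x, D x⟫_ℂ = r ∧ 0 ≤ r ∧ r ≤ δ * ‖x‖ ^ 2 := by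
    intro x
    obtain ⟨μ, _, h1, h2, h3⟩ := hE.resolves x
    have hU := measurableSet_biUnion_cell R N
    have hμU : μ.restrict (⋃ i ∈ gridIndex R N, cell N i) = μ := by
      refine Measure.restrict_eq_self_of_ae_mem (ae_iff.2 ?_)
      have := hE.proj.measureReal_eq h1 hU.compl
      rw [hE.proj.compl_eq_zero hU (hE.biUnion_cell N), zero_apply, norm_zero,
        zero_pow two_ne_zero, measureReal_eq_zero_iff] at this
      exact this
    have hsplit : ∫ t, t ∂μ = ∑ i ∈ gridIndex R N, ∫ t in cell N i, t ∂μ := by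
      rw [← integral_biUnion_finset _ (fun i _ => measurableSet_cell N i)
        (fun i _ j _ hij => pairwise_disjoint_cell N hij) (fun i _ => h2.integrableOn), hμU]
    have hμc : ∀ i, μ.real (cell N i) = ‖E (cell N i) x‖ ^ 2 := fun i =>
      hE.proj.measureReal_eq h1 (measurableSet_cell N i)
    refine ⟨∑ i ∈ gridIndex R N, ∫ t in cell N i, (t - node N i) ∂μ, ?_, ?_, ?_⟩
    · rw [hD, sub_apply, inner_sub_right, h3, hsplit, stepOp, sum_apply, inner_sum]
      push_cast
      rw [← Finset.sum_sub_distrib]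
      refine Finset.sum_congr rfl fun i _ => ?_
      rw [integral_sub h2.integrableOn (integrable_const _),Pi.smul_apply, inner_smul_right,
        ← h1 _ (measurableSet_cell N i), setIntegral_const, smul_eq_mul]
      push_cast; ring
    · refine Finset.sum_nonneg fun i _ => setIntegral_nonneg (measurableSet_cell N i) fun t ht => ?_
      linarith [(mem_cell_bounds ht).1]
    · rw [← hE.sum_norm_cell_sq N x, Finset.mul_sum]
      refine Finset.sum_le_sum fun i _ => ?_
      calc ∫ t in cell N i, (t - node N i) ∂μ ≤ ∫ t in cell N i, δ ∂μ := by
            refine setIntegral_mono_on (h2.integrableOn.sub (integrable_const _))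
              (integrable_const _) (measurableSet_cell N i) fun t ht => ?_
            linarith [(mem_cell_bounds ht).2]
        _ = δ * ‖E (cell N i) x‖ ^ 2 := by
            rw [setIntegral_const, smul_eq_mul, hμc, mul_comm]
  have hsym : ∀ x, ⟪D x, x⟫_ℂ = ⟪x, D x⟫_ℂ := fun x => by
    obtain ⟨r, hr, -⟩ := key x
    rw [← inner_conj_symm, hr, Complex.conj_ofReal]
  have h0 : 0 ≤ D := by
    rw [ContinuousLinearMap.nonneg_iff_isPositive, ContinuousLinearMap.isPositive_iff_complex]
    intro x
    obtain ⟨r, hr, hr0, -⟩ := key x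
    rw [hsym, hr]
    simp [hr0]
  have h1 : D ≤ (δ : ℂ) • 1 := by
    rw [ContinuousLinearMap.le_def, ContinuousLinearMap.isPositive_iff_complex]
    intro x
    obtain ⟨r, hr, -, hr1⟩ := key x
    have : ⟪((δ : ℂ) • (1 : H →L[ℂ] H) - D) x, x⟫_ℂ = ((δ * ‖x‖ ^ 2 - r : ℝ) : ℂ) := by
      rw [sub_apply, inner_sub_left, hsym, hr,
        show ((δ : ℂ) • (1 : H →L[ℂ] H)) x = (δ : ℂ) • x from rfl, inner_smul_left,
        inner_self_eq_norm_sq_to_K]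
      push_cast
      simp
    rw [this]
    exact ⟨by simp only [RCLike.re_to_complex, Complex.ofReal_re],
      by simp only [RCLike.re_to_complex, Complex.ofReal_re]; linarith⟩
  refine (CStarAlgebra.norm_le_norm_of_nonneg_of_le h0 h1).trans ?_
  rw [norm_smul, Complex.norm_real, Real.norm_of_nonneg hδ0]
  exact mul_le_of_le_one_right hδ0 (ContinuousLinearMap.norm_id_le)

lemma tendsto_stepOp_id : Tendsto (fun N => stepOp E R N (fun x => (x : ℂ))) atTop (𝓝 A) := by
  rw [tendsto_iff_norm_sub_tendsto_zero]
  refine squeeze_zero (fun N => norm_nonneg _) (fun N => ?_) tendsto_one_div_add_atTop_nhds_zero_nat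
  rw [norm_sub_rev]
  exact hE.norm_sub_stepOp_le N

lemma tendsto_stepOp_polynomial (q : Polynomial ℂ) :
    Tendsto (fun N => stepOp E R N (fun x => q.eval (x : ℂ))) atTop (𝓝 (Polynomial.aeval A q)) := by
  have h1 : ∀ N, stepOp E R N (fun x => q.eval (x : ℂ)) =
      Polynomial.aeval (stepOp E R N (fun x => (x : ℂ))) q := by
    intro N
    rw [← hE.stepHom_apply, ← hE.stepHom_apply, Polynomial.aeval_algHom_apply]
    congr 1
    funext x
    simp [Polynomial.aeval_def, Polynomial.eval₂_eq_eval_map]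
  simp_rw [h1]
  exact (Polynomial.continuous_aeval q).tendsto A |>.comp hE.tendsto_stepOp_id

/-- For polynomials convergence follows from the homomorphism property and from the convergence for
the coordinate function. Weierstrass approximation of the real and imaginary parts, with a bound
uniform in `N`, does the rest. -/
lemma exists_tendsto_stepOp {a : ℝ → ℂ} (ha : Continuous a) :
    ∃ L, Tendsto (fun N => stepOp E R N a) atTop (𝓝 L) := by
  refine cauchySeq_tendsto_of_complete (Metric.cauchySeq_iff'.2 fun ε hε => ?_)
  obtain ⟨q₁, hq₁⟩ := exists_polynomial_near_of_continuousOn (-R : ℝ) R (fun x => (a x).re)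
    (by fun_prop) (ε / 8) (by positivity)
  obtain ⟨q₂, hq₂⟩ := exists_polynomial_near_of_continuousOn (-R : ℝ) R (fun x => (a x).im)
    (by fun_prop) (ε / 8) (by positivity)
  set q : Polynomial ℂ := q₁.map (algebraMap ℝ ℂ) + Polynomial.C Complex.I * q₂.map (algebraMap ℝ ℂ)
  have hq : ∀ x ∈ Icc (-R : ℝ) R, ‖(a - fun x : ℝ => q.eval (x : ℂ)) x‖ ≤ ε / 4 := by
    intro x hx
    have e1 : ∀ q : Polynomial ℝ, (q.map (algebraMap ℝ ℂ)).eval (x : ℂ) = ((q.eval x : ℝ) : ℂ) :=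
      fun q => by
        have := Polynomial.eval_map_algebraMap (R := ℝ) (B := ℂ) q (x : ℂ)
        rw [this]
        exact (Polynomial.aeval_algebraMap_apply_eq_algebraMap_eval x q)
    have e2 : (a - fun x : ℝ => q.eval (x : ℂ)) x =
        (((a x).re - q₁.eval x : ℝ) : ℂ) + Complex.I * (((a x).im - q₂.eval x : ℝ) : ℂ) := by
      simp only [Pi.sub_apply, q, Polynomial.eval_add, Polynomial.eval_mul, Polynomial.eval_C, e1]
      conv_lhs => rw [← Complex.re_add_im (a x)]
      push_cast; ring
    rw [e2]
    refine (norm_add_le _ _).trans ?_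
    rw [norm_mul, Complex.norm_I, one_mul, Complex.norm_real, Complex.norm_real, Real.norm_eq_abs,
      Real.norm_eq_abs, abs_sub_comm, abs_sub_comm (a x).im]
    linarith [hq₁ x hx, hq₂ x hx]
  have hC := (hE.tendsto_stepOp_polynomial q).cauchySeq
  obtain ⟨n₀, hn₀⟩ := Metric.cauchySeq_iff'.1 hC (ε / 4) (by positivity)
  refine ⟨n₀, fun n hn => ?_⟩
  have h1 := hn₀ n hn
  have h2 : ∀ n, dist (stepOp E R n a) (stepOp E R n (fun x => q.eval (x : ℂ))) ≤ ε / 4 := by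
    intro n
    rw [dist_eq_norm, ← hE.stepHom_apply, ← hE.stepHom_apply, ← map_sub, hE.stepHom_apply]
    exact hE.norm_stepOp_le n (by positivity) hq
  have h3 := dist_triangle4 (stepOp E R n a) (stepOp E R n (fun x => q.eval (x : ℂ)))
    (stepOp E R n₀ (fun x => q.eval (x : ℂ))) (stepOp E R n₀ a)
  have h4 := h2 n₀
  rw [dist_comm] at h4
  linarith [h2 n]

end IsSpectralOn

/-- The integral of a continuous function with respect to a spectral measure on `[-R, R]`. -/
noncomputable def fnOf (E : Set ℝ → H →L[ℂ] H) (R : ℕ) (a : ℝ → ℂ) : H →L[ℂ] H :=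
  limUnder atTop fun N => stepOp E R N a

lemma IsSpectralOn.tendsto_fnOf {E : Set ℝ → H →L[ℂ] H} {A : H →L[ℂ] H} {R : ℕ}
    (hE : IsSpectralOn E A R) {a : ℝ → ℂ} (ha : Continuous a) :
    Tendsto (fun N => stepOp E R N a) atTop (𝓝 (fnOf E R a)) :=
  tendsto_nhds_limUnder (hE.exists_tendsto_stepOp ha)

lemma IsSpectralOn.norm_fnOf_le {E : Set ℝ → H →L[ℂ] H} {A : H →L[ℂ] H} {R : ℕ}
    (hE : IsSpectralOn E A R) {a : ℝ → ℂ} (ha : Continuous a) {c : ℝ}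
    (hc : ∀ x ∈ Icc (-R : ℝ) R, ‖a x‖ ≤ c) : ‖fnOf E R a‖ ≤ c :=
  le_of_tendsto' (hE.tendsto_fnOf ha).norm fun N => hE.norm_stepOp_le N
    ((norm_nonneg _).trans (hc 0 (by simp))) hc

end StepOperators

end NoncommFun

namespace NoncommFun

/-! ### Complex measures generated by spectral measures and nuclear operators. -/

section ComplexMeasures

open Filter Topology

/-- A series of complex measures with summable variations converges to a complex measure. -/
lemma exists_hasSum_complexMeasure {X : Type*} [MeasurableSpace X] {ι : Type*}
    (ν : ι → ComplexMeasure X) (hν : ∑' i, (ν i).variation Set.univ < ∞) :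
    ∃ ν' : ComplexMeasure X, (∀ S, HasSum (fun i => ν i S) (ν' S)) ∧
      ν'.variation ≤ Measure.sum fun i => (ν i).variation := by
  have hle : ∀ i S, ‖ν i S‖ₑ ≤ (ν i).variation S := fun i S =>
    (ν i).enorm_measure_le_variation S
  have hsummable : ∀ S, Summable fun i => ν i S := by
    intro S
    refine Summable.of_norm ?_
    have : ∑' i, ‖ν i S‖ₑ ≠ ∞ := ((ENNReal.tsum_le_tsum fun i =>
      (hle i S).trans (measure_mono (subset_univ S))).trans_lt hν).ne
    simpa using ENNReal.summable_toReal this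
  refine ⟨⟨fun S => ∑' i, ν i S, by simp, fun S hS => by simp [hS], fun f hf hd => ?_⟩,
    fun S => (hsummable S).hasSum, ?_⟩
  · have h1 : Summable fun q : ι × ℕ => ν q.1 (f q.2) := by
      refine Summable.of_norm ?_
      have : ∑' q : ι × ℕ, ‖ν q.1 (f q.2)‖ₑ ≠ ∞ := by
        rw [ENNReal.tsum_prod (f := fun i n => ‖ν i (f n)‖ₑ)]
        refine ((ENNReal.tsum_le_tsum fun i => ?_).trans_lt hν).ne
        calc ∑' n, ‖ν i (f n)‖ₑ ≤ ∑' n, (ν i).variation (f n) := ENNReal.tsum_le_tsum fun n => hle _ _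
          _ = (ν i).variation (⋃ n, f n) := (measure_iUnion hd hf).symm
          _ ≤ _ := measure_mono (subset_univ _)
      simpa using ENNReal.summable_toReal this
    have h2 := h1.hasSum.prod_fiberwise fun i => (ν i).m_iUnion hf hd
    have h3 : HasSum (fun q : ℕ × ι => ν q.2 (f q.1)) (∑' q : ι × ℕ, ν q.1 (f q.2)) :=
      (Equiv.prodComm ℕ ι).hasSum_iff.2 h1.hasSum
    have h4 := h3.prod_fiberwise fun n => (hsummable (f n)).hasSum
    rwa [← h2.tsum_eq] at h4
  · refine VectorMeasure.variation_le_of_forall_enorm_le fun S hS => ?_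
    rw [Measure.sum_apply _ hS]
    refine le_trans ?_ (ENNReal.tsum_le_tsum fun i => hle i S)
    exact enorm_tsum_le_tsum_enorm

variable {H : Type u} [NormedAddCommGroup H] [InnerProductSpace ℂ H] [CompleteSpace H]
variable {X Y : Type*} [MeasurableSpace X] [MeasurableSpace Y]

open scoped Classical in
/-- The complex measure `⟨E(·) v, k⟩`. -/
noncomputable def IsProjectionMeasure.complexMeasure {E : Set X → H →L[ℂ] H}
    (hE : IsProjectionMeasure E) (k v : H) : ComplexMeasure X where
  measureOf' S := if MeasurableSet S then ⟪k, E S v⟫_ℂ else 0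
  empty' := by simp [hE.empty]
  not_measurable' S hS := if_neg hS
  m_iUnion' f hf hd := by
    simp only [hf, if_true, MeasurableSet.iUnion hf]
    exact (hE.hasSum_iUnion f hf hd v).mapL (innerSL ℂ k)

lemma IsProjectionMeasure.complexMeasure_apply {E : Set X → H →L[ℂ] H}
    (hE : IsProjectionMeasure E) (k v : H) {S : Set X} (hS : MeasurableSet S) :
    hE.complexMeasure k v S = ⟪k, E S v⟫_ℂ := if_pos hS

lemma IsProjectionMeasure.norm_apply_le {E : Set X → H →L[ℂ] H} (hE : IsProjectionMeasure E)
    {S : Set X} (hS : MeasurableSet S) (v : H) : ‖E S v‖ ≤ ‖v‖ :=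
  (ContinuousLinearMap.le_opNorm _ _).trans
    (mul_le_of_le_one_left (norm_nonneg _) (hE.proj S hS).norm_le)

/-- By Cauchy–Schwarz `|⟨E(T)k, E(T)v⟩| ≤ ‖E(T)k‖ ‖E(T)v‖`. This is relaxed to a sum of squares
because the sum, unlike the product, is a measure in `T` and so dominates the variation. -/
lemma IsProjectionMeasure.variation_complexMeasure_le {E : Set X → H →L[ℂ] H}
    (hE : IsProjectionMeasure E) (k v : H) {S : Set X} (hS : MeasurableSet S) :
    (hE.complexMeasure k v).variation S ≤
      ENNReal.ofReal (‖E S k‖ ^ 2) + ENNReal.ofReal (‖E S v‖ ^ 2) := by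
  obtain ⟨μ, _, hμ⟩ := hE.meas k
  obtain ⟨μ', _, hμ'⟩ := hE.meas v
  have e1 : ∀ T, MeasurableSet T → μ T = ENNReal.ofReal (‖E T k‖ ^ 2) := fun T hT => by
    rw [← hE.measureReal_eq hμ hT, ofReal_measureReal]
  have e2 : ∀ T, MeasurableSet T → μ' T = ENNReal.ofReal (‖E T v‖ ^ 2) := fun T hT => by
    rw [← hE.measureReal_eq hμ' hT, ofReal_measureReal]
  have h : (hE.complexMeasure k v).variation ≤ μ + μ' := by
    refine VectorMeasure.variation_le_of_forall_enorm_le fun T hT => ?_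
    rw [hE.complexMeasure_apply k v hT, Measure.add_apply, e1 T hT, e2 T hT,
      ← ENNReal.ofReal_add (by positivity) (by positivity), ← ofReal_norm]
    refine ENNReal.ofReal_le_ofReal ?_
    rw [inner_self_of_isStarProjection (hE.proj T hT)]
    refine (norm_inner_le_norm _ _).trans ?_
    nlinarith [sq_nonneg (‖E T k‖ - ‖E T v‖), norm_nonneg (E T k), norm_nonneg (E T v)]
  refine (h S).trans_eq ?_
  rw [Measure.add_apply, e1 S hS, e2 S hS]

lemma IsProjectionMeasure.variation_complexMeasure_univ_le {E : Set X → H →L[ℂ] H}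
    (hE : IsProjectionMeasure E) {k v : H} {a b : ℝ} (hk : ‖k‖ ≤ a) (hv : ‖v‖ ≤ b) :
    (hE.complexMeasure k v).variation Set.univ ≤ ENNReal.ofReal (a ^ 2) + ENNReal.ofReal (b ^ 2) := by
  refine (hE.variation_complexMeasure_le k v .univ).trans ?_
  gcongr
  · exact (hE.norm_apply_le .univ k).trans hk
  · exact (hE.norm_apply_le .univ v).trans hv

lemma IsProjectionMeasure.isFiniteMeasure_variation {E : Set X → H →L[ℂ] H}
    (hE : IsProjectionMeasure E) (k v : H) : IsFiniteMeasure (hE.complexMeasure k v).variation :=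
  ⟨(hE.variation_complexMeasure_univ_le le_rfl le_rfl).trans_lt (by finiteness)⟩

/-- The complex measure `⟨E₁(·) S E₂(·) h, k⟩` for a nuclear operator `S`. -/
lemma exists_complexMeasure_prod {E₁ : Set X → H →L[ℂ] H} {E₂ : Set Y → H →L[ℂ] H}
    (hE₁ : IsProjectionMeasure E₁) (hE₂ : IsProjectionMeasure E₂) {ι : Type*} {c : ι → ℝ}
    (hc : Summable c) (hc0 : ∀ i, 0 ≤ c i) {x v : ι → H} (hx : ∀ i, ‖x i‖ ≤ 1)
    (hv : ∀ i, ‖v i‖ ≤ 1) {S : H →L[ℂ] H}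
    (hS : ∀ h, HasSum (fun i => (c i : ℂ) • ⟪x i, h⟫_ℂ • v i) (S h)) (h k : H) :
    ∃ ν : ComplexMeasure (X × Y),
      (∀ Λ Δ, MeasurableSet Λ → MeasurableSet Δ → ν (Λ ×ˢ Δ) = ⟪k, E₁ Λ (S (E₂ Δ h))⟫_ℂ) ∧
      IsFiniteMeasure ν.variation ∧
      (∀ Λ, MeasurableSet Λ → E₁ Λ = 0 → ν.variation (Λ ×ˢ Set.univ) = 0) ∧
      (∀ Δ, MeasurableSet Δ → E₂ Δ = 0 → ν.variation (Set.univ ×ˢ Δ) = 0) := by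
  set B := ContinuousLinearMap.mul ℝ ℂ with hB
  have f₁ := fun i => hE₁.isFiniteMeasure_variation k (v i)
  have f₂ := fun i => hE₂.isFiniteMeasure_variation (x i) h
  -- A rank one term gives a product of two complex measures; the weights `c i` make the series of
  -- variations converge.
  let ν₀ : ι → ComplexMeasure (X × Y) := fun i =>
    (c i) • (hE₁.complexMeasure k (v i)).prod (hE₂.complexMeasure (x i) h) B
  have hvar : ∀ i, (ν₀ i).variation ≤ ENNReal.ofReal (c i) • ‖B‖ₑ •
      (hE₁.complexMeasure k (v i)).variation.prod (hE₂.complexMeasure (x i) h).variation := by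
    intro i
    simp only [ν₀]
    rw [VectorMeasure.variation_smul]
    refine Measure.le_iff.2 fun s hs => ?_
    have h1 : ((hE₁.complexMeasure k (v i)).prod (hE₂.complexMeasure (x i) h) B).variation s ≤
      (‖B‖ₑ • (hE₁.complexMeasure k (v i)).variation.prod
        (hE₂.complexMeasure (x i) h).variation) s := VectorMeasure.variation_prod_le s
    rw [Measure.smul_apply, Measure.smul_apply, smul_eq_mul, ← Real.enorm_of_nonneg (hc0 i)]
    exact mul_le_mul_right h1 _
  have hvar' : ∀ i s t, (ν₀ i).variation (s ×ˢ t) ≤ ENNReal.ofReal (c i) * (‖B‖ₑ *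
      ((hE₁.complexMeasure k (v i)).variation s * (hE₂.complexMeasure (x i) h).variation t)) := by
    intro i s t
    refine (hvar i _).trans_eq ?_
    rw [Measure.smul_apply, Measure.smul_apply, Measure.prod_prod]; rfl
  have hfin : ∑' i, (ν₀ i).variation Set.univ < ∞ := by
    set D := ‖B‖ₑ * ((ENNReal.ofReal (‖k‖ ^ 2) + ENNReal.ofReal (1 ^ 2)) *
      (ENNReal.ofReal (1 ^ 2) + ENNReal.ofReal (‖h‖ ^ 2))) with hD
    have hDf : D < ∞ := by
      rw [hD, enorm_eq_nnnorm]
      finiteness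
    have : ∀ i, (ν₀ i).variation Set.univ ≤ ENNReal.ofReal (c i) * D := by
      intro i
      rw [← univ_prod_univ]
      refine (hvar' i _ _).trans ?_
      rw [hD]
      gcongr
      · exact hE₁.variation_complexMeasure_univ_le le_rfl (hv i)
      · exact hE₂.variation_complexMeasure_univ_le (hx i) le_rfl
    refine (ENNReal.tsum_le_tsum this).trans_lt ?_
    rw [ENNReal.tsum_mul_right]
    exact ENNReal.mul_lt_top hc.tsum_ofReal_lt_top hDf
  obtain ⟨ν, hν, hle⟩ := exists_hasSum_complexMeasure ν₀ hfin
  refine ⟨ν, fun Λ Δ hΛ hΔ => ?_, ⟨?_⟩, fun Λ hΛ h0 => ?_, fun Δ hΔ h0 => ?_⟩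
  · refine (hν _).unique ?_
    have h1 := ((hS (E₂ Δ h)).mapL (E₁ Λ)).mapL (innerSL ℂ k)
    have h2 : (fun i => ν₀ i (Λ ×ˢ Δ)) =
        fun i => innerSL ℂ k (E₁ Λ ((c i : ℂ) • ⟪x i, E₂ Δ h⟫_ℂ • v i)) := by
      funext i
      simp only [ν₀]
      rw [smul_apply, VectorMeasure.prod_apply, hB, ContinuousLinearMap.mul_apply',
        hE₁.complexMeasure_apply _ _ hΛ, hE₂.complexMeasure_apply _ _ hΔ, innerSL_apply_apply,
        map_smul, map_smul, inner_smul_right, inner_smul_right, Complex.real_smul]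
      ring
    rwa [h2]
  · refine (hle _).trans_lt ?_
    rwa [Measure.sum_apply _ .univ]
  -- Strips over null sets of the spectral measures are null; this later confines `ν` to `[-R,R]²`.
  · refine le_antisymm ((hle _).trans_eq ?_) zero_le
    rw [Measure.sum_apply _ (hΛ.prod .univ), ENNReal.tsum_eq_zero]
    intro i
    refine le_antisymm ((hvar' i _ _).trans_eq ?_) zero_le
    have : (hE₁.complexMeasure k (v i)).variation Λ = 0 :=
      le_antisymm ((hE₁.variation_complexMeasure_le k (v i) hΛ).trans_eq (by simp [h0])) zero_le
    simp [this]
  · refine le_antisymm ((hle _).trans_eq ?_) zero_le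
    rw [Measure.sum_apply _ (MeasurableSet.univ.prod hΔ), ENNReal.tsum_eq_zero]
    intro i
    refine le_antisymm ((hvar' i _ _).trans_eq ?_) zero_le
    have : (hE₂.complexMeasure (x i) h).variation Δ = 0 :=
      le_antisymm ((hE₂.variation_complexMeasure_le (x i) h hΔ).trans_eq (by simp [h0])) zero_le
    simp [this]

end ComplexMeasures

end NoncommFun

namespace NoncommFun

/-! ### Nuclear expansions, the trace class and traces. -/

section NuclearOperators

open Filter Topology

variable {H : Type u} [NormedAddCommGroup H] [InnerProductSpace ℂ H]

/-- `S = ∑ ⟨·, x_i⟩ y_i` with `∑ ‖x_i‖ ‖y_i‖ < ∞`. -/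
structure IsNuclearExpansion (S : H →L[ℂ] H) {ι : Type*} (x y : ι → H) : Prop where
  summable : Summable fun i => ‖x i‖ * ‖y i‖
  hasSum : ∀ h, HasSum (fun i => ⟪x i, h⟫_ℂ • y i) (S h)

/-- Cauchy–Schwarz along the diagonal, then Bessel for each of the two systems. -/
lemma diagNorm_one_smulRight_le (x y : H) :
    diagNorm 1 ((innerSL ℂ x).smulRight y) ≤ ENNReal.ofReal (‖x‖ * ‖y‖) := by
  refine diagNorm_le fun N e f he hf => ?_
  simp only [ENNReal.rpow_one, one_div, inv_one]
  have h1 : ∀ n, ‖⟪f n, (innerSL ℂ x).smulRight y (e n)⟫_ℂ‖ₑ =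
      ENNReal.ofReal (‖⟪e n, x⟫_ℂ‖ * ‖⟪f n, y⟫_ℂ‖) := fun n => by
    rw [← ofReal_norm, ContinuousLinearMap.smulRight_apply, inner_smul_right, norm_mul,
      innerSL_apply_apply, norm_inner_symm]
  simp_rw [h1]
  rw [← ENNReal.ofReal_sum_of_nonneg fun _ _ => by positivity]
  refine ENNReal.ofReal_le_ofReal ((Real.sum_mul_le_sqrt_mul_sqrt _ _ _).trans ?_)
  gcongr
  · rw [Real.sqrt_le_left (norm_nonneg _)]; exact he.sum_inner_products_le x
  · rw [Real.sqrt_le_left (norm_nonneg _)]; exact hf.sum_inner_products_le y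

namespace IsNuclearExpansion

variable {S : H →L[ℂ] H} {ι : Type*} {x y : ι → H} (hS : IsNuclearExpansion S x y)
include hS

lemma memSchatten [CompleteSpace H] : MemSchatten 1 S := by
  have hn : ∀ i, ‖(innerSL ℂ (x i)).smulRight (y i)‖ = ‖x i‖ * ‖y i‖ := fun i => by
    rw [ContinuousLinearMap.norm_smulRight_apply, innerSL_apply_norm]
  have h1 : Summable fun i => (innerSL ℂ (x i)).smulRight (y i) :=
    Summable.of_norm (by simpa only [hn] using hS.summable)
  have h2 : HasSum (fun i => (innerSL ℂ (x i)).smulRight (y i)) S := by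
    convert! h1.hasSum using 1
    ext h
    refine (hS.hasSum h).unique ?_
    exact h1.hasSum.mapL (ContinuousLinearMap.apply ℂ H h)
  refine (schattenNorm_le_diagNorm le_rfl S).trans_lt (ENNReal.mul_lt_top (by finiteness) ?_)
  refine (diagNorm_tsum_le le_rfl h2).trans_lt ?_
  refine (ENNReal.tsum_le_tsum fun i => diagNorm_one_smulRight_le (x i) (y i)).trans_lt ?_
  exact hS.summable.tsum_ofReal_lt_top

/-- Cauchy–Schwarz and Bessel make the double series over the expansion and the basis absolutely
convergent, so the order of summation can be exchanged. The value does not involve the basis. -/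
lemma hasTrace : HasTrace S (∑' i, ⟪x i, y i⟫_ℂ) := by
  intro s b
  have hb := b.orthonormal
  have h1 : ∀ i, HasSum (fun e => ⟪x i, b e⟫_ℂ * ⟪b e, y i⟫_ℂ) ⟪x i, y i⟫_ℂ := fun i =>
    b.hasSum_inner_mul_inner _ _
  have hfin : ∀ i (t : Finset s), ∑ e ∈ t, ‖⟪x i, b e⟫_ℂ * ⟪b e, y i⟫_ℂ‖ ≤ ‖x i‖ * ‖y i‖ := by
    intro i t
    simp_rw [norm_mul]
    refine (Real.sum_mul_le_sqrt_mul_sqrt _ _ _).trans ?_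
    gcongr
    · rw [Real.sqrt_le_left (norm_nonneg _)]
      rw [Finset.sum_congr rfl fun e _ => by rw [norm_inner_symm]]
      exact hb.sum_inner_products_le (x i)
    · rw [Real.sqrt_le_left (norm_nonneg _)]; exact hb.sum_inner_products_le (y i)
  have h2 : Summable fun q : ι × s => ⟪x q.1, b q.2⟫_ℂ * ⟪b q.2, y q.1⟫_ℂ := by
    refine Summable.of_norm ((summable_prod_of_nonneg fun q => norm_nonneg _).2 ⟨fun i => ?_, ?_⟩)
    · exact summable_of_sum_le (fun _ => norm_nonneg _) (hfin i)
    · exact hS.summable.of_nonneg_of_le (fun i => tsum_nonneg fun _ => norm_nonneg _)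
        fun i => Real.tsum_le_of_sum_le (fun _ => norm_nonneg _) (hfin i)
  have h3 := h2.hasSum.prod_fiberwise h1
  rw [h3.tsum_eq]
  have h4 : HasSum (fun q : s × ι => ⟪x q.2, b q.1⟫_ℂ * ⟪b q.1, y q.2⟫_ℂ) _ :=
    (Equiv.prodComm s ι).hasSum_iff.2 h2.hasSum
  refine h4.prod_fiberwise fun e => ?_
  have h5 := (hS.hasSum (b e)).mapL (innerSL ℂ (b e))
  simpa only [innerSL_apply_apply, inner_smul_right] using h5

lemma mul_mul [CompleteSpace H] (X Y : H →L[ℂ] H) :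
    IsNuclearExpansion (Y * S * X) (fun i => star X (x i)) (fun i => Y (y i)) where
  summable := by
    refine (hS.summable.mul_left (‖X‖ * ‖Y‖)).of_nonneg_of_le (fun _ => by positivity) fun i => ?_
    calc ‖star X (x i)‖ * ‖Y (y i)‖ ≤ (‖star X‖ * ‖x i‖) * (‖Y‖ * ‖y i‖) := by
          gcongr <;> exact ContinuousLinearMap.le_opNorm _ _
      _ = _ := by rw [norm_star]; ring
  hasSum h := by
    have := (hS.hasSum (X h)).mapL Y
    simp only [map_smul] at this
    simp only [ContinuousLinearMap.star_eq_adjoint, ContinuousLinearMap.adjoint_inner_left]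
    exact this

/-- An explicit expansion of the transformed operator: it shows that the image is of trace class and
makes its trace computable. -/
lemma hasSum_mul_mul [CompleteSpace H] {κ : Type*} {X Y : κ → H →L[ℂ] H}
    (hXY : Summable fun m => ‖X m‖ * ‖Y m‖) {K : H →L[ℂ] H}
    (hK : HasSum (fun m => Y m * S * X m) K) :
    IsNuclearExpansion K (fun q : κ × ι => star (X q.1) (x q.2)) (fun q => Y q.1 (y q.2)) := by
  have hs : Summable fun q : κ × ι => ‖star (X q.1) (x q.2)‖ * ‖Y q.1 (y q.2)‖ := by
    refine (hXY.mul_of_nonneg hS.summable (fun _ => by positivity)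
      (fun _ => by positivity)).of_nonneg_of_le (fun _ => by positivity) fun q => ?_
    calc ‖star (X q.1) (x q.2)‖ * ‖Y q.1 (y q.2)‖
        ≤ (‖star (X q.1)‖ * ‖x q.2‖) * (‖Y q.1‖ * ‖y q.2‖) := by
          gcongr <;> exact ContinuousLinearMap.le_opNorm _ _
      _ = _ := by rw [norm_star]; ring
  refine ⟨hs, fun h => ?_⟩
  have h1 : Summable fun q : κ × ι => ⟪star (X q.1) (x q.2), h⟫_ℂ • Y q.1 (y q.2) := by
    refine Summable.of_norm ((hs.mul_right ‖h‖).of_nonneg_of_le (fun _ => norm_nonneg _) fun q => ?_)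
    rw [norm_smul]
    calc _ ≤ ‖star (X q.1) (x q.2)‖ * ‖h‖ * ‖Y q.1 (y q.2)‖ := by
          gcongr; exact norm_inner_le_norm _ _
      _ = _ := by ring
  have h2 := h1.hasSum.prod_fiberwise fun m => (hS.mul_mul (X m) (Y m)).hasSum h
  have h3 := hK.mapL (ContinuousLinearMap.apply ℂ H h)
  exact h2.unique h3 ▸ h1.hasSum

end IsNuclearExpansion

lemma exists_isNuclearExpansion [CompleteSpace H] {S : H →L[ℂ] H} (hS : MemSchatten 1 S) :
    ∃ (ι : Type) (x y : ι → H), IsNuclearExpansion S x y := by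
  obtain ⟨ι, _, v, hv, h1, h2⟩ := exists_orthonormal_expansion (p := 1) (by simp) S hS
  refine ⟨ι, fun i => star S (v i), v, ?_, h1⟩
  have h3 : ∑' i, ‖star S (v i)‖ₑ ≠ ∞ := by
    simp only [ENNReal.rpow_one] at h2
    exact (h2.trans_lt (ENNReal.mul_lt_top (by finiteness) hS)).ne
  simpa [hv.1] using ENNReal.summable_toReal h3

lemma isNuclearExpansion_smulRight (x y : H) :
    IsNuclearExpansion ((innerSL ℂ x).smulRight y) (fun _ : Unit => x) (fun _ => y) where
  summable := (hasSum_fintype _).summable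
  hasSum h := by simp

lemma HasTrace.unique [CompleteSpace H] {K : H →L[ℂ] H} {t t' : ℂ} (h : HasTrace K t)
    (h' : HasTrace K t') : t = t' := by
  obtain ⟨s, b, -⟩ := exists_hilbertBasis ℂ H
  exact (h s b).unique (h' s b)

end NuclearOperators

/-! ### Riemann sums of double operator integrals for nuclear series. -/

section DoubleSteps

open Filter Topology

variable {H : Type u} [NormedAddCommGroup H] [InnerProductSpace ℂ H] [CompleteSpace H]

/-- The Riemann sum of the double operator integral `∬ F(x,y) dE₁(x) S dE₂(y)`. -/
noncomputable def doubleStepOp (E₁ E₂ : Set ℝ → H →L[ℂ] H) (R N : ℕ) (S : H →L[ℂ] H)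
    (F : ℝ → ℝ → ℂ) : H →L[ℂ] H :=
  ∑ i ∈ gridIndex R N, ∑ j ∈ gridIndex R N,
    F (node N i) (node N j) • (E₁ (cell N i) * S * E₂ (cell N j))

omit [CompleteSpace H] in
lemma doubleStepOp_mul (E₁ E₂ : Set ℝ → H →L[ℂ] H) (R N : ℕ) (S : H →L[ℂ] H) (a b : ℝ → ℂ) :
    doubleStepOp E₁ E₂ R N S (fun x y => a x * b y) = stepOp E₁ R N a * S * stepOp E₂ R N b := by
  simp only [doubleStepOp, stepOp, Finset.sum_mul, Finset.mul_sum]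
  rw [Finset.sum_comm]
  refine Finset.sum_congr rfl fun j _ => Finset.sum_congr rfl fun i _ => ?_
  rw [smul_mul_assoc, smul_mul_smul_comm]

/-- `F(x,y) = ∑ a_m(x) b_m(y)` on `[-R, R]²`, with an absolutely convergent series of products of
continuous functions. -/
structure IsNuclearSeries (R : ℕ) (F : ℝ → ℝ → ℂ) {ι : Type*} (a b : ι → ℝ → ℂ) (c d : ι → ℝ) :
    Prop where
  continuous_left : ∀ m, Continuous (a m)
  continuous_right : ∀ m, Continuous (b m)
  norm_left : ∀ m, ∀ x ∈ Icc (-R : ℝ) R, ‖a m x‖ ≤ c m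
  norm_right : ∀ m, ∀ y ∈ Icc (-R : ℝ) R, ‖b m y‖ ≤ d m
  summable : Summable fun m => c m * d m
  hasSum : ∀ x ∈ Icc (-R : ℝ) R, ∀ y ∈ Icc (-R : ℝ) R, HasSum (fun m => a m x * b m y) (F x y)

namespace IsNuclearSeries

variable {R : ℕ} {F : ℝ → ℝ → ℂ} {ι : Type*} {a b : ι → ℝ → ℂ} {c d : ι → ℝ}
  (hF : IsNuclearSeries R F a b c d)
include hF

lemma swap : IsNuclearSeries R (fun y x => F x y) b a d c where
  continuous_left := hF.continuous_right
  continuous_right := hF.continuous_left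
  norm_left := hF.norm_right
  norm_right := hF.norm_left
  summable := by simpa only [mul_comm] using hF.summable
  hasSum y hy x hx := by simpa only [mul_comm] using hF.hasSum x hx y hy

lemma nonneg_left (m : ι) : 0 ≤ c m := (norm_nonneg _).trans (hF.norm_left m 0 (by simp))

lemma nonneg_right (m : ι) : 0 ≤ d m := (norm_nonneg _).trans (hF.norm_right m 0 (by simp))

lemma norm_le {x y : ℝ} (hx : x ∈ Icc (-R : ℝ) R) (hy : y ∈ Icc (-R : ℝ) R) :
    ‖F x y‖ ≤ ∑' m, c m * d m := by
  have h : ∀ m, ‖a m x * b m y‖ ≤ c m * d m := fun m => by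
    rw [norm_mul]
    exact mul_le_mul (hF.norm_left m x hx) (hF.norm_right m y hy) (norm_nonneg _) (hF.nonneg_left m)
  rw [← (hF.hasSum x hx y hy).tsum_eq]
  exact tsum_of_norm_bounded hF.summable.hasSum h

variable {E₁ E₂ : Set ℝ → H →L[ℂ] H} {A B : H →L[ℂ] H}

lemma hasSum_doubleStepOp (N : ℕ) (S : H →L[ℂ] H) :
    HasSum (fun m => stepOp E₁ R N (a m) * S * stepOp E₂ R N (b m))
      (doubleStepOp E₁ E₂ R N S F) := by
  simp_rw [← doubleStepOp_mul]
  refine hasSum_sum fun i hi => hasSum_sum fun j hj => ?_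
  exact (hF.hasSum _ (node_mem hi) _ (node_mem hj)).smul_const _

lemma summable_norm (hE₁ : IsSpectralOn E₁ A R) (hE₂ : IsSpectralOn E₂ B R) :
    Summable fun m => ‖fnOf E₁ R (a m)‖ * ‖fnOf E₂ R (b m)‖ := by
  refine hF.summable.of_nonneg_of_le (fun _ => by positivity) fun m => ?_
  exact mul_le_mul (hE₁.norm_fnOf_le (hF.continuous_left m) (hF.norm_left m))
    (hE₂.norm_fnOf_le (hF.continuous_right m) (hF.norm_right m)) (norm_nonneg _) (hF.nonneg_left m)

lemma summable_fnOf (hE₁ : IsSpectralOn E₁ A R) (hE₂ : IsSpectralOn E₂ B R) (S : H →L[ℂ] H) :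
    Summable fun m => fnOf E₁ R (a m) * S * fnOf E₂ R (b m) := by
  refine Summable.of_norm (((hF.summable_norm hE₁ hE₂).mul_left ‖S‖).of_nonneg_of_le
    (fun _ => norm_nonneg _) fun m => ?_)
  calc _ ≤ ‖fnOf E₁ R (a m)‖ * ‖S‖ * ‖fnOf E₂ R (b m)‖ :=
        (norm_mul_le _ _).trans (mul_le_mul_of_nonneg_right (norm_mul_le _ _) (norm_nonneg _))
    _ = _ := by ring

/-- Dominated convergence for series. The left side does not mention the expansion, so the limit is
independent of it and linear in the integrand. -/
lemma tendsto_doubleStepOp (hE₁ : IsSpectralOn E₁ A R) (hE₂ : IsSpectralOn E₂ B R)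
    (S : H →L[ℂ] H) :
    Tendsto (fun N => doubleStepOp E₁ E₂ R N S F) atTop
      (𝓝 (∑' m, fnOf E₁ R (a m) * S * fnOf E₂ R (b m))) := by
  have h1 : ∀ N, doubleStepOp E₁ E₂ R N S F =
      ∑' m, stepOp E₁ R N (a m) * S * stepOp E₂ R N (b m) := fun N =>
    (hF.hasSum_doubleStepOp N S).tsum_eq.symm
  simp_rw [h1]
  refine tendsto_tsum_of_dominated_convergence (hF.summable.mul_left ‖S‖) (fun m => ?_)
    (Eventually.of_forall fun N m => ?_)
  · exact ((hE₁.tendsto_fnOf (hF.continuous_left m)).mul_const S).mul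
      (hE₂.tendsto_fnOf (hF.continuous_right m))
  · calc _ ≤ ‖stepOp E₁ R N (a m)‖ * ‖S‖ * ‖stepOp E₂ R N (b m)‖ :=
          (norm_mul_le _ _).trans (mul_le_mul_of_nonneg_right (norm_mul_le _ _) (norm_nonneg _))
      _ ≤ c m * ‖S‖ * d m := by
          gcongr
          · exact mul_nonneg (hF.nonneg_left m) (norm_nonneg S)
          · exact hE₁.norm_stepOp_le N (hF.nonneg_left m) (hF.norm_left m)
          · exact hE₂.norm_stepOp_le N (hF.nonneg_right m) (hF.norm_right m)
      _ = _ := by ring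

end IsNuclearSeries

end DoubleSteps

end NoncommFun

namespace NoncommFun

/-! ### Nuclear series are Schur multipliers, and `f(A,B)` is a limit of Riemann sums. -/

section DoubleIntegrals

open Filter Topology

variable {H : Type u} [NormedAddCommGroup H] [InnerProductSpace ℂ H] [CompleteSpace H]

lemma floor_mem_gridIndex {R N : ℕ} {x : ℝ} (hx : x ∈ Icc (-R : ℝ) R) :
    ⌊((N : ℝ) + 1) * x⌋ ∈ gridIndex R N := by
  obtain ⟨i, hi, h⟩ := mem_iUnion₂.1 (Icc_subset_biUnion_cell R N hx)
  exact (show ⌊_⌋ = i from h) ▸ hi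

lemma tendsto_node_floor (x : ℝ) :
    Tendsto (fun N : ℕ => node N ⌊((N : ℝ) + 1) * x⌋) atTop (𝓝 x) := by
  have h1 : Tendsto (fun N : ℕ => x - 1 / ((N : ℝ) + 1)) atTop (𝓝 (x - 0)) :=
    tendsto_const_nhds.sub tendsto_one_div_add_atTop_nhds_zero_nat
  rw [sub_zero] at h1
  refine tendsto_of_tendsto_of_tendsto_of_le_of_le h1 tendsto_const_nhds (fun N => ?_) fun N => ?_
  · linarith [(mem_cell_bounds (N := N) (x := x) rfl).2]
  · exact (mem_cell_bounds (N := N) (x := x) rfl).1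

lemma hasSum_tsum_prod_swap {ι κ : Type*} {G : ι → κ → ℂ}
    (h1 : Summable fun q : ι × κ => G q.1 q.2) {g : κ → ℂ} (h2 : ∀ i, HasSum (fun m => G m i) (g i)) :
    HasSum g (∑' q : ι × κ, G q.1 q.2) := by
  have h3 : HasSum (fun q : κ × ι => G q.2 q.1) (∑' q : ι × κ, G q.1 q.2) :=
    ((Equiv.prodComm κ ι).hasSum_iff (f := fun q : ι × κ => G q.1 q.2)).2 h1.hasSum
  exact h3.prod_fiberwise h2

/-- The step function with the values of `F` at the nodes. -/
noncomputable def stepFun (R N : ℕ) (F : ℝ → ℝ → ℂ) : ℝ × ℝ → ℂ :=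
  fun z => ∑ i ∈ gridIndex R N, ∑ j ∈ gridIndex R N,
    (cell N i ×ˢ cell N j).indicator (fun _ => F (node N i) (node N j)) z

lemma stepFun_apply {R N : ℕ} (F : ℝ → ℝ → ℂ) {z : ℝ × ℝ} (h1 : z.1 ∈ Icc (-R : ℝ) R)
    (h2 : z.2 ∈ Icc (-R : ℝ) R) :
    stepFun R N F z = F (node N ⌊((N : ℝ) + 1) * z.1⌋) (node N ⌊((N : ℝ) + 1) * z.2⌋) := by
  rw [stepFun, Finset.sum_eq_single_of_mem _ (floor_mem_gridIndex h1) fun i _ hi => ?_,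
    Finset.sum_eq_single_of_mem _ (floor_mem_gridIndex h2) fun i _ hi => ?_]
  · exact indicator_of_mem (show z ∈ cell N _ ×ˢ cell N _ from ⟨rfl, rfl⟩) _
  · exact indicator_of_notMem (fun h => hi (show ⌊_⌋ = i from h.2).symm) _
  · exact Finset.sum_eq_zero fun j _ =>
      indicator_of_notMem (fun h => hi (show ⌊_⌋ = i from h.1).symm) _

lemma measurable_stepFun (R N : ℕ) (F : ℝ → ℝ → ℂ) : Measurable (stepFun R N F) :=
  Finset.measurable_sum _ fun i _ => Finset.measurable_sum _ fun j _ =>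
    measurable_const.indicator ((measurableSet_cell N i).prod (measurableSet_cell N j))

omit [CompleteSpace H] in
lemma inner_doubleStepOp {E₁ E₂ : Set ℝ → H →L[ℂ] H} {S : H →L[ℂ] H} {h k : H}
    {ν : ComplexMeasure (ℝ × ℝ)} [IsFiniteMeasure ν.variation]
    (hν : ∀ Λ Δ, MeasurableSet Λ → MeasurableSet Δ → ν (Λ ×ˢ Δ) = ⟪k, E₁ Λ (S (E₂ Δ h))⟫_ℂ)
    (R N : ℕ) (F : ℝ → ℝ → ℂ) :
    VectorMeasure.integral ν (stepFun R N F) (ContinuousLinearMap.mul ℝ ℂ) =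
      ⟪k, doubleStepOp E₁ E₂ R N S F h⟫_ℂ := by
  have hm : ∀ i j, MeasurableSet (cell N i ×ˢ cell N j) := fun i j =>
    (measurableSet_cell N i).prod (measurableSet_cell N j)
  have hi : ∀ i j, ν.Integrable
      ((cell N i ×ˢ cell N j).indicator fun _ => F (node N i) (node N j)) := fun i j =>
    (integrable_const _).indicator (hm i j)
  have e : stepFun R N F = fun z => ∑ q ∈ gridIndex R N ×ˢ gridIndex R N,
      (cell N q.1 ×ˢ cell N q.2).indicator (fun _ => F (node N q.1) (node N q.2)) z := by
    funext z
    rw [stepFun, Finset.sum_product]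
  have e2 : doubleStepOp E₁ E₂ R N S F = ∑ q ∈ gridIndex R N ×ˢ gridIndex R N,
      F (node N q.1) (node N q.2) • (E₁ (cell N q.1) * S * E₂ (cell N q.2)) := by
    rw [doubleStepOp, Finset.sum_product]
  have e3 : ⟪k, doubleStepOp E₁ E₂ R N S F h⟫_ℂ = ∑ q ∈ gridIndex R N ×ˢ gridIndex R N,
      F (node N q.1) (node N q.2) * ⟪k, E₁ (cell N q.1) (S (E₂ (cell N q.2) h))⟫_ℂ := by
    rw [e2, sum_apply, inner_sum]
    exact Finset.sum_congr rfl fun q _ => inner_smul_right _ _ _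
  have e4 : ∀ q : ℤ × ℤ, VectorMeasure.integral ν ((cell N q.1 ×ˢ cell N q.2).indicator
      fun _ => F (node N q.1) (node N q.2)) (ContinuousLinearMap.mul ℝ ℂ) =
      F (node N q.1) (node N q.2) * ⟪k, E₁ (cell N q.1) (S (E₂ (cell N q.2) h))⟫_ℂ := fun q => by
    rw [← hν _ _ (measurableSet_cell N _) (measurableSet_cell N _)]
    exact VectorMeasure.integral_indicator_const _ (hm _ _)
  have e5 := VectorMeasure.integral_finsetSum (μ := ν) (B := ContinuousLinearMap.mul ℝ ℂ)
    (gridIndex R N ×ˢ gridIndex R N) (f := fun q : ℤ × ℤ => (cell N q.1 ×ˢ cell N q.2).indicator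
      (fun _ => F (node N q.1) (node N q.2))) fun q _ => hi q.1 q.2
  rw [e3, ← Finset.sum_congr rfl fun q _ => e4 q]
  rw [e]
  exact e5

variable {E₁ E₂ : Set ℝ → H →L[ℂ] H} {A B : H →L[ℂ] H} {R : ℕ} {F : ℝ → ℝ → ℂ}

/-- The scalar integral and the operator series are limits of the same Riemann sums: the step
functions converge to the integrand boundedly on `[-R,R]²`, which carries the variation of `ν`. -/
lemma IsNuclearSeries.isDoubleIntegralHS {ι κ : Type*} {a b : ι → ℝ → ℂ} {c d : ι → ℝ}
    (hF : IsNuclearSeries R F a b c d) (hFc : Continuous fun z : ℝ × ℝ => F z.1 z.2)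
    (hE₁ : IsSpectralOn E₁ A R) (hE₂ : IsSpectralOn E₂ B R) {S : H →L[ℂ] H} {x y : κ → H}
    (hS : IsNuclearExpansion S x y) :
    IsDoubleIntegralHS E₁ E₂ (fun z => F z.1 z.2) S
      (∑' m, fnOf E₁ R (a m) * S * fnOf E₂ R (b m)) := by
  intro h k
  have hx : ∀ z : H, ‖((‖z‖⁻¹ : ℝ) : ℂ) • z‖ ≤ 1 := fun z => by
    rw [norm_smul, Complex.norm_real, norm_inv, norm_norm]
    exact inv_mul_le_one
  have hxx : ∀ z : H, ((‖z‖ : ℝ) : ℂ) • ((‖z‖⁻¹ : ℝ) : ℂ) • z = z := fun z => by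
    rcases eq_or_ne z 0 with rfl | hz
    · simp
    · rw [smul_smul, ← Complex.ofReal_mul, mul_inv_cancel₀ (norm_ne_zero_iff.2 hz)]; simp
  have hS' : ∀ h, HasSum (fun i => ((‖x i‖ * ‖y i‖ : ℝ) : ℂ) • ⟪((‖x i‖⁻¹ : ℝ) : ℂ) • x i, h⟫_ℂ •
      ((‖y i‖⁻¹ : ℝ) : ℂ) • y i) (S h) := by
    intro h
    have e : (fun i => ((‖x i‖ * ‖y i‖ : ℝ) : ℂ) • ⟪((‖x i‖⁻¹ : ℝ) : ℂ) • x i, h⟫_ℂ •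
        ((‖y i‖⁻¹ : ℝ) : ℂ) • y i) = fun i => ⟪x i, h⟫_ℂ • y i := by
      funext i
      conv_rhs => rw [← hxx (x i), ← hxx (y i), inner_smul_left, Complex.conj_ofReal]
      rw [Complex.ofReal_mul, smul_smul, smul_smul (_ * _) (‖y i‖ : ℂ)]
      congr 1
      ring
    rw [e]
    exact hS.hasSum h
  -- The expansion is normalised to vectors of norm at most 1 with weights `‖x i‖ * ‖y i‖`.
  obtain ⟨ν, hν, hfin, h1, h2⟩ := exists_complexMeasure_prod hE₁.proj hE₂.proj hS.summable
    (fun i => by positivity) (fun i => hx (x i)) (fun i => hx (y i)) hS' h k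
  have hK1 : ∀ᵐ z ∂ν.variation, z.1 ∈ Icc (-R : ℝ) R := by
    have := h1 _ measurableSet_Icc.compl (hE₁.proj.compl_eq_zero measurableSet_Icc hE₁.supp)
    rw [ae_iff]
    exact measure_mono_null (fun z hz => Set.mem_prod.2 ⟨hz, mem_univ _⟩) this
  have hK2 : ∀ᵐ z ∂ν.variation, z.2 ∈ Icc (-R : ℝ) R := by
    have := h2 _ measurableSet_Icc.compl (hE₂.proj.compl_eq_zero measurableSet_Icc hE₂.supp)
    rw [ae_iff]
    exact measure_mono_null (fun z hz => Set.mem_prod.2 ⟨mem_univ _, hz⟩) this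
  refine ⟨ν, hν, ?_, ?_⟩
  · refine Integrable.of_bound hFc.aestronglyMeasurable (∑' m, c m * d m) ?_
    filter_upwards [hK1, hK2] with z hz1 hz2 using hF.norm_le hz1 hz2
  · have hlim : Tendsto (fun N => ⟪k, doubleStepOp E₁ E₂ R N S F h⟫_ℂ) atTop
        (𝓝 ⟪k, (∑' m, fnOf E₁ R (a m) * S * fnOf E₂ R (b m)) h⟫_ℂ) :=
      ((innerSL ℂ k).continuous.tendsto _).comp
        (((ContinuousLinearMap.apply ℂ H h).continuous.tendsto _).comp
          (hF.tendsto_doubleStepOp hE₁ hE₂ S))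
    refine tendsto_nhds_unique hlim ?_
    simp_rw [← inner_doubleStepOp hν]
    refine VectorMeasure.tendsto_integral_filter_of_norm_le_const
      (Eventually.of_forall fun N => (measurable_stepFun R N F).aestronglyMeasurable)
      ⟨∑' m, c m * d m, Eventually.of_forall fun N => ?_⟩ ?_
    · filter_upwards [hK1, hK2] with z hz1 hz2
      rw [stepFun_apply F hz1 hz2]
      exact hF.norm_le (node_mem (floor_mem_gridIndex hz1)) (node_mem (floor_mem_gridIndex hz2))
    · filter_upwards [hK1, hK2] with z hz1 hz2
      simp_rw [stepFun_apply F hz1 hz2]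
      exact (hFc.tendsto z).comp
        ((tendsto_node_floor z.1).prodMk_nhds (tendsto_node_floor z.2))

omit [CompleteSpace H] in
-- Two complex measures that agree on the rectangles, a generating π-system, coincide.
lemma IsDoubleIntegralHS.unique {Φ : ℝ × ℝ → ℂ} {S K K' : H →L[ℂ] H}
    (h : IsDoubleIntegralHS E₁ E₂ Φ S K) (h' : IsDoubleIntegralHS E₁ E₂ Φ S K') : K = K' := by
  ext x
  refine ext_inner_left ℂ fun k => ?_
  obtain ⟨ν, h1, -, h2⟩ := h x k
  obtain ⟨ν', h1', -, h2'⟩ := h' x k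
  have : ν = ν' := by
    refine VectorMeasure.ext_of_generateFrom _ ?_ generateFrom_prod.symm isPiSystem_prod ?_
    · rintro _ ⟨s, hs, t, ht, rfl⟩
      rw [h1 s t hs ht, h1' s t hs ht]
    · rw [← univ_prod_univ, h1 _ _ .univ .univ, h1' _ _ .univ .univ]
  rw [h2, h2', this]

lemma IsNuclearSeries.isDoubleIntegral {ι : Type*} {a b : ι → ℝ → ℂ} {c d : ι → ℝ}
    (hF : IsNuclearSeries R F a b c d) (hFc : Continuous fun z : ℝ × ℝ => F z.1 z.2)
    (hE₁ : IsSpectralOn E₁ A R) (hE₂ : IsSpectralOn E₂ B R) :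
    IsDoubleIntegral E₁ E₂ (fun z => F z.1 z.2) 1
      (∑' m, fnOf E₁ R (a m) * 1 * fnOf E₂ R (b m)) := by
  have hK : ∀ S : H →L[ℂ] H, HasSum (fun m => fnOf E₂ R (b m) * S * fnOf E₁ R (a m))
      (∑' m, fnOf E₂ R (b m) * S * fnOf E₁ R (a m)) := fun S =>
    (hF.swap.summable_fnOf hE₂ hE₁ S).hasSum
  have hHS : ∀ {κ : Type} {S : H →L[ℂ] H} {x y : κ → H}, IsNuclearExpansion S x y →
      IsDoubleIntegralHS E₂ E₁ (fun z => F z.swap.1 z.swap.2) S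
        (∑' m, fnOf E₂ R (b m) * S * fnOf E₁ R (a m)) := fun hS =>
    hF.swap.isDoubleIntegralHS (hFc.comp continuous_swap) hE₂ hE₁ hS
  refine ⟨fun S hS => ?_, fun S K hS hSK => ?_⟩
  · obtain ⟨κ, x, y, hxy⟩ := exists_isNuclearExpansion hS
    exact ⟨_, (hxy.hasSum_mul_mul (hF.summable_norm hE₁ hE₂) (hK S)).memSchatten, hHS hxy⟩
  · obtain ⟨κ, x, y, hxy⟩ := exists_isNuclearExpansion hS
    rw [hSK.unique (hHS hxy), one_mul]
    set W := ∑' m, fnOf E₁ R (a m) * 1 * fnOf E₂ R (b m) with hW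
    have hW' : HasSum (fun m => fnOf E₁ R (a m) * 1 * fnOf E₂ R (b m)) W :=
      (hF.summable_fnOf hE₁ hE₂ 1).hasSum
    have hK' := hxy.hasSum_mul_mul (hF.summable_norm hE₁ hE₂) (hK S)
    have hWS := hxy.mul_mul 1 W
    rw [mul_one] at hWS
    refine ⟨_, hWS.hasTrace, ?_⟩
    convert! hK'.hasTrace using 1
    simp only [star_one, one_apply_eq_self]
    -- Both traces are sums of the same absolutely summable array: `trace (W S) = ∑_i ⟨x_i, W y_i⟩`,
    -- and moving `a_m(A)` to the left entry gives the expansion of `K`.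
    set G : ι → κ → ℂ := fun m i =>
      ⟪star (fnOf E₁ R (a m)) (x i), fnOf E₂ R (b m) (y i)⟫_ℂ with hG
    have h1 : Summable fun q : ι × κ => G q.1 q.2 :=
      Summable.of_norm (hK'.summable.of_nonneg_of_le (fun _ => norm_nonneg _)
        fun q => norm_inner_le_norm _ _)
    have h3 : ∀ i, HasSum (fun m => G m i) ⟪x i, W (y i)⟫_ℂ := fun i => by
      have h4 := (hW'.mapL (ContinuousLinearMap.apply ℂ H (y i))).mapL (innerSL ℂ (x i))
      simp only [mul_one] at h4
      simp only [hG, ContinuousLinearMap.star_eq_adjoint, ContinuousLinearMap.adjoint_inner_left]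
      exact h4
    exact (hasSum_tsum_prod_swap h1 h3).tsum_eq

/-- Testing on rank one operators recovers the matrix entries. It identifies the operator chosen in
`functionOfPair`. -/
lemma IsDoubleIntegral.unique {Φ : ℝ × ℝ → ℂ} {T W W' : H →L[ℂ] H}
    (h : IsDoubleIntegral E₁ E₂ Φ T W) (h' : IsDoubleIntegral E₁ E₂ Φ T W') : W = W' := by
  ext y
  refine ext_inner_left ℂ fun x => ?_
  have hS := isNuclearExpansion_smulRight x y
  obtain ⟨K, -, hK⟩ := h.1 _ hS.memSchatten
  obtain ⟨t, h1, h2⟩ := h.2 _ K hS.memSchatten hK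
  obtain ⟨t', h1', h2'⟩ := h'.2 _ K hS.memSchatten hK
  have key : ∀ V : H →L[ℂ] H, HasTrace (V * (innerSL ℂ x).smulRight y) ⟪x, V y⟫_ℂ := fun V => by
    simpa using (hS.mul_mul 1 V).hasTrace
  rw [(key W).unique h1, (key W').unique h1', h2.unique h2']

/-- The operator `f(A,B)` is the limit of Riemann sums if `f` is the sum of an absolutely
convergent series of products. -/
lemma IsNuclearSeries.functionOfPair_spec {f : Plane → ℂ} (hf : Continuous f) {ι : Type*}
    {a b : ι → ℝ → ℂ} {c d : ι → ℝ} (hF : IsNuclearSeries R (fun x y => f !₂[x, y]) a b c d)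
    (hA : IsSelfAdjoint A) (hB : IsSelfAdjoint B) (hRA : ‖A‖ ≤ R) (hRB : ‖B‖ ≤ R) :
    IsFunctionOfPair f A B (functionOfPair f A B) ∧
      Tendsto (fun N => doubleStepOp (spectralMeasure A) (spectralMeasure B) R N 1
        fun x y => f !₂[x, y]) atTop (𝓝 (functionOfPair f A B)) := by
  have hEA := spectralMeasure_isSpectralOn hA hRA
  have hEB := spectralMeasure_isSpectralOn hB hRB
  have hc : Continuous fun z : ℝ × ℝ => f !₂[z.1, z.2] := by
    refine hf.comp ((PiLp.continuous_toLp 2 _).comp ?_)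
    refine continuous_pi fun i => ?_
    fin_cases i
    · exact continuous_fst
    · exact continuous_snd
  have h1 : IsFunctionOfPair f A B _ := hF.isDoubleIntegral hc hEA hEB
  have h2 : ∃ W, IsFunctionOfPair f A B W := ⟨_, h1⟩
  have h3 : functionOfPair f A B = h2.choose := dif_pos h2
  have h4 : functionOfPair f A B = _ := h3.trans (h2.choose_spec.unique h1)
  rw [h4]
  exact ⟨h1, hF.tendsto_doubleStepOp hEA hEB 1⟩

end DoubleIntegrals

end NoncommFun

namespace NoncommFun

/-! ### Riemann sums of triple operator integrals and the perturbation formula. -/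

section TripleSteps

open Filter Topology

variable {H : Type u} [NormedAddCommGroup H] [InnerProductSpace ℂ H] [CompleteSpace H]

/-- The Riemann sum of the triple operator integral `∭ φ(x,x',y) dE(x) S dE'(x') dQ(y)`. -/
noncomputable def tripleStepOp (E E' Q : Set ℝ → H →L[ℂ] H) (R N : ℕ) (S : H →L[ℂ] H)
    (φ : ℝ → ℝ → ℝ → ℂ) : H →L[ℂ] H :=
  ∑ i ∈ gridIndex R N, ∑ j ∈ gridIndex R N, ∑ k ∈ gridIndex R N,
    φ (node N i) (node N j) (node N k) • (E (cell N i) * S * E' (cell N j) * Q (cell N k))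

/-- A bound for the triple operator integrals of `φ`: in the Schatten norm in terms of an orthonormal
expansion of the middle operator, and (up to the factor `L`) in the operator norm. -/
def TripleBound (p : ℝ) (E E' Q : Set ℝ → H →L[ℂ] H) (R : ℕ) (L : ℝ) (φ : ℝ → ℝ → ℝ → ℂ)
    (D : ℝ) : Prop :=
  ∀ (N : ℕ) (S : H →L[ℂ] H), ‖tripleStepOp E E' Q R N S φ‖ ≤ D * (L * ‖S‖) ∧
    ∀ (ι : Type) (v : ι → H), Orthonormal ℂ v →
      (∀ h, HasSum (fun i => ⟪star S (v i), h⟫_ℂ • v i) (S h)) →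
      diagNorm p (tripleStepOp E E' Q R N S φ) ≤
        ENNReal.ofReal D * (∑' i, ‖star S (v i)‖ₑ ^ p) ^ (1 / p)

variable {E E' Q : Set ℝ → H →L[ℂ] H} {A A' B : H →L[ℂ] H} {R : ℕ} {p L : ℝ}

omit [CompleteSpace H] in
lemma tripleStepOp_congr (N : ℕ) (S : H →L[ℂ] H) {φ φ' : ℝ → ℝ → ℝ → ℂ}
    (h : ∀ x ∈ Icc (-R : ℝ) R, ∀ x' ∈ Icc (-R : ℝ) R, ∀ y ∈ Icc (-R : ℝ) R, φ x x' y = φ' x x' y) :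
    tripleStepOp E E' Q R N S φ = tripleStepOp E E' Q R N S φ' :=
  Finset.sum_congr rfl fun i hi => Finset.sum_congr rfl fun j hj => Finset.sum_congr rfl fun k hk => by
    rw [h _ (node_mem hi) _ (node_mem hj) _ (node_mem hk)]

omit [CompleteSpace H] in
lemma hasSum_tripleStepOp (N : ℕ) (S : H →L[ℂ] H) {ρ : Type*} {φ : ρ → ℝ → ℝ → ℝ → ℂ}
    {φ' : ℝ → ℝ → ℝ → ℂ} (h : ∀ x ∈ Icc (-R : ℝ) R, ∀ x' ∈ Icc (-R : ℝ) R, ∀ y ∈ Icc (-R : ℝ) R,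
      HasSum (fun r => φ r x x' y) (φ' x x' y)) :
    HasSum (fun r => tripleStepOp E E' Q R N S (φ r)) (tripleStepOp E E' Q R N S φ') :=
  hasSum_sum fun _ hi => hasSum_sum fun _ hj => hasSum_sum fun _ hk =>
    (h _ (node_mem hi) _ (node_mem hj) _ (node_mem hk)).smul_const _

omit [CompleteSpace H] in
lemma tripleStepOp_smul (N : ℕ) (S : H →L[ℂ] H) (c : ℂ) (φ : ℝ → ℝ → ℝ → ℂ) :
    tripleStepOp E E' Q R N S (fun x x' y => c * φ x x' y) = c • tripleStepOp E E' Q R N S φ := by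
  simp only [tripleStepOp, Finset.smul_sum, smul_smul]

omit [CompleteSpace H] in
lemma tripleStepOp_sum (N : ℕ) (S : H →L[ℂ] H) {ρ : Type*} (s : Finset ρ)
    (φ : ρ → ℝ → ℝ → ℝ → ℂ) : tripleStepOp E E' Q R N S (fun x x' y => ∑ r ∈ s, φ r x x' y) =
      ∑ r ∈ s, tripleStepOp E E' Q R N S (φ r) := by
  have h := hasSum_tripleStepOp (E := E) (E' := E') (Q := Q) (R := R) N S (ρ := s)
    (φ := fun r => φ r) (φ' := fun x x' y => ∑ r ∈ s, φ r x x' y) fun x _ x' _ y _ => by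
      rw [← Finset.sum_coe_sort]; exact hasSum_fintype _
  rw [h.unique (hasSum_fintype _), Finset.sum_coe_sort s fun r => tripleStepOp E E' Q R N S (φ r)]

omit [CompleteSpace H] in
lemma tripleStepOp_sub (N : ℕ) (S S' : H →L[ℂ] H) (φ : ℝ → ℝ → ℝ → ℂ) :
    tripleStepOp E E' Q R N (S - S') φ =
      tripleStepOp E E' Q R N S φ - tripleStepOp E E' Q R N S' φ := by
  simp only [tripleStepOp, mul_sub, sub_mul, smul_sub, Finset.sum_sub_distrib]

omit [CompleteSpace H] in
lemma tripleStepOp_mul (N : ℕ) (S : H →L[ℂ] H) (a b e : ℝ → ℂ) :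
    tripleStepOp E E' Q R N S (fun x x' y => a x * b x' * e y) =
      stepOp E R N a * S * stepOp E' R N b * stepOp Q R N e := by
  simp only [tripleStepOp, stepOp, Finset.sum_mul]
  refine Finset.sum_congr rfl fun i _ => ?_
  rw [Finset.sum_comm, Finset.mul_sum]
  refine Finset.sum_congr rfl fun k _ => ?_
  rw [Finset.mul_sum, Finset.sum_mul]
  refine Finset.sum_congr rfl fun j _ => ?_
  rw [smul_mul_assoc, smul_mul_smul_comm, smul_mul_smul_comm]

namespace TripleBound

lemma congr {φ φ' : ℝ → ℝ → ℝ → ℂ} {D : ℝ} (h : TripleBound p E E' Q R L φ D)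
    (hφ : ∀ x ∈ Icc (-R : ℝ) R, ∀ x' ∈ Icc (-R : ℝ) R, ∀ y ∈ Icc (-R : ℝ) R,
      φ x x' y = φ' x x' y) : TripleBound p E E' Q R L φ' D := fun N S => by
  rw [← tripleStepOp_congr N S hφ]
  exact h N S

lemma hasSum (hp : 1 ≤ p) {ρ : Type*} {φ : ρ → ℝ → ℝ → ℝ → ℂ}
    {φ' : ℝ → ℝ → ℝ → ℂ} {D : ρ → ℝ} (h : ∀ r, TripleBound p E E' Q R L (φ r) (D r))
    (hD0 : ∀ r, 0 ≤ D r) {D' : ℝ} (hD : HasSum D D')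
    (hφ : ∀ x ∈ Icc (-R : ℝ) R, ∀ x' ∈ Icc (-R : ℝ) R, ∀ y ∈ Icc (-R : ℝ) R,
      HasSum (fun r => φ r x x' y) (φ' x x' y)) : TripleBound p E E' Q R L φ' D' := by
  intro N S
  have h1 := hasSum_tripleStepOp (E := E) (E' := E') (Q := Q) N S hφ
  refine ⟨?_, fun ι v hv hS => ?_⟩
  · rw [← h1.tsum_eq]
    exact tsum_of_norm_bounded (hD.mul_right _) fun r => (h r N S).1
  · refine (diagNorm_tsum_le hp h1).trans ?_
    refine (ENNReal.tsum_le_tsum fun r => (h r N S).2 ι v hv hS).trans_eq ?_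
    rw [ENNReal.tsum_mul_right, ← ENNReal.ofReal_tsum_of_nonneg hD0 hD.summable, hD.tsum_eq]

lemma sum (hp : 1 ≤ p) {ρ : Type*} (s : Finset ρ) {φ : ρ → ℝ → ℝ → ℝ → ℂ}
    {D : ρ → ℝ} (h : ∀ r ∈ s, TripleBound p E E' Q R L (φ r) (D r)) (hD0 : ∀ r ∈ s, 0 ≤ D r) :
    TripleBound p E E' Q R L (fun x x' y => ∑ r ∈ s, φ r x x' y) (∑ r ∈ s, D r) := by
  refine hasSum hp (ρ := s) (φ := fun r => φ r) (D := fun r => D r) (fun r => h r r.2)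
    (fun r => hD0 r r.2) ?_ fun x _ x' _ y _ => ?_
  · rw [← Finset.sum_coe_sort]; exact hasSum_fintype _
  · rw [← Finset.sum_coe_sort]; exact hasSum_fintype _

lemma add (hp : 1 ≤ p) {φ φ' : ℝ → ℝ → ℝ → ℂ} {D D' : ℝ}
    (h : TripleBound p E E' Q R L φ D) (h' : TripleBound p E E' Q R L φ' D') (hD : 0 ≤ D)
    (hD' : 0 ≤ D') : TripleBound p E E' Q R L (fun x x' y => φ x x' y + φ' x x' y) (D + D') := by
  have := TripleBound.hasSum hp (φ := fun b : Bool => cond b φ φ') (D := fun b => cond b D D')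
    (φ' := fun x x' y => φ x x' y + φ' x x' y) (D' := D + D')
    (fun b => by cases b <;> assumption) (fun b => by cases b <;> assumption)
    (by simpa using hasSum_fintype fun b => cond b D D')
    fun x _ x' _ y _ => by simpa using hasSum_fintype fun b => (cond b φ φ') x x' y
  exact this

lemma const_mul (hp : 1 ≤ p) {φ : ℝ → ℝ → ℝ → ℂ} {D : ℝ} (h : TripleBound p E E' Q R L φ D)
    (c : ℂ) : TripleBound p E E' Q R L (fun x x' y => c * φ x x' y) (‖c‖ * D) := by
  intro N S
  rw [tripleStepOp_smul]
  refine ⟨?_, fun ι v hv hS => ?_⟩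
  · rw [norm_smul, mul_assoc]
    exact mul_le_mul_of_nonneg_left (h N S).1 (norm_nonneg c)
  · refine (diagNorm_smul_le hp c _).trans ?_
    rw [ENNReal.ofReal_mul (norm_nonneg c), mul_assoc, ofReal_norm]
    exact mul_le_mul_right ((h N S).2 ι v hv hS) _

end TripleBound

/-- Compressed between two cells, the difference of the step operators becomes the scalar `x_i -
x'_j`, which cancels the denominator of the divided difference. -/
lemma stepOp_mul_tripleStep_middle (hE : IsSpectralOn E A R) (hE' : IsSpectralOn E' A' R) (N : ℕ)
    {i j : ℤ} (hi : i ∈ gridIndex R N) (hj : j ∈ gridIndex R N) :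
    E (cell N i) * (stepOp E R N (fun x => (x : ℂ)) - stepOp E' R N (fun x => (x : ℂ))) *
      E' (cell N j) = ((node N i : ℂ) - node N j) • (E (cell N i) * E' (cell N j)) := by
  have h1 : E (cell N i) * stepOp E R N (fun x => (x : ℂ)) = (node N i : ℂ) • E (cell N i) := by
    rw [stepOp, Finset.mul_sum, Finset.sum_eq_single_of_mem i hi fun k _ hk => ?_]
    · rw [mul_smul_comm, hE.cell_mul_cell, if_pos rfl]
    · rw [mul_smul_comm, hE.cell_mul_cell, if_neg hk.symm, smul_zero]
  have h2 : stepOp E' R N (fun x => (x : ℂ)) * E' (cell N j) = (node N j : ℂ) • E' (cell N j) := by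
    rw [stepOp, Finset.sum_mul, Finset.sum_eq_single_of_mem j hj fun k _ hk => ?_]
    · rw [smul_mul_assoc, hE'.cell_mul_cell, if_pos rfl]
    · rw [smul_mul_assoc, hE'.cell_mul_cell, if_neg hk, smul_zero]
  rw [mul_sub, sub_mul, h1, mul_assoc, h2, smul_mul_assoc, mul_smul_comm, sub_smul]

/-- The difference of two Riemann sums, as a Riemann sum of a triple operator integral. -/
lemma doubleStepOp_sub_doubleStepOp (hE : IsSpectralOn E A R) (hE' : IsSpectralOn E' A' R) (N : ℕ)
    {g : ℝ → ℝ → ℂ} {φ : ℝ → ℝ → ℝ → ℂ}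
    (hφ : ∀ x x' y, φ x x' y * ((x : ℂ) - x') = g x y - g x' y) :
    doubleStepOp E Q R N 1 g - doubleStepOp E' Q R N 1 g = tripleStepOp E E' Q R N
      (stepOp E R N (fun x => (x : ℂ)) - stepOp E' R N (fun x => (x : ℂ))) φ := by
  -- The missing third spectral measure is inserted by a resolution of the identity: `E'` here, and
  -- `E` in `h2`.
  have h1 : doubleStepOp E Q R N 1 g = ∑ i ∈ gridIndex R N, ∑ j ∈ gridIndex R N,
      ∑ k ∈ gridIndex R N, g (node N i) (node N k) • (E (cell N i) * E' (cell N j) * Q (cell N k)) := by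
    rw [doubleStepOp]
    refine Finset.sum_congr rfl fun i _ => ?_
    rw [Finset.sum_comm]
    refine Finset.sum_congr rfl fun k _ => ?_
    rw [← Finset.smul_sum, ← Finset.sum_mul, ← Finset.mul_sum, hE'.sum_cell]
  have h2 : doubleStepOp E' Q R N 1 g = ∑ i ∈ gridIndex R N, ∑ j ∈ gridIndex R N,
      ∑ k ∈ gridIndex R N, g (node N j) (node N k) • (E (cell N i) * E' (cell N j) * Q (cell N k)) := by
    rw [doubleStepOp, Finset.sum_comm (s := gridIndex R N) (t := gridIndex R N)
      (f := fun i j => ∑ k ∈ gridIndex R N,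
        g (node N j) (node N k) • (E (cell N i) * E' (cell N j) * Q (cell N k)))]
    refine Finset.sum_congr rfl fun j _ => ?_
    rw [Finset.sum_comm]
    refine Finset.sum_congr rfl fun k _ => ?_
    rw [← Finset.smul_sum, ← Finset.sum_mul, ← Finset.sum_mul, hE.sum_cell, one_mul, mul_one]
  rw [h1, h2, tripleStepOp]
  simp_rw [← Finset.sum_sub_distrib, ← sub_smul, ← hφ]
  refine Finset.sum_congr rfl fun i hi => Finset.sum_congr rfl fun j hj =>
    Finset.sum_congr rfl fun k _ => ?_
  rw [stepOp_mul_tripleStep_middle hE hE' N hi hj, smul_mul_assoc, smul_smul]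

/-- At level `N` the perturbation formula has the step approximation of `A - A'` in the middle. The
crude operator norm bound, uniform in `N`, replaces it by `A - A'` in the limit, so the Schatten
bound is applied to `A - A'` alone. -/
lemma TripleBound.diagNorm_sub_le (hE : IsSpectralOn E A R) (hE' : IsSpectralOn E' A' R)
    {g : ℝ → ℝ → ℂ} {φ : ℝ → ℝ → ℝ → ℂ} {D : ℝ} (h : TripleBound p E E' Q R L φ D)
    (hφ : ∀ x x' y, φ x x' y * ((x : ℂ) - x') = g x y - g x' y) {W W' : H →L[ℂ] H}
    (hW : Tendsto (fun N => doubleStepOp E Q R N 1 g) atTop (𝓝 W))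
    (hW' : Tendsto (fun N => doubleStepOp E' Q R N 1 g) atTop (𝓝 W')) {ι : Type} {v : ι → H}
    (hv : Orthonormal ℂ v)
    (hS : ∀ h, HasSum (fun i => ⟪star (A - A') (v i), h⟫_ℂ • v i) ((A - A') h)) :
    diagNorm p (W - W') ≤ ENNReal.ofReal D * (∑' i, ‖star (A - A') (v i)‖ₑ ^ p) ^ (1 / p) := by
  set S : ℕ → H →L[ℂ] H := fun N =>
    stepOp E R N (fun x => (x : ℂ)) - stepOp E' R N (fun x => (x : ℂ)) with hSdef
  have hSlim : Tendsto (fun N => S N - (A - A')) atTop (𝓝 0) := by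
    have := (hE.tendsto_stepOp_id.sub hE'.tendsto_stepOp_id).sub_const (A - A')
    rwa [sub_self] at this
  have h0 : Tendsto (fun N => tripleStepOp E E' Q R N (S N - (A - A')) φ) atTop (𝓝 0) := by
    refine squeeze_zero_norm (fun N => (h N _).1) ?_
    simpa using (hSlim.norm.const_mul L).const_mul D
  have h1 : Tendsto (fun N => tripleStepOp E E' Q R N (A - A') φ) atTop (𝓝 (W - W')) := by
    have h2 := (hW.sub hW').sub h0
    rw [sub_zero] at h2
    refine h2.congr fun N => ?_
    rw [doubleStepOp_sub_doubleStepOp hE hE' N hφ, ← tripleStepOp_sub, hSdef, sub_sub_cancel]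
  exact diagNorm_le_of_tendsto h1 (Eventually.of_forall fun N => (h N _).2 ι v hv hS)

end TripleSteps

/-! ### Bilinear forms with scalar coefficient matrices. -/

section Blocks

variable {H : Type u} [NormedAddCommGroup H] [InnerProductSpace ℂ H]

/-- `|∑ h_{jk} ⟨w_k, z_j⟩| ≤ D ‖z‖ ‖w‖` (in an equivalent form that is additive in `h`). -/
def FormBound (H : Type u) [NormedAddCommGroup H] [InnerProductSpace ℂ H] (J : Finset ℤ)
    (h : ℤ → ℤ → ℝ) (D : ℝ) : Prop :=
  ∀ z w : ℤ → H, ‖∑ j ∈ J, ∑ k ∈ J, (h j k : ℂ) * ⟪z j, w k⟫_ℂ‖ ≤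
    D * ((∑ j ∈ J, ‖z j‖ ^ 2 + ∑ k ∈ J, ‖w k‖ ^ 2) / 2)

/-- Taking `z_j = D⁻¹ ∑_k h_{jk} w_k` and writing `s` for the left side, the form bound reads `2s ≤
s + D² ∑ ‖w_k‖²` after multiplication by `2D`. -/
lemma FormBound.sum_norm_sq_le {J : Finset ℤ} {h : ℤ → ℤ → ℝ} {D : ℝ} (hD : 0 < D)
    (hh : FormBound H J h D) (w : ℤ → H) :
    ∑ j ∈ J, ‖∑ k ∈ J, (h j k : ℂ) • w k‖ ^ 2 ≤ D ^ 2 * ∑ k ∈ J, ‖w k‖ ^ 2 := by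
  set y : ℤ → H := fun j => ∑ k ∈ J, (h j k : ℂ) • w k with hy
  set s := ∑ j ∈ J, ‖y j‖ ^ 2 with hs
  have h1 := hh (fun j => ((D⁻¹ : ℝ) : ℂ) • y j) w
  have h2 : ∑ j ∈ J, ∑ k ∈ J, (h j k : ℂ) * ⟪((D⁻¹ : ℝ) : ℂ) • y j, w k⟫_ℂ = ((D⁻¹ * s : ℝ) : ℂ) := by
    rw [hs]
    push_cast
    rw [Finset.mul_sum]
    refine Finset.sum_congr rfl fun j _ => ?_
    have : ⟪y j, y j⟫_ℂ = ∑ k ∈ J, (h j k : ℂ) * ⟪y j, w k⟫_ℂ := by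
      conv_lhs => rw [hy]
      simp only [inner_sum, inner_smul_right]
      rfl
    have h3 : ((‖y j‖ : ℂ)) ^ 2 = ∑ k ∈ J, (h j k : ℂ) * ⟪y j, w k⟫_ℂ := by
      rw [← this, inner_self_eq_norm_sq_to_K]; rfl
    rw [h3, Finset.mul_sum]
    refine Finset.sum_congr rfl fun k _ => ?_
    rw [inner_smul_left, ← Complex.ofReal_inv, Complex.conj_ofReal]
    ring
  have hs0 : 0 ≤ s := Finset.sum_nonneg fun _ _ => by positivity
  have h4 : ∑ j ∈ J, ‖((D⁻¹ : ℝ) : ℂ) • y j‖ ^ 2 = D⁻¹ ^ 2 * s := by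
    rw [hs, Finset.mul_sum]
    refine Finset.sum_congr rfl fun j _ => ?_
    rw [norm_smul, Complex.norm_real, Real.norm_of_nonneg (by positivity), mul_pow]
  rw [h2, h4, Complex.norm_real, Real.norm_of_nonneg (by positivity)] at h1
  have h5 : D * ((D⁻¹ ^ 2 * s + ∑ k ∈ J, ‖w k‖ ^ 2) / 2) * (2 * D) =
      s + D ^ 2 * ∑ k ∈ J, ‖w k‖ ^ 2 := by field_simp
  have h6 : D⁻¹ * s * (2 * D) = 2 * s := by field_simp
  have h7 := mul_le_mul_of_nonneg_right h1 (by positivity : (0 : ℝ) ≤ 2 * D)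
  rw [h5, h6] at h7
  linarith

end Blocks

end NoncommFun

namespace NoncommFun

/-! ### Triple operator integrals of block kernels. -/

section BlockKernels

open Filter Topology

variable {H : Type u} [NormedAddCommGroup H] [InnerProductSpace ℂ H] [CompleteSpace H]
variable {E E' Q : Set ℝ → H →L[ℂ] H} {A A' B : H →L[ℂ] H} {R : ℕ} {p M : ℝ}

/-- The restriction of `a` to the `j`-th cell of the grid of mesh `1 / M`. -/
noncomputable def cutCell (M : ℝ) (a : ℝ → ℂ) (j : ℤ) : ℝ → ℂ :=
  fun x => if ⌊M * x⌋ = j then a x else 0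

lemma sum_norm_cutCell_sq_le {a : ℝ → ℂ} {x : ℝ} (hx : ‖a x‖ ≤ 1) (J : Finset ℤ) :
    ∑ j : J, ‖cutCell M a j x‖ ^ 2 ≤ 1 := by
  have h1 : ∀ j, ‖cutCell M a j x‖ ^ 2 = if ⌊M * x⌋ = j then ‖a x‖ ^ 2 else 0 := fun j => by
    rw [cutCell]; split_ifs <;> simp
  rw [Finset.sum_coe_sort J fun j => ‖cutCell M a j x‖ ^ 2]
  simp_rw [h1]
  rw [Finset.sum_ite_eq]
  split_ifs
  · exact pow_le_one₀ (norm_nonneg _) hx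
  · exact zero_le_one

lemma norm_cutCell_le {a : ℝ → ℂ} {x : ℝ} (hx : ‖a x‖ ≤ 1) (j : ℤ) : ‖cutCell M a j x‖ ≤ 1 := by
  rw [cutCell]; split_ifs
  · exact hx
  · simp

lemma IsSpectralOn.sum_norm_cutCell_apply_le (hE : IsSpectralOn E A R) {a : ℝ → ℂ}
    (ha : ∀ x ∈ Icc (-R : ℝ) R, ‖a x‖ ≤ 1) (N : ℕ) (J : Finset ℤ) (h : H) :
    ∑ j : J, ‖stepOp E R N (cutCell M a j) h‖ ^ 2 ≤ ‖h‖ ^ 2 := by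
  simpa using hE.sum_norm_stepOp_sq_le N (fun j : J => cutCell M a j) (c := 1)
    (fun x hx => sum_norm_cutCell_sq_le (ha x hx) J) h

lemma IsSpectralOn.sum_norm_star_cutCell_apply_le (hE : IsSpectralOn E A R) {a : ℝ → ℂ}
    (ha : ∀ x ∈ Icc (-R : ℝ) R, ‖a x‖ ≤ 1) (N : ℕ) (J : Finset ℤ) (h : H) :
    ∑ j : J, ‖star (stepOp E R N (cutCell M a j)) h‖ ^ 2 ≤ ‖h‖ ^ 2 := by
  simp_rw [hE.star_stepOp]
  simpa using hE.sum_norm_stepOp_sq_le N (fun (j : J) x => starRingEnd ℂ (cutCell M a j x)) (c := 1)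
    (fun x hx => by simpa using sum_norm_cutCell_sq_le (ha x hx) J) h

lemma norm_star_stepOp_apply_le (hQ : IsSpectralOn Q B R) {e : ℝ → ℂ} {G : ℝ} (hG : 0 ≤ G)
    (he : ∀ y ∈ Icc (-R : ℝ) R, ‖e y‖ ≤ G) (N : ℕ) (u : H) :
    ‖star (stepOp Q R N e) u‖ ≤ G * ‖u‖ := by
  refine (ContinuousLinearMap.le_opNorm _ _).trans ?_
  rw [norm_star]
  gcongr
  exact hQ.norm_stepOp_le N hG he

/-- The operator integral is `∑_j α_j S X_j`, with `α_j` the part of `a(A)` on the `j`-th cell and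
`X_j = ∑_k κ_{jk} b_k(A') e_{jk}(B)`; the last hypothesis is the row bound for the `X_j`. The grid
of mesh `1/M` is fixed, independently of the Riemann grid indexed by `N`. -/
lemma tripleBound_block (hp : p ∈ Icc (1 : ℝ) 2) (hE : IsSpectralOn E A R)
    (hE' : IsSpectralOn E' A' R) (hQ : IsSpectralOn Q B R) {J : Finset ℤ}
    (hJ : ∀ x ∈ Icc (-R : ℝ) R, ⌊M * x⌋ ∈ J) {κ : ℤ → ℤ → ℝ} {D : ℝ} (hD : 0 < D)
    (hκ' : ∀ j k, |κ j k| ≤ D) {a b : ℝ → ℂ} (ha : ∀ x ∈ Icc (-R : ℝ) R, ‖a x‖ ≤ 1)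
    (hb : ∀ x ∈ Icc (-R : ℝ) R, ‖b x‖ ≤ 1) {e : ℤ → ℤ → ℝ → ℂ} {G : ℝ} (hG : 0 ≤ G)
    (he : ∀ j k, ∀ y ∈ Icc (-R : ℝ) R, ‖e j k y‖ ≤ G)
    (hX : ∀ N u, ∑ j ∈ J, ‖∑ k ∈ J, (κ j k : ℂ) • star (stepOp Q R N (e j k))
      (star (stepOp E' R N (cutCell M b k)) u)‖ ^ 2 ≤ (D * G) ^ 2 * ‖u‖ ^ 2) :
    TripleBound p E E' Q R ((J.card : ℝ) ^ 2)
      (fun x x' y => κ ⌊M * x⌋ ⌊M * x'⌋ * (a x * b x' * e ⌊M * x⌋ ⌊M * x'⌋ y)) (D * G) := by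
  intro N S
  set X : ℤ → H →L[ℂ] H := fun j =>
    ∑ k ∈ J, (κ j k : ℂ) • (stepOp E' R N (cutCell M b k) * stepOp Q R N (e j k)) with hXdef
  have key : tripleStepOp E E' Q R N S
      (fun x x' y => κ ⌊M * x⌋ ⌊M * x'⌋ * (a x * b x' * e ⌊M * x⌋ ⌊M * x'⌋ y)) =
      ∑ j ∈ J, stepOp E R N (cutCell M a j) * S * X j := by
    rw [tripleStepOp_congr N S (φ' := fun x x' y => ∑ j ∈ J, ∑ k ∈ J,
      (κ j k : ℂ) * (cutCell M a j x * cutCell M b k x' * e j k y)) fun x hx x' hx' y _ => ?_]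
    · rw [tripleStepOp_sum N S J (fun j x x' y => ∑ k ∈ J,
        (κ j k : ℂ) * (cutCell M a j x * cutCell M b k x' * e j k y))]
      refine Finset.sum_congr rfl fun j _ => ?_
      rw [tripleStepOp_sum N S J (fun k x x' y =>
        (κ j k : ℂ) * (cutCell M a j x * cutCell M b k x' * e j k y)), hXdef, Finset.mul_sum]
      refine Finset.sum_congr rfl fun k _ => ?_
      rw [tripleStepOp_smul, tripleStepOp_mul, mul_smul_comm, mul_assoc]
    -- Each point lies in exactly one cell, so one pair `(j,k)` survives.
    · rw [Finset.sum_eq_single_of_mem _ (hJ x hx) fun j _ hj => ?_,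
        Finset.sum_eq_single_of_mem _ (hJ x' hx') fun k _ hk => ?_]
      · simp [cutCell]
      · simp [cutCell, hk.symm]
      · exact Finset.sum_eq_zero fun k _ => by simp [cutCell, hj.symm]
  have hXstar : ∀ j u, star (X j) u = ∑ k ∈ J, (κ j k : ℂ) • star (stepOp Q R N (e j k))
      (star (stepOp E' R N (cutCell M b k)) u) := by
    intro j u
    simp only [hXdef, star_sum, star_smul, star_mul, sum_apply]
    refine Finset.sum_congr rfl fun k _ => ?_
    simp
  rw [key]
  refine ⟨?_, fun ι v hv hS => ?_⟩
  -- The crude bound counts the at most `|J|²` terms; it only has to be independent of `N`.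
  · have hXn : ∀ j, ‖X j‖ ≤ J.card * (D * G) := by
      intro j
      rw [hXdef, ← nsmul_eq_mul]
      refine (norm_sum_le _ _).trans (Finset.sum_le_card_nsmul _ _ _ fun k _ => ?_)
      rw [norm_smul, Complex.norm_real, Real.norm_eq_abs]
      gcongr
      · exact hκ' j k
      · refine (norm_mul_le _ _).trans ?_
        have h1 := hE'.norm_stepOp_le N zero_le_one fun x hx => norm_cutCell_le (M := M) (hb x hx) k
        have h2 := hQ.norm_stepOp_le N hG (he j k)
        calc _ ≤ 1 * G := by gcongr
          _ = G := one_mul G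
    calc ‖∑ j ∈ J, stepOp E R N (cutCell M a j) * S * X j‖
        ≤ J.card • (1 * ‖S‖ * (J.card * (D * G))) := by
          refine (norm_sum_le _ _).trans (Finset.sum_le_card_nsmul _ _ _ fun j _ => ?_)
          refine (norm_mul_le _ _).trans ?_
          gcongr
          · refine (norm_mul_le _ _).trans ?_
            gcongr
            exact hE.norm_stepOp_le N zero_le_one fun x hx => norm_cutCell_le (M := M) (ha x hx) j
          · exact hXn j
      _ = _ := by rw [nsmul_eq_mul]; ring
  · rw [← Finset.sum_coe_sort J fun j => stepOp E R N (cutCell M a j) * S * X j]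
    refine diagNorm_sum_mul_mul_le hp (fun j : J => stepOp E R N (cutCell M a j))
      (fun j : J => X j) S hv hS (by positivity) (hE.sum_norm_cutCell_apply_le ha N J)
      (hE.sum_norm_star_cutCell_apply_le ha N J) fun u => ?_
    rw [Finset.sum_coe_sort J fun j => ‖star (X j) u‖ ^ 2]
    simp_rw [hXstar]
    exact hX N u

/-- Since `e` depends only on `j`, the factor `e_j(B)*` comes out of the sum over `k`, and the form
bound acts on the column `b_k(A')* u`. -/
lemma tripleBound_block_left (hp : p ∈ Icc (1 : ℝ) 2) (hE : IsSpectralOn E A R)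
    (hE' : IsSpectralOn E' A' R) (hQ : IsSpectralOn Q B R) {J : Finset ℤ}
    (hJ : ∀ x ∈ Icc (-R : ℝ) R, ⌊M * x⌋ ∈ J) {κ : ℤ → ℤ → ℝ} {D : ℝ} (hD : 0 < D)
    (hκ : FormBound H J κ D) (hκ' : ∀ j k, |κ j k| ≤ D) {a b : ℝ → ℂ}
    (ha : ∀ x ∈ Icc (-R : ℝ) R, ‖a x‖ ≤ 1) (hb : ∀ x ∈ Icc (-R : ℝ) R, ‖b x‖ ≤ 1)
    {e : ℤ → ℝ → ℂ} {G : ℝ} (hG : 0 ≤ G) (he : ∀ j, ∀ y ∈ Icc (-R : ℝ) R, ‖e j y‖ ≤ G) :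
    TripleBound p E E' Q R ((J.card : ℝ) ^ 2)
      (fun x x' y => κ ⌊M * x⌋ ⌊M * x'⌋ * (a x * b x' * e ⌊M * x⌋ y)) (D * G) := by
  refine tripleBound_block hp hE hE' hQ hJ hD hκ' ha hb (e := fun j _ => e j) hG
    (fun j _ => he j) fun N u => ?_
  have h1 := hκ.sum_norm_sq_le hD fun k => star (stepOp E' R N (cutCell M b k)) u
  have h2 := hE'.sum_norm_star_cutCell_apply_le (M := M) hb N J u
  rw [Finset.sum_coe_sort J fun k => ‖star (stepOp E' R N (cutCell M b k)) u‖ ^ 2] at h2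
  calc _ ≤ ∑ j ∈ J, G ^ 2 * ‖∑ k ∈ J, (κ j k : ℂ) • star (stepOp E' R N (cutCell M b k)) u‖ ^ 2 := by
        refine Finset.sum_le_sum fun j _ => ?_
        simp_rw [← map_smul]
        rw [← map_sum, ← mul_pow]
        gcongr
        exact norm_star_stepOp_apply_le hQ hG (he j) N _
    _ ≤ G ^ 2 * (D ^ 2 * ‖u‖ ^ 2) := by
        rw [← Finset.mul_sum]
        gcongr
        exact h1.trans (by gcongr)
    _ = _ := by ring

/-- Since `e` depends only on `k`, the form bound acts first, on the vectors `e_k(B)* b_k(A')* u`;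
the norms of the `e_k(B)*` are estimated afterwards. -/
lemma tripleBound_block_right (hp : p ∈ Icc (1 : ℝ) 2) (hE : IsSpectralOn E A R)
    (hE' : IsSpectralOn E' A' R) (hQ : IsSpectralOn Q B R) {J : Finset ℤ}
    (hJ : ∀ x ∈ Icc (-R : ℝ) R, ⌊M * x⌋ ∈ J) {κ : ℤ → ℤ → ℝ} {D : ℝ} (hD : 0 < D)
    (hκ : FormBound H J κ D) (hκ' : ∀ j k, |κ j k| ≤ D) {a b : ℝ → ℂ}
    (ha : ∀ x ∈ Icc (-R : ℝ) R, ‖a x‖ ≤ 1) (hb : ∀ x ∈ Icc (-R : ℝ) R, ‖b x‖ ≤ 1)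
    {e : ℤ → ℝ → ℂ} {G : ℝ} (hG : 0 ≤ G) (he : ∀ j, ∀ y ∈ Icc (-R : ℝ) R, ‖e j y‖ ≤ G) :
    TripleBound p E E' Q R ((J.card : ℝ) ^ 2)
      (fun x x' y => κ ⌊M * x⌋ ⌊M * x'⌋ * (a x * b x' * e ⌊M * x'⌋ y)) (D * G) := by
  refine tripleBound_block hp hE hE' hQ hJ hD hκ' ha hb (e := fun _ k => e k) hG
    (fun _ k => he k) fun N u => ?_
  have h2 := hE'.sum_norm_star_cutCell_apply_le (M := M) hb N J u
  rw [Finset.sum_coe_sort J fun k => ‖star (stepOp E' R N (cutCell M b k)) u‖ ^ 2] at h2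
  calc _ ≤ D ^ 2 * ∑ k ∈ J, ‖star (stepOp Q R N (e k))
        (star (stepOp E' R N (cutCell M b k)) u)‖ ^ 2 := hκ.sum_norm_sq_le hD _
    _ ≤ D ^ 2 * ∑ k ∈ J, G ^ 2 * ‖star (stepOp E' R N (cutCell M b k)) u‖ ^ 2 := by
        gcongr with k
        rw [← mul_pow]
        gcongr
        exact norm_star_stepOp_apply_le hQ hG (he k) N _
    _ ≤ D ^ 2 * (G ^ 2 * ‖u‖ ^ 2) := by
        rw [← Finset.mul_sum]
        gcongr
    _ = _ := by ring

end BlockKernels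

/-! ### Bounded Toeplitz forms and Hilbert's inequality. -/

section ToeplitzForms

open Filter Topology

variable {H : Type u} [NormedAddCommGroup H] [InnerProductSpace ℂ H]

lemma FormBound.sub {J : Finset ℤ} {h h' : ℤ → ℤ → ℝ} {D D' : ℝ} (hh : FormBound H J h D)
    (hh' : FormBound H J h' D') : FormBound H J (fun j k => h j k - h' j k) (D + D') := by
  intro z w
  push_cast
  simp only [sub_mul, Finset.sum_sub_distrib]
  rw [add_mul]
  exact (norm_sub_le _ _).trans (add_le_add (hh z w) (hh' z w))

lemma FormBound.mono {J : Finset ℤ} {h : ℤ → ℤ → ℝ} {D D' : ℝ} (hh : FormBound H J h D)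
    (hD : D ≤ D') : FormBound H J h D' := fun z w => (hh z w).trans (by gcongr)

lemma sum_toeplitz_le {κ : ℤ → ℝ} {D : ℝ} (hκ : ∀ s : Finset ℤ, ∑ d ∈ s, |κ d| ≤ D)
    (J : Finset ℤ) (j : ℤ) : ∑ k ∈ J, |κ (j - k)| ≤ D ∧ ∑ k ∈ J, |κ (k - j)| ≤ D := by
  constructor
  · have := hκ (J.map ⟨fun k => j - k, fun a b h => by simpa using h⟩)
    rwa [Finset.sum_map] at this
  · have := hκ (J.map ⟨fun k => k - j, fun a b h => by simpa using h⟩)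
    rwa [Finset.sum_map] at this

/-- A Toeplitz form with a summable symbol is bounded. -/
lemma formBound_of_summable {κ : ℤ → ℝ} {D : ℝ} (hκ : ∀ s : Finset ℤ, ∑ d ∈ s, |κ d| ≤ D)
    (J : Finset ℤ) : FormBound H J (fun j k => κ (j - k)) D := by
  intro z w
  calc _ ≤ ∑ j ∈ J, ∑ k ∈ J, |κ (j - k)| * ((‖z j‖ ^ 2 + ‖w k‖ ^ 2) / 2) := by
        refine norm_sum_le_of_le _ fun j _ => norm_sum_le_of_le _ fun k _ => ?_
        rw [norm_mul, Complex.norm_real, Real.norm_eq_abs]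
        gcongr
        refine (norm_inner_le_norm _ _).trans ?_
        nlinarith [sq_nonneg (‖z j‖ - ‖w k‖)]
    _ = (∑ j ∈ J, (∑ k ∈ J, |κ (j - k)|) * ‖z j‖ ^ 2 +
          ∑ k ∈ J, (∑ j ∈ J, |κ (j - k)|) * ‖w k‖ ^ 2) / 2 := by
        simp_rw [Finset.sum_mul]
        rw [Finset.sum_comm (s := J) (t := J) (f := fun k j => |κ (j - k)| * ‖w k‖ ^ 2),
          ← Finset.sum_add_distrib, Finset.sum_div]
        refine Finset.sum_congr rfl fun j _ => ?_
        rw [← Finset.sum_add_distrib, Finset.sum_div]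
        exact Finset.sum_congr rfl fun k _ => by ring
    _ ≤ (∑ j ∈ J, D * ‖z j‖ ^ 2 + ∑ k ∈ J, D * ‖w k‖ ^ 2) / 2 := by
        gcongr with j _ k _
        · exact (sum_toeplitz_le hκ J j).1
        · exact (sum_toeplitz_le hκ J k).2
    _ = _ := by rw [← Finset.mul_sum, ← Finset.mul_sum]; ring

lemma integral_exp_int_mul (d : ℤ) :
    ∫ θ in (0 : ℝ)..2 * Real.pi, Complex.exp (d * θ * Complex.I) =
      if d = 0 then 2 * (Real.pi : ℂ) else 0 := by
  split_ifs with h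
  · simp [h]
  · have h1 : (d * Complex.I : ℂ) ≠ 0 := by simp [h]
    have h2 := integral_exp_mul_complex (a := 0) (b := 2 * Real.pi) h1
    have h3 : ∀ θ : ℝ, Complex.exp (d * θ * Complex.I) = Complex.exp (d * Complex.I * θ) := fun θ => by
      ring_nf
    simp_rw [h3]
    rw [h2]
    have h4 : (d * Complex.I * ((2 * Real.pi : ℝ) : ℂ)) = d * (2 * Real.pi * Complex.I) := by
      push_cast; ring
    rw [h4, Complex.exp_int_mul_two_pi_mul_I]
    simp

/-- The Fourier coefficients of the sawtooth `π - θ`, from an explicit antiderivative. -/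
lemma integral_mul_exp_int_mul {d : ℤ} (h : d ≠ 0) :
    ∫ θ in (0 : ℝ)..2 * Real.pi, ((Real.pi - θ : ℝ) : ℂ) * Complex.exp (d * θ * Complex.I) =
      2 * Real.pi * Complex.I / d := by
  have h1 : (d * Complex.I : ℂ) ≠ 0 := by simp [h]
  have hd : (d : ℂ) ≠ 0 := by exact_mod_cast h
  set v : ℝ → ℂ := fun θ => Complex.exp (d * θ * Complex.I) / (d * Complex.I) with hv
  have hder : ∀ θ : ℝ, HasDerivAt (fun θ : ℝ => ((Real.pi - θ : ℝ) : ℂ) * v θ +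
      Complex.exp (d * θ * Complex.I) / (d * Complex.I) ^ 2)
      (((Real.pi - θ : ℝ) : ℂ) * Complex.exp (d * θ * Complex.I)) θ := by
    intro θ
    have e1 : HasDerivAt (fun θ : ℝ => Complex.exp (d * θ * Complex.I))
        (Complex.exp (d * θ * Complex.I) * (d * Complex.I)) θ := by
      have := ((((hasDerivAt_id (θ : ℂ)).const_mul (d : ℂ)).mul_const Complex.I).cexp).comp_ofReal
      simpa using this
    have e2 : HasDerivAt (fun θ : ℝ => ((Real.pi - θ : ℝ) : ℂ)) (-1) θ := by
      have := ((hasDerivAt_id θ).const_sub Real.pi).ofReal_comp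
      simpa using this
    have e3 := (e2.mul (e1.div_const (d * Complex.I))).add (e1.div_const ((d * Complex.I) ^ 2))
    refine e3.congr_deriv ?_
    field_simp
    ring
  rw [intervalIntegral.integral_eq_sub_of_hasDerivAt (fun θ _ => hder θ)
    (Continuous.intervalIntegrable (by fun_prop) _ _)]
  have h4 : ((d : ℂ) * ((2 * Real.pi : ℝ) : ℂ) * Complex.I) = d * (2 * Real.pi * Complex.I) := by
    push_cast; ring
  simp only [hv, h4, Complex.exp_int_mul_two_pi_mul_I]
  push_cast
  simp only [mul_zero, zero_mul, Complex.exp_zero]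
  field_simp
  linear_combination (-2 * (Real.pi : ℂ) * d * Complex.I) * Complex.I_sq

/-- Hilbert's inequality. -/
lemma formBound_hilbert (J : Finset ℤ) :
    FormBound H J (fun j k => 1 / ((j - k : ℤ) : ℝ)) Real.pi := by
  intro z w
  set e : ℤ → ℝ → ℂ := fun d θ => Complex.exp (d * θ * Complex.I) with he
  have hec : ∀ d, Continuous (e d) := fun d => by simp only [he]; fun_prop
  set P : (ℤ → H) → ℝ → H := fun z θ => ∑ j ∈ J, e j θ • z j with hP
  have hPc : ∀ z, Continuous (P z) := fun z =>
    continuous_finsetSum _ fun j _ => (hec j).smul continuous_const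
  have hmul : ∀ j k θ, starRingEnd ℂ (e j θ) * e k θ = e (k - j) θ := by
    intro j k θ
    simp only [he]
    rw [← Complex.exp_conj, ← Complex.exp_add]
    simp only [map_mul, Complex.conj_I, Complex.conj_ofReal, map_intCast]
    push_cast; ring_nf
  have hPP : ∀ z w θ, ⟪P z θ, P w θ⟫_ℂ = ∑ j ∈ J, ∑ k ∈ J, e (k - j) θ * ⟪z j, w k⟫_ℂ := by
    intro z w θ
    simp only [hP]
    rw [sum_inner]
    refine Finset.sum_congr rfl fun j _ => ?_
    rw [inner_sum]
    refine Finset.sum_congr rfl fun k _ => ?_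
    rw [inner_smul_left, inner_smul_right, ← hmul]; ring
  have hint : ∀ (ψ : ℝ → ℂ) (_ : Continuous ψ) (z w : ℤ → H),
      ∫ θ in (0 : ℝ)..2 * Real.pi, ψ θ * ⟪P z θ, P w θ⟫_ℂ =
        ∑ j ∈ J, ∑ k ∈ J, (∫ θ in (0 : ℝ)..2 * Real.pi, ψ θ * e (k - j) θ) * ⟪z j, w k⟫_ℂ := by
    intro ψ hψ z w
    have h1 : ∀ θ, ψ θ * ⟪P z θ, P w θ⟫_ℂ =
        ∑ j ∈ J, ∑ k ∈ J, (ψ θ * e (k - j) θ) * ⟪z j, w k⟫_ℂ := fun θ => by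
      rw [hPP, Finset.mul_sum]
      refine Finset.sum_congr rfl fun j _ => ?_
      rw [Finset.mul_sum]
      exact Finset.sum_congr rfl fun k _ => by ring
    have hc : ∀ j k, Continuous fun θ => (ψ θ * e (k - j) θ) * ⟪z j, w k⟫_ℂ := fun j k =>
      (hψ.mul (hec _)).mul continuous_const
    simp_rw [h1]
    rw [intervalIntegral.integral_finsetSum fun j _ =>
      (continuous_finsetSum J fun k _ => hc j k).intervalIntegrable _ _]
    refine Finset.sum_congr rfl fun j _ => ?_
    rw [intervalIntegral.integral_finsetSum fun k _ => (hc j k).intervalIntegrable _ _]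
    exact Finset.sum_congr rfl fun k _ => intervalIntegral.integral_mul_const _ _
  have hpars : ∀ z, ∫ θ in (0 : ℝ)..2 * Real.pi, ‖P z θ‖ ^ 2 =
      2 * Real.pi * ∑ j ∈ J, ‖z j‖ ^ 2 := by
    intro z
    have h1 : ((∫ θ in (0 : ℝ)..2 * Real.pi, ‖P z θ‖ ^ 2 : ℝ) : ℂ) =
        ((2 * Real.pi * ∑ j ∈ J, ‖z j‖ ^ 2 : ℝ) : ℂ) := by
      rw [← intervalIntegral.integral_ofReal]
      have : ∀ θ, ((‖P z θ‖ ^ 2 : ℝ) : ℂ) = 1 * ⟪P z θ, P z θ⟫_ℂ := fun θ => by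
        rw [inner_self_eq_norm_sq_to_K]; push_cast; simp
      simp_rw [this]
      rw [hint (fun _ => 1) continuous_const]
      push_cast
      rw [Finset.mul_sum]
      refine Finset.sum_congr rfl fun j hj => ?_
      simp only [one_mul, he, integral_exp_int_mul]
      rw [Finset.sum_eq_single_of_mem j hj fun k _ hk => by rw [if_neg (sub_ne_zero.2 hk), zero_mul],
        if_pos (sub_self j), inner_self_eq_norm_sq_to_K]
      rfl
    exact_mod_cast h1
  have hψ : Continuous fun θ : ℝ => ((Real.pi - θ : ℝ) : ℂ) := by fun_prop
  -- The Hilbert matrix consists of Fourier coefficients of `π - θ`; the bound `|π - θ| ≤ π` and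
  -- Parseval then give the constant `π`.
  have hmain : ∑ j ∈ J, ∑ k ∈ J, (((1 / ((j - k : ℤ) : ℝ) : ℝ)) : ℂ) * ⟪z j, w k⟫_ℂ =
      Complex.I / (2 * Real.pi) *
        ∫ θ in (0 : ℝ)..2 * Real.pi, ((Real.pi - θ : ℝ) : ℂ) * ⟪P z θ, P w θ⟫_ℂ := by
    rw [hint _ hψ, Finset.mul_sum]
    refine Finset.sum_congr rfl fun j _ => ?_
    rw [Finset.mul_sum]
    refine Finset.sum_congr rfl fun k _ => ?_
    rw [← mul_assoc]
    congr 1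
    have hpi : (Real.pi : ℂ) ≠ 0 := by exact_mod_cast Real.pi_ne_zero
    -- On the diagonal `1/0 = 0` agrees with the vanishing mean of `π - θ`.
    rcases eq_or_ne k j with rfl | hkj
    · have h0 : ∫ θ in (0 : ℝ)..2 * Real.pi, ((Real.pi - θ : ℝ) : ℂ) * e (k - k) θ = 0 := by
        simp only [he, sub_self, Int.cast_zero, zero_mul, Complex.exp_zero, mul_one]
        rw [intervalIntegral.integral_ofReal, intervalIntegral.integral_sub
          intervalIntegrable_const (continuous_id'.intervalIntegrable _ _), intervalIntegral.integral_const, integral_id]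
        simp only [smul_eq_mul]
        norm_cast
        ring
      rw [h0]; simp
    · have hd : ((k - j : ℤ) : ℂ) ≠ 0 := by exact_mod_cast sub_ne_zero.2 hkj
      have hd' : ((j - k : ℤ) : ℂ) ≠ 0 := by exact_mod_cast sub_ne_zero.2 hkj.symm
      simp only [he]
      rw [integral_mul_exp_int_mul (sub_ne_zero.2 hkj)]
      push_cast at hd hd' ⊢
      field_simp
      rw [Complex.I_sq]; ring
  rw [hmain, norm_mul]
  have h1 : ‖Complex.I / (2 * Real.pi : ℂ)‖ = 1 / (2 * Real.pi) := by
    rw [norm_div, Complex.norm_I, norm_mul, Complex.norm_real, Real.norm_of_nonneg Real.pi_pos.le]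
    norm_num
  have h2 : ‖∫ θ in (0 : ℝ)..2 * Real.pi, ((Real.pi - θ : ℝ) : ℂ) * ⟪P z θ, P w θ⟫_ℂ‖ ≤
      ∫ θ in (0 : ℝ)..2 * Real.pi, Real.pi * ((‖P z θ‖ ^ 2 + ‖P w θ‖ ^ 2) / 2) := by
    refine (intervalIntegral.norm_integral_le_integral_norm (by positivity)).trans ?_
    refine intervalIntegral.integral_mono_on (by positivity)
      ((hψ.mul ((hPc z).inner (hPc w))).norm.intervalIntegrable _ _)
      (Continuous.intervalIntegrable (continuous_const.mul
        ((((hPc z).norm.pow 2).add ((hPc w).norm.pow 2)).div_const 2)) _ _) fun θ hθ => ?_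
    rw [norm_mul, Complex.norm_real, Real.norm_eq_abs]
    have : |Real.pi - θ| ≤ Real.pi := abs_le.2 ⟨by linarith [hθ.2], by linarith [hθ.1]⟩
    gcongr
    refine (norm_inner_le_norm _ _).trans ?_
    nlinarith [sq_nonneg (‖P z θ‖ - ‖P w θ‖)]
  have hi : ∀ z, IntervalIntegrable (fun θ => ‖P z θ‖ ^ 2) volume 0 (2 * Real.pi) := fun z =>
    Continuous.intervalIntegrable ((hPc z).norm.pow 2) _ _
  have h3 : ∫ θ in (0 : ℝ)..2 * Real.pi, Real.pi * ((‖P z θ‖ ^ 2 + ‖P w θ‖ ^ 2) / 2) =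
      Real.pi * ((2 * Real.pi * ∑ j ∈ J, ‖z j‖ ^ 2 + 2 * Real.pi * ∑ k ∈ J, ‖w k‖ ^ 2) / 2) := by
    rw [intervalIntegral.integral_const_mul, intervalIntegral.integral_div,
      intervalIntegral.integral_add (hi z) (hi w), hpars, hpars]
  rw [h3] at h2
  rw [h1]
  refine (mul_le_mul_of_nonneg_left h2 (by positivity)).trans_eq ?_
  field_simp

end ToeplitzForms

end NoncommFun

namespace NoncommFun

/-! ### Near and far parts of the divided difference as block kernels. -/

section ExponentialType

open Filter Topology
open scoped Nat

variable {H : Type u} [NormedAddCommGroup H] [InnerProductSpace ℂ H]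

/-- A constant in the bounds for the truncated Hilbert matrices. -/
noncomputable def hilbertConst : ℝ := 13 + 5 * ∑' d : ℤ, 1 / (d : ℝ) ^ 2

/-- The powers of the Hilbert matrix, without a band around the diagonal. -/
noncomputable def farCoeff (n : ℕ) (j k : ℤ) : ℝ :=
  if 5 ≤ |j - k| then 1 / ((j - k : ℤ) : ℝ) ^ (n + 1) else 0

lemma summable_one_div_int_sq : Summable fun d : ℤ => 1 / (d : ℝ) ^ 2 :=
  Real.summable_one_div_int_pow.2 one_lt_two

lemma hilbertConst_ge : 13 ≤ hilbertConst := by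
  have : 0 ≤ ∑' d : ℤ, 1 / (d : ℝ) ^ 2 := tsum_nonneg fun d => by positivity
  rw [hilbertConst]; linarith

lemma abs_farCoeff_le (n : ℕ) (j k : ℤ) : |farCoeff n j k| ≤ hilbertConst * (1 / 5) ^ n := by
  have h1 : (0 : ℝ) ≤ (1 / 5) ^ n := by positivity
  rw [farCoeff]
  split_ifs with h
  · have h2 : (5 : ℝ) ≤ |((j - k : ℤ) : ℝ)| := by exact_mod_cast h
    rw [abs_div, abs_one, abs_pow, pow_succ]
    calc 1 / (|((j - k : ℤ) : ℝ)| ^ n * |((j - k : ℤ) : ℝ)|) ≤ 1 / (5 ^ n * 1) := by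
          gcongr; linarith
      _ = 1 * (1 / 5) ^ n := by rw [mul_one, one_mul, one_div_pow]
      _ ≤ _ := by gcongr; linarith [hilbertConst_ge]
  · rw [abs_zero]
    exact mul_nonneg (by linarith [hilbertConst_ge]) h1

lemma formBound_farCoeff (n : ℕ) (J : Finset ℤ) :
    FormBound H J (farCoeff n) (hilbertConst * (1 / 5) ^ n) := by
  set Z := ∑' d : ℤ, 1 / (d : ℝ) ^ 2 with hZ
  have hZ0 : 0 ≤ Z := tsum_nonneg fun d => by positivity
  -- For exponent zero the symbol is not summable: the nine diagonals with `|d| ≤ 4` are removed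
  -- from the Hilbert matrix, at the cost `π + 9 ≤ 13`. For higher exponents `|d|^{-(n+2)} ≤ 5^{-n}
  -- d^{-2}`, and the shift from `n` to `n + 1` explains the factor 5 in `hilbertConst`.
  rcases n with _ | n
  · have h1 : ∀ s : Finset ℤ, ∑ d ∈ s, |if 5 ≤ |d| then 0 else 1 / (d : ℝ)| ≤ 9 := by
      intro s
      calc _ ≤ ∑ d ∈ s, if d ∈ Finset.Icc (-4 : ℤ) 4 then (1 : ℝ) else 0 := by
            refine Finset.sum_le_sum fun d _ => ?_
            split_ifs with h2 h3 h3
            · simp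
            · simp
            · rcases eq_or_ne d 0 with rfl | hd
              · simp
              · have : (1 : ℝ) ≤ |(d : ℝ)| := by exact_mod_cast Int.one_le_abs hd
                rw [abs_div, abs_one]
                exact div_le_one_of_le₀ this (abs_nonneg _)
            · exact absurd (Finset.mem_Icc.2 (abs_le.1 (by omega : |d| ≤ 4))) h3
        _ ≤ ∑ d ∈ Finset.Icc (-4 : ℤ) 4, (1 : ℝ) := by
            rw [← Finset.sum_filter]
            refine Finset.sum_le_sum_of_subset_of_nonneg (fun d hd => (Finset.mem_filter.1 hd).2)
              fun _ _ _ => zero_le_one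
        _ = 9 := by simp
    have h2 := (formBound_hilbert (H := H) J).sub (formBound_of_summable (H := H) h1 J)
    have h3 : farCoeff 0 = fun j k : ℤ => 1 / ((j - k : ℤ) : ℝ) -
        if 5 ≤ |j - k| then 0 else 1 / ((j - k : ℤ) : ℝ) := by
      funext j k
      rw [farCoeff]; split_ifs <;> simp
    rw [h3]
    refine h2.mono ?_
    rw [pow_zero, mul_one, hilbertConst]
    linarith [Real.pi_le_four]
  · have h1 : ∀ s : Finset ℤ, ∑ d ∈ s, |if 5 ≤ |d| then 1 / (d : ℝ) ^ (n + 1 + 1) else 0| ≤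
        (1 / 5) ^ n * Z := by
      intro s
      refine le_trans ?_ (mul_le_mul_of_nonneg_left
        (summable_one_div_int_sq.sum_le_tsum s fun d _ => by positivity) (by positivity))
      rw [Finset.mul_sum]
      refine Finset.sum_le_sum fun d _ => ?_
      split_ifs with h
      · have h2 : (5 : ℝ) ≤ |(d : ℝ)| := by exact_mod_cast h
        rw [abs_div, abs_one, abs_pow, ← sq_abs, pow_add _ n 2, one_div_pow, one_div_mul_one_div]
        gcongr
      · rw [abs_zero]; positivity
    refine (formBound_of_summable (H := H) h1 J).mono ?_
    rw [hilbertConst, pow_succ]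
    have : (0 : ℝ) ≤ (1 / 5) ^ n := by positivity
    nlinarith

lemma formBound_diagonal (m : ℤ) (J : Finset ℤ) :
    FormBound H J (fun j k => if k - j = m then 1 else 0) 1 := by
  have h1 : ∀ s : Finset ℤ, ∑ d ∈ s, |if -d = m then (1 : ℝ) else 0| ≤ 1 := by
    intro s
    have : ∀ d : ℤ, |if -d = m then (1 : ℝ) else 0| = if d = -m then 1 else 0 := fun d => by
      by_cases h : d = -m
      · simp [h]
      · rw [if_neg h, if_neg (fun h' => h (by omega)), abs_zero]
    simp_rw [this]
    rw [Finset.sum_ite_eq']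
    split_ifs <;> simp
  have h2 := formBound_of_summable (H := H) h1 J
  simpa only [neg_sub] using h2

/-- `g(x + s/M, y) = ∑ s^c d_c(x,y) / c!` with `|d_c| ≤ G`: the function `g` is of exponential type
`M` in the first variable. -/
def IsExpType (M G : ℝ) (g : ℝ → ℝ → ℂ) : Prop :=
  ∃ d : ℕ → ℝ → ℝ → ℂ, (∀ c x y, ‖d c x y‖ ≤ G) ∧ (∀ c x, Continuous (d c x)) ∧
    ∀ x s y, HasSum (fun c => ((s ^ c / c ! : ℝ) : ℂ) * d c x y) (g (x + s / M) y)

/-- The terms of the divided difference near the diagonal. -/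
noncomputable def nearTerm (M : ℝ) (d : ℕ → ℝ → ℝ → ℂ) (c : ℕ) (x x' y : ℝ) : ℂ :=
  if |⌊M * x'⌋ - ⌊M * x⌋| ≤ 4 then
    (((∑ a ∈ Finset.range (c + 1), Int.fract (M * x) ^ a * (M * x' - ⌊M * x⌋) ^ (c - a)) /
      (c + 1)! : ℝ) : ℂ) * d (c + 1) (⌊M * x⌋ / M) y
  else 0

/-- The terms of the divided difference far from the diagonal. -/
noncomputable def farTerm (M : ℝ) (q : ℕ × ℕ) (s : ℝ → ℝ → ℝ) (x x' : ℝ) : ℝ :=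
  farCoeff q.1 ⌊M * x⌋ ⌊M * x'⌋ * (Int.fract (M * x') - Int.fract (M * x)) ^ q.1 *
    (s x x' ^ q.2 / q.2 !)

variable [CompleteSpace H]
variable {E E' Q : Set ℝ → H →L[ℂ] H} {A A' B : H →L[ℂ] H} {R : ℕ} {p M : ℝ}

lemma norm_fract_pow_le (x : ℝ) (n : ℕ) : ‖((Int.fract x ^ n : ℝ) : ℂ)‖ ≤ 1 := by
  rw [Complex.norm_real, Real.norm_of_nonneg (pow_nonneg (Int.fract_nonneg x) n)]
  exact pow_le_one₀ (Int.fract_nonneg x) (Int.fract_lt_one x).le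

/-- A near term is a combination of nine diagonals and `c + 1` monomials; the number `c + 1` turns
`(c + 1)!` into `c!`. -/
lemma tripleBound_nearTerm (hp : p ∈ Icc (1 : ℝ) 2) (hE : IsSpectralOn E A R)
    (hE' : IsSpectralOn E' A' R) (hQ : IsSpectralOn Q B R) {J : Finset ℤ}
    (hJ : ∀ x ∈ Icc (-R : ℝ) R, ⌊M * x⌋ ∈ J) {d : ℕ → ℝ → ℝ → ℂ} {G : ℝ}
    (hd : ∀ c x y, ‖d c x y‖ ≤ G) (c : ℕ) :
    TripleBound p E E' Q R ((J.card : ℝ) ^ 2) (nearTerm M d c) (9 * G * (5 ^ c / c !)) := by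
  have hG : 0 ≤ G := (norm_nonneg _).trans (hd 0 0 0)
  have key : ∀ m ∈ Finset.Icc (-4 : ℤ) 4, ∀ a ∈ Finset.range (c + 1),
      TripleBound p E E' Q R ((J.card : ℝ) ^ 2) (fun x x' y =>
        ((5 ^ c / (c + 1)! : ℝ) : ℂ) * (((if ⌊M * x'⌋ - ⌊M * x⌋ = m then (1 : ℝ) else 0 : ℝ) : ℂ) *
          (((Int.fract (M * x) ^ a : ℝ) : ℂ) *
            -- On the diagonal `m` one has `M x' - ⌊M x⌋ = fract (M x') + m`, of modulus at most 5;
            -- dividing by `5^c` makes the factor a contraction.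
            ((((Int.fract (M * x') + m) ^ (c - a) / 5 ^ c : ℝ)) : ℂ) * d (c + 1) (⌊M * x⌋ / M) y)))
        (‖((5 ^ c / (c + 1)! : ℝ) : ℂ)‖ * (1 * G)) := by
    intro m hm a ha
    rw [Finset.mem_Icc] at hm
    have hm1 : (-4 : ℝ) ≤ m := by exact_mod_cast hm.1
    have hm2 : (m : ℝ) ≤ 4 := by exact_mod_cast hm.2
    refine TripleBound.const_mul hp.1 ?_ _
    refine tripleBound_block_left hp hE hE' hQ hJ (κ := fun j k => if k - j = m then 1 else 0)
      zero_lt_one (formBound_diagonal m J) (fun j k => by split_ifs <;> simp)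
      (a := fun x => ((Int.fract (M * x) ^ a : ℝ) : ℂ))
      (b := fun x' => ((((Int.fract (M * x') + m) ^ (c - a) / 5 ^ c : ℝ)) : ℂ))
      (e := fun j y => d (c + 1) (j / M) y)
      (fun x _ => norm_fract_pow_le _ _) (fun x _ => ?_) hG fun j y _ => hd _ _ _
    rw [Complex.norm_real, norm_div, norm_pow, norm_pow, Real.norm_eq_abs, Real.norm_of_nonneg
      (by norm_num : (0 : ℝ) ≤ 5)]
    refine div_le_one_of_le₀ ?_ (by positivity)
    calc |Int.fract (M * x) + m| ^ (c - a) ≤ 5 ^ (c - a) := by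
          gcongr
          rw [abs_le]
          constructor <;> linarith [Int.fract_nonneg (M * x), Int.fract_lt_one (M * x)]
      _ ≤ 5 ^ c := pow_le_pow_right₀ (by norm_num) (Nat.sub_le c a)
  have h1 := TripleBound.sum hp.1 (Finset.Icc (-4 : ℤ) 4) (fun m hm =>
    TripleBound.sum hp.1 (Finset.range (c + 1)) (key m hm) fun _ _ => by positivity)
    fun _ _ => Finset.sum_nonneg fun _ _ => by positivity
  have h2 : ∑ m ∈ Finset.Icc (-4 : ℤ) 4, ∑ a ∈ Finset.range (c + 1),
      (‖((5 ^ c / (c + 1)! : ℝ) : ℂ)‖ * (1 * G)) = 9 * G * (5 ^ c / c !) := by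
    rw [Finset.sum_const, Finset.sum_const, Finset.card_range, Complex.norm_real,
      Real.norm_of_nonneg (by positivity), Nat.factorial_succ]
    have : (c ! : ℝ) ≠ 0 := by positivity
    simp only [Int.card_Icc, nsmul_eq_mul]
    push_cast
    field_simp
  rw [h2] at h1
  refine h1.congr fun x _ x' _ y _ => ?_
  rw [nearTerm]
  have h5 : (5 ^ c : ℂ) ≠ 0 := pow_ne_zero _ (by norm_num)
  split_ifs with h
  · rw [Finset.sum_eq_single_of_mem (⌊M * x'⌋ - ⌊M * x⌋) (Finset.mem_Icc.2 (abs_le.1 h))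
      fun m _ hm => Finset.sum_eq_zero fun a _ => by rw [if_neg hm.symm]; simp]
    have h3 : M * x' - ⌊M * x⌋ = Int.fract (M * x') + ((⌊M * x'⌋ - ⌊M * x⌋ : ℤ) : ℝ) := by
      push_cast
      linarith [Int.floor_add_fract (M * x')]
    rw [Finset.sum_div, h3]
    push_cast
    rw [Finset.sum_mul]
    refine Finset.sum_congr rfl fun a _ => ?_
    simp only [if_true]
    push_cast
    field_simp
  · refine Finset.sum_eq_zero fun m hm => Finset.sum_eq_zero fun a _ => ?_
    rw [if_neg]
    · simp
    · rintro rfl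
      exact h (abs_le.2 (Finset.mem_Icc.1 hm))

/-- The binomial formula separates `x` from `x'` at the cost `2^n`. The band excluded from
`farCoeff` supplies `5^{-n}`, so the series in `n` converges. -/
lemma tripleBound_farTerm (hp : p ∈ Icc (1 : ℝ) 2) (hE : IsSpectralOn E A R)
    (hE' : IsSpectralOn E' A' R) (hQ : IsSpectralOn Q B R) {J : Finset ℤ}
    (hJ : ∀ x ∈ Icc (-R : ℝ) R, ⌊M * x⌋ ∈ J) {d : ℕ → ℝ → ℝ → ℂ} {G : ℝ}
    (hd : ∀ c x y, ‖d c x y‖ ≤ G) (q : ℕ × ℕ) :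
    TripleBound p E E' Q R ((J.card : ℝ) ^ 2) (fun x x' y =>
        farTerm M q (fun x _ => Int.fract (M * x)) x x' * d q.2 (⌊M * x⌋ / M) y)
        (hilbertConst * G * ((2 / 5) ^ q.1 * (1 / q.2 !))) ∧
    TripleBound p E E' Q R ((J.card : ℝ) ^ 2) (fun x x' y =>
        farTerm M q (fun _ x' => Int.fract (M * x')) x x' * d q.2 (⌊M * x'⌋ / M) y)
        (hilbertConst * G * ((2 / 5) ^ q.1 * (1 / q.2 !))) := by
  obtain ⟨n, c⟩ := q
  have hG : 0 ≤ G := (norm_nonneg _).trans (hd 0 0 0)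
  have hK : 0 < hilbertConst * (1 / 5) ^ n := mul_pos (by linarith [hilbertConst_ge]) (by positivity)
  have hsum : ∑ a ∈ Finset.range (n + 1), ‖((n.choose a * (-1) ^ (n - a) / c ! : ℝ) : ℂ)‖ *
      (hilbertConst * (1 / 5) ^ n * G) = hilbertConst * G * ((2 / 5) ^ n * (1 / c !)) := by
    have h1 : ∀ a, ‖((n.choose a * (-1) ^ (n - a) / c ! : ℝ) : ℂ)‖ = n.choose a / c ! := fun a => by
      rw [Complex.norm_real, norm_div, norm_mul, norm_pow, norm_neg, norm_one, one_pow, mul_one,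
        Real.norm_natCast, Real.norm_natCast]
    simp_rw [h1]
    rw [← Finset.sum_mul, ← Finset.sum_div]
    have : ∑ a ∈ Finset.range (n + 1), (n.choose a : ℝ) = 2 ^ n := by
      exact_mod_cast Nat.sum_range_choose n
    rw [this, div_pow, div_pow]
    ring
  have hbin : ∀ σ τ : ℝ, (τ - σ) ^ n =
      ∑ a ∈ Finset.range (n + 1), n.choose a * (-1) ^ (n - a) * (σ ^ (n - a) * τ ^ a) := fun σ τ => by
    rw [sub_eq_add_neg, add_pow]
    refine Finset.sum_congr rfl fun a _ => ?_
    rw [neg_pow σ]; ring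
  constructor
  · have key := TripleBound.sum hp.1 (Finset.range (n + 1)) (fun a _ =>
      TripleBound.const_mul hp.1 (tripleBound_block_left hp hE hE' hQ hJ (κ := farCoeff n) hK
        (formBound_farCoeff n J) (abs_farCoeff_le n)
        (a := fun x => ((Int.fract (M * x) ^ (n - a + c) : ℝ) : ℂ))
        (b := fun x' => ((Int.fract (M * x') ^ a : ℝ) : ℂ)) (e := fun j y => d c (j / M) y)
        (fun x _ => norm_fract_pow_le _ _) (fun x _ => norm_fract_pow_le _ _) hG
        fun j y _ => hd _ _ _) ((n.choose a * (-1) ^ (n - a) / c ! : ℝ) : ℂ))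
      fun a _ => mul_nonneg (norm_nonneg _) (mul_nonneg hK.le hG)
    rw [hsum] at key
    refine key.congr fun x _ x' _ y _ => ?_
    simp only [farTerm]
    rw [hbin]
    push_cast
    rw [Finset.mul_sum, Finset.sum_mul, Finset.sum_mul]
    refine Finset.sum_congr rfl fun a _ => ?_
    rw [pow_add]
    ring
  · have key := TripleBound.sum hp.1 (Finset.range (n + 1)) (fun a _ =>
      TripleBound.const_mul hp.1 (tripleBound_block_right hp hE hE' hQ hJ (κ := farCoeff n) hK
        (formBound_farCoeff n J) (abs_farCoeff_le n)
        (a := fun x => ((Int.fract (M * x) ^ (n - a) : ℝ) : ℂ))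
        (b := fun x' => ((Int.fract (M * x') ^ (a + c) : ℝ) : ℂ)) (e := fun j y => d c (j / M) y)
        (fun x _ => norm_fract_pow_le _ _) (fun x _ => norm_fract_pow_le _ _) hG
        fun j y _ => hd _ _ _) ((n.choose a * (-1) ^ (n - a) / c ! : ℝ) : ℂ))
      fun a _ => mul_nonneg (norm_nonneg _) (mul_nonneg hK.le hG)
    rw [hsum] at key
    refine key.congr fun x _ x' _ y _ => ?_
    simp only [farTerm]
    rw [hbin]
    push_cast
    rw [Finset.mul_sum, Finset.sum_mul, Finset.sum_mul]
    refine Finset.sum_congr rfl fun a _ => ?_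
    rw [pow_add]
    ring

end ExponentialType

end NoncommFun

namespace NoncommFun

/-! ### The Lipschitz estimate for functions of exponential type. -/

section ExponentialTypeEstimate

open Filter Topology
open scoped Nat

/-- With `D = j - k` and `r` the difference of the fractional parts, `M (x - x') = D - r`, where
`|r| < 1` and `|D| ≥ 5`; expand in a geometric series. -/
lemma hasSum_farCoeff {M x x' : ℝ} (h : 5 ≤ |⌊M * x⌋ - ⌊M * x'⌋|) :
    HasSum (fun n => farCoeff n ⌊M * x⌋ ⌊M * x'⌋ * (Int.fract (M * x') - Int.fract (M * x)) ^ n)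
      (M * (x - x'))⁻¹ := by
  set D : ℝ := ((⌊M * x⌋ - ⌊M * x'⌋ : ℤ) : ℝ) with hD
  set r := Int.fract (M * x') - Int.fract (M * x) with hr
  have hD5 : (5 : ℝ) ≤ |D| := by rw [hD]; exact_mod_cast h
  have hD0 : D ≠ 0 := fun h0 => by rw [h0, abs_zero] at hD5; linarith
  have hr1 : |r| < 1 := by
    rw [hr, abs_lt]
    constructor <;> linarith [Int.fract_nonneg (M * x), Int.fract_lt_one (M * x),
      Int.fract_nonneg (M * x'), Int.fract_lt_one (M * x')]
  have h1 : |r / D| < 1 := by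
    rw [abs_div, div_lt_one (by linarith)]; linarith
  have h2 := (hasSum_geometric_of_abs_lt_one h1).mul_left D⁻¹
  have e1 : M * (x - x') = D - r := by
    rw [hD, hr]
    push_cast
    linarith [Int.floor_add_fract (M * x), Int.floor_add_fract (M * x')]
  have e2 : D⁻¹ * (1 - r / D)⁻¹ = (M * (x - x'))⁻¹ := by
    rw [e1, ← mul_inv]; congr 1; field_simp
  rw [e2] at h2
  convert! h2 using 2 with n
  rw [farCoeff, if_pos h, ← hD, div_pow, pow_succ]
  field_simp

lemma hasSum_farTerm {M x x' : ℝ} (h : 5 ≤ |⌊M * x⌋ - ⌊M * x'⌋|) {s : ℝ → ℝ → ℝ} {v : ℕ → ℂ} {b : ℂ}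
    (hv : HasSum (fun c => ((s x x' ^ c / c ! : ℝ) : ℂ) * v c) b) :
    HasSum (fun q : ℕ × ℕ => (farTerm M q s x x' : ℂ) * v q.2) (((M * (x - x'))⁻¹ : ℝ) * b) := by
  set f : ℕ → ℂ := fun n => ((farCoeff n ⌊M * x⌋ ⌊M * x'⌋ *
    (Int.fract (M * x') - Int.fract (M * x)) ^ n : ℝ) : ℂ) with hf
  set g : ℕ → ℂ := fun c => ((s x x' ^ c / c ! : ℝ) : ℂ) * v c with hg
  have h1 : HasSum f (((M * (x - x'))⁻¹ : ℝ) : ℂ) := (hasSum_farCoeff h).mapL Complex.ofRealCLM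
  have h2 : Summable fun q : ℕ × ℕ => f q.1 * g q.2 :=
    summable_mul_of_summable_norm (f := f) (g := g) h1.summable.norm hv.summable.norm
  have h3 := HasSum.mul (f := f) (g := g) h1 hv h2
  have e : ∀ q : ℕ × ℕ, (farTerm M q s x x' : ℂ) * v q.2 = f q.1 * g q.2 := by
    intro q
    rw [farTerm, Complex.ofReal_mul, mul_assoc]
  simp_rw [e]
  exact h3

lemma farTerm_eq_zero {M x x' : ℝ} (h : ¬ 5 ≤ |⌊M * x⌋ - ⌊M * x'⌋|) (q : ℕ × ℕ) (s : ℝ → ℝ → ℝ) :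
    farTerm M q s x x' = 0 := by
  rw [farTerm, farCoeff, if_neg h, zero_mul, zero_mul]

lemma norm_nearTerm_le {M G : ℝ} {d : ℕ → ℝ → ℝ → ℂ} (hd : ∀ c x y, ‖d c x y‖ ≤ G) (c : ℕ)
    (x x' y : ℝ) : ‖nearTerm M d c x x' y‖ ≤ G * (5 ^ c / c !) := by
  have hG : 0 ≤ G := (norm_nonneg _).trans (hd 0 0 0)
  rw [nearTerm]
  split_ifs with h
  · rw [norm_mul, Complex.norm_real, mul_comm]
    gcongr
    · exact hd _ _ _
    · rw [norm_div, Real.norm_natCast, Nat.factorial_succ]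
      have h1 : |M * x' - ⌊M * x⌋| ≤ 5 := by
        have h2 : |((⌊M * x'⌋ - ⌊M * x⌋ : ℤ) : ℝ)| ≤ 4 := by exact_mod_cast h
        push_cast at h2
        rw [abs_le] at h2 ⊢
        constructor <;> linarith [Int.floor_add_fract (M * x'), Int.fract_nonneg (M * x'),
          Int.fract_lt_one (M * x')]
      have h3 : ‖∑ a ∈ Finset.range (c + 1), Int.fract (M * x) ^ a *
          (M * x' - ⌊M * x⌋) ^ (c - a)‖ ≤ (c + 1) * 5 ^ c := by
        refine (norm_sum_le_of_le _ (f := fun a => Int.fract (M * x) ^ a *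
          (M * x' - ⌊M * x⌋) ^ (c - a)) (n := fun _ => (5 : ℝ) ^ c) fun a _ => ?_).trans_eq
          (by simp)
        rw [norm_mul, norm_pow, norm_pow, Real.norm_of_nonneg (Int.fract_nonneg _), Real.norm_eq_abs]
        calc _ ≤ 1 * (5 : ℝ) ^ (c - a) := by
              gcongr
              exact pow_le_one₀ (Int.fract_nonneg _) (Int.fract_lt_one _).le
          _ ≤ 5 ^ c := by rw [one_mul]; exact pow_le_pow_right₀ (by norm_num) (Nat.sub_le c a)
      rw [div_le_div_iff₀ (by positivity) (by positivity)]
      push_cast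
      have : (0 : ℝ) < c ! := by positivity
      nlinarith
  · rw [norm_zero]; positivity

lemma nearTerm_eq_zero {M : ℝ} (d : ℕ → ℝ → ℝ → ℂ) (c : ℕ) {x x' : ℝ} (y : ℝ)
    (h : 5 ≤ |⌊M * x⌋ - ⌊M * x'⌋|) : nearTerm M d c x x' y = 0 := by
  rw [nearTerm, if_neg]
  rw [abs_sub_comm]
  omega

/-- Both values of `g` are expanded about the same endpoint `⌊M x⌋ / M`, and each `σ^c - t^c` is
divided by `σ - t`. -/
lemma tsum_nearTerm_mul {M G : ℝ} {d : ℕ → ℝ → ℝ → ℂ} (hd : ∀ c x y, ‖d c x y‖ ≤ G) {g : ℝ → ℝ → ℂ}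
    (hM : 0 < M)
    (hg : ∀ x s y, HasSum (fun c => ((s ^ c / c ! : ℝ) : ℂ) * d c x y) (g (x + s / M) y))
    {x x' y : ℝ} (h : ¬ 5 ≤ |⌊M * x⌋ - ⌊M * x'⌋|) :
    (∑' c, nearTerm M d c x x' y) * ((M * (x - x') : ℝ) : ℂ) = g x y - g x' y := by
  have hsum : Summable fun c => nearTerm M d c x x' y :=
    Summable.of_norm (((Real.summable_pow_div_factorial 5).mul_left G).of_nonneg_of_le
      (fun _ => norm_nonneg _) fun c => norm_nearTerm_le hd c x x' y)
  set σ := Int.fract (M * x) with hσ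
  set t := M * x' - ⌊M * x⌋ with ht
  have e0 : M * (x - x') = σ - t := by
    rw [hσ, ht]; linarith [Int.floor_add_fract (M * x)]
  have h1 : HasSum (fun c => ((σ ^ c / c ! : ℝ) : ℂ) * d c (⌊M * x⌋ / M) y -
      ((t ^ c / c ! : ℝ) : ℂ) * d c (⌊M * x⌋ / M) y) (g x y - g x' y) := by
    have e1 : (⌊M * x⌋ : ℝ) / M + σ / M = x := by
      rw [← add_div, hσ, Int.floor_add_fract]; field_simp
    have e2 : (⌊M * x⌋ : ℝ) / M + t / M = x' := by
      rw [← add_div, ht, add_sub_cancel]; field_simp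
    have := (hg (⌊M * x⌋ / M) σ y).sub (hg (⌊M * x⌋ / M) t y)
    rwa [e1, e2] at this
  -- The terms of order zero cancel, so the series is shifted by one.
  rw [← hasSum_nat_add_iff' 1] at h1
  simp only [Finset.range_one, Finset.sum_singleton, pow_zero, sub_self, sub_zero] at h1
  rw [← tsum_mul_right]
  rw [← h1.tsum_eq]
  refine tsum_congr fun c => ?_
  have h2 : |⌊M * x'⌋ - ⌊M * x⌋| ≤ 4 := by rw [abs_sub_comm]; omega
  have h3 := (Commute.all σ t).geom_sum₂_mul (c + 1)
  simp only [Nat.add_sub_cancel] at h3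
  have h4 : (((∑ a ∈ Finset.range (c + 1), σ ^ a * t ^ (c - a)) / (c + 1)! : ℝ) : ℂ) *
      ((σ - t : ℝ) : ℂ) = ((σ ^ (c + 1) / (c + 1)! : ℝ) : ℂ) - ((t ^ (c + 1) / (c + 1)! : ℝ) : ℂ) := by
    rw [← Complex.ofReal_mul, ← Complex.ofReal_sub, div_mul_eq_mul_div, h3, sub_div]
  rw [nearTerm, if_pos h2, e0, mul_right_comm, h4, sub_mul]

/-- The constant in the estimate for functions of exponential type. -/
noncomputable def schurConst : ℝ :=
  9 * (∑' c : ℕ, (5 : ℝ) ^ c / c !) +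
    2 * (hilbertConst * ∑' q : ℕ × ℕ, ((2 / 5 : ℝ) ^ q.1 * (1 / q.2 !)))

lemma summable_farBound : Summable fun q : ℕ × ℕ => ((2 / 5 : ℝ) ^ q.1 * (1 / q.2 !)) := by
  have h1 : Summable fun n : ℕ => (2 / 5 : ℝ) ^ n :=
    summable_geometric_of_lt_one (by norm_num) (by norm_num)
  have h2 : Summable fun n : ℕ => (1 / n ! : ℝ) := by
    simpa using Real.summable_pow_div_factorial 1
  exact Summable.mul_of_nonneg (f := fun n : ℕ => (2 / 5 : ℝ) ^ n) (g := fun n : ℕ => (1 / n ! : ℝ))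
    h1 h2 (fun _ => by positivity) fun _ => by positivity

variable {H : Type u} [NormedAddCommGroup H] [InnerProductSpace ℂ H] [CompleteSpace H]
variable {E E' Q : Set ℝ → H →L[ℂ] H} {A A' B : H →L[ℂ] H} {R : ℕ} {p M L : ℝ}

/-- For a function of exponential type, `f(A,B)` is a Lipschitz function of `A`. -/
lemma IsExpType.diagNorm_sub_le {G : ℝ} {g : ℝ → ℝ → ℂ} (hg : IsExpType M G g) (hM : 0 < M)
    (hp : p ∈ Icc (1 : ℝ) 2) (hE : IsSpectralOn E A R) (hE' : IsSpectralOn E' A' R)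
    (hQ : IsSpectralOn Q B R) {W W' : H →L[ℂ] H}
    (hW : Tendsto (fun N => doubleStepOp E Q R N 1 g) atTop (𝓝 W))
    (hW' : Tendsto (fun N => doubleStepOp E' Q R N 1 g) atTop (𝓝 W')) {ι : Type} {v : ι → H}
    (hv : Orthonormal ℂ v)
    (hS : ∀ h, HasSum (fun i => ⟪star (A - A') (v i), h⟫_ℂ • v i) ((A - A') h)) :
    diagNorm p (W - W') ≤ ENNReal.ofReal (M * G * schurConst) *
      (∑' i, ‖star (A - A') (v i)‖ₑ ^ p) ^ (1 / p) := by
  obtain ⟨d, hd, -, hg⟩ := hg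
  have hG : 0 ≤ G := (norm_nonneg _).trans (hd 0 0 0)
  have hK : 0 ≤ hilbertConst := by linarith [hilbertConst_ge]
  set J : Finset ℤ := Finset.Icc ⌊M * (-R)⌋ ⌊M * R⌋ with hJdef
  have hJ : ∀ x ∈ Icc (-R : ℝ) R, ⌊M * x⌋ ∈ J := fun x hx =>
    Finset.mem_Icc.2 ⟨Int.floor_le_floor (mul_le_mul_of_nonneg_left hx.1 hM.le),
      Int.floor_le_floor (mul_le_mul_of_nonneg_left hx.2 hM.le)⟩
  set f₁ : ℕ × ℕ → ℝ → ℝ → ℝ → ℂ := fun q x x' y =>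
    farTerm M q (fun x _ => Int.fract (M * x)) x x' * d q.2 (⌊M * x⌋ / M) y with hf₁
  set f₂ : ℕ × ℕ → ℝ → ℝ → ℝ → ℂ := fun q x x' y =>
    farTerm M q (fun _ x' => Int.fract (M * x')) x x' * d q.2 (⌊M * x'⌋ / M) y with hf₂
  have hbase : ∀ x y, HasSum (fun c => ((Int.fract (M * x) ^ c / c ! : ℝ) : ℂ) *
      d c (⌊M * x⌋ / M) y) (g x y) := fun x y => by
    have e1 : (⌊M * x⌋ : ℝ) / M + Int.fract (M * x) / M = x := by
      rw [← add_div, Int.floor_add_fract]; field_simp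
    have := hg (⌊M * x⌋ / M) (Int.fract (M * x)) y
    rwa [e1] at this
  have hfar₁ : ∀ x x' y, HasSum (fun q => f₁ q x x' y) (if 5 ≤ |⌊M * x⌋ - ⌊M * x'⌋| then
      (((M * (x - x'))⁻¹ : ℝ) : ℂ) * g x y else 0) := by
    intro x x' y
    split_ifs with h
    · exact hasSum_farTerm (s := fun x _ => Int.fract (M * x))
        (v := fun c => d c (⌊M * x⌋ / M) y) h (hbase x y)
    · have h0 : ∀ q, f₁ q x x' y = 0 := fun q => by
        simp only [hf₁, farTerm_eq_zero h, Complex.ofReal_zero, zero_mul]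
      simp_rw [h0]
      exact hasSum_zero
  have hfar₂ : ∀ x x' y, HasSum (fun q => f₂ q x x' y) (if 5 ≤ |⌊M * x⌋ - ⌊M * x'⌋| then
      (((M * (x - x'))⁻¹ : ℝ) : ℂ) * g x' y else 0) := by
    intro x x' y
    split_ifs with h
    · exact hasSum_farTerm (s := fun _ x' => Int.fract (M * x'))
        (v := fun c => d c (⌊M * x'⌋ / M) y) h (hbase x' y)
    · have h0 : ∀ q, f₂ q x x' y = 0 := fun q => by
        simp only [hf₂, farTerm_eq_zero h, Complex.ofReal_zero, zero_mul]
      simp_rw [h0]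
      exact hasSum_zero
  have hnear : ∀ x x' y, HasSum (fun c => nearTerm M d c x x' y) (∑' c, nearTerm M d c x x' y) :=
    fun x x' y => (Summable.of_norm (((Real.summable_pow_div_factorial 5).mul_left G).of_nonneg_of_le
      (fun _ => norm_nonneg _) fun c => norm_nearTerm_le hd c x x' y)).hasSum
  have b₀ := TripleBound.hasSum hp.1 (fun c => tripleBound_nearTerm hp hE hE' hQ hJ hd c)
    (fun c => by positivity) ((Real.summable_pow_div_factorial 5).hasSum.mul_left (9 * G))
    fun x _ x' _ y _ => hnear x x' y
  have b₁ := TripleBound.hasSum hp.1 (fun q => (tripleBound_farTerm hp hE hE' hQ hJ hd q).1)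
    (fun c => by positivity) (summable_farBound.hasSum.mul_left (hilbertConst * G))
    fun x _ x' _ y _ => hfar₁ x x' y
  have b₂ := TripleBound.hasSum hp.1 (fun q => (tripleBound_farTerm hp hE hE' hQ hJ hd q).2)
    (fun c => by positivity) (summable_farBound.hasSum.mul_left (hilbertConst * G))
    fun x _ x' _ y _ => hfar₂ x x' y
  have hs1 : 0 ≤ ∑' c : ℕ, (5 : ℝ) ^ c / c ! := tsum_nonneg fun _ => by positivity
  have hs2 : 0 ≤ ∑' q : ℕ × ℕ, ((2 / 5 : ℝ) ^ q.1 * (1 / q.2 !)) :=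
    tsum_nonneg fun _ => by positivity
  -- The divided difference is `M (near + far₁ - far₂)`, the factor `M` compensating the quotients
  -- by `M (x - x')`.
  have b := ((b₀.add hp.1 b₁ (by positivity) (by positivity)).add hp.1 (b₂.const_mul hp.1 (-1))
    (by positivity) (by positivity)).const_mul hp.1 (M : ℂ)
  have hconst : ‖(M : ℂ)‖ * (9 * G * ∑' c : ℕ, (5 : ℝ) ^ c / c ! +
      hilbertConst * G * ∑' q : ℕ × ℕ, ((2 / 5 : ℝ) ^ q.1 * (1 / q.2 !)) +
      ‖(-1 : ℂ)‖ * (hilbertConst * G * ∑' q : ℕ × ℕ, ((2 / 5 : ℝ) ^ q.1 * (1 / q.2 !)))) =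
      M * G * schurConst := by
    rw [Complex.norm_real, Real.norm_of_nonneg hM.le, norm_neg, norm_one, schurConst]
    ring
  rw [hconst] at b
  refine b.diagNorm_sub_le hE hE' (fun x x' y => ?_) hW hW' hv hS
  -- Far from the diagonal the near terms vanish and `x ≠ x'`; otherwise both far terms vanish.
  split_ifs with h
  · have h0 : ∀ c, nearTerm M d c x x' y = 0 := fun c => nearTerm_eq_zero d c y h
    simp_rw [h0]
    have hne : x - x' ≠ 0 := by
      intro h1
      rw [sub_eq_zero] at h1
      rw [h1, sub_self, abs_zero] at h
      omega
    have hne' : (x - x' : ℂ) ≠ 0 := by exact_mod_cast hne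
    have hM' : (M : ℂ) ≠ 0 := by exact_mod_cast hM.ne'
    rw [tsum_zero]
    push_cast
    field_simp
    ring
  · rw [← tsum_nearTerm_mul hd hM hg h]
    push_cast
    ring

end ExponentialTypeEstimate

end NoncommFun

namespace NoncommFun

/-! ### Functions of exponential type as nuclear series on a square. -/

section NuclearBounds

open Filter Topology
open scoped Nat

/-- On `[-R, R]²` the function `F` is the sum of a series of products of continuous functions, the
projective tensor norm of which does not exceed `C`. -/
def HasNuclearBound (R : ℕ) (F : ℝ → ℝ → ℂ) (C : ℝ) : Prop :=
  ∃ (ι : Type) (a b : ι → ℝ → ℂ) (c d : ι → ℝ), IsNuclearSeries R F a b c d ∧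
    ∑' m, c m * d m ≤ C

namespace HasNuclearBound

variable {R : ℕ} {F G : ℝ → ℝ → ℂ} {C D : ℝ}

lemma congr (h : HasNuclearBound R F C)
    (hFG : ∀ x ∈ Icc (-R : ℝ) R, ∀ y ∈ Icc (-R : ℝ) R, F x y = G x y) :
    HasNuclearBound R G C := by
  obtain ⟨ι, a, b, c, d, h, hC⟩ := h
  exact ⟨ι, a, b, c, d, { h with hasSum := fun x hx y hy => hFG x hx y hy ▸ h.hasSum x hx y hy },
    hC⟩

lemma of_right {g : ℝ → ℂ} (hg : Continuous g) (hC : ∀ y ∈ Icc (-R : ℝ) R, ‖g y‖ ≤ C) :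
    HasNuclearBound R (fun _ y => g y) C :=
  ⟨Unit, fun _ _ => 1, fun _ => g, fun _ => 1, fun _ => C,
    { continuous_left := fun _ => continuous_const
      continuous_right := fun _ => hg
      norm_left := fun _ _ _ => by simp
      norm_right := fun _ => hC
      summable := (hasSum_fintype _).summable
      hasSum := fun x _ y _ => by
        simp }, by simp⟩

lemma of_hasSum {κ : Type} {F : κ → ℝ → ℝ → ℂ} {C : κ → ℝ}
    (h : ∀ k, HasNuclearBound R (F k) (C k)) (hC : Summable C)
    (hF : ∀ x ∈ Icc (-R : ℝ) R, ∀ y ∈ Icc (-R : ℝ) R, HasSum (fun k => F k x y) (G x y)) :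
    HasNuclearBound R G (∑' k, C k) := by
  choose ι a b c d h hle using h
  have h0 : ∀ q : Σ k, ι k, 0 ≤ c q.1 q.2 * d q.1 q.2 := fun q =>
    mul_nonneg ((h q.1).nonneg_left q.2) ((h q.1).nonneg_right q.2)
  have hs : Summable fun k => ∑' m, c k m * d k m :=
    hC.of_nonneg_of_le (fun k => tsum_nonneg fun m => h0 ⟨k, m⟩) hle
  have h1 : Summable fun q : Σ k, ι k => c q.1 q.2 * d q.1 q.2 :=
    (summable_sigma_of_nonneg h0).2 ⟨fun k => (h k).summable, hs⟩
  refine ⟨Σ k, ι k, fun q => a q.1 q.2, fun q => b q.1 q.2, fun q => c q.1 q.2,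
    fun q => d q.1 q.2,
    { continuous_left := fun q => (h q.1).continuous_left q.2
      continuous_right := fun q => (h q.1).continuous_right q.2
      norm_left := fun q => (h q.1).norm_left q.2
      norm_right := fun q => (h q.1).norm_right q.2
      summable := h1
      hasSum := fun x hx y hy => ?_ }, ?_⟩
  · have h2 : Summable fun q : Σ k, ι k => a q.1 q.2 x * b q.1 q.2 y := by
      refine Summable.of_norm (h1.of_nonneg_of_le (fun _ => norm_nonneg _) fun q => ?_)
      rw [norm_mul]
      exact mul_le_mul ((h q.1).norm_left q.2 x hx) ((h q.1).norm_right q.2 y hy) (norm_nonneg _)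
        ((h q.1).nonneg_left q.2)
    have h3 := h2.hasSum.sigma fun k => (h k).hasSum x hx y hy
    exact h3.unique (hF x hx y hy) ▸ h2.hasSum
  · rw [h1.tsum_sigma' fun k => (h k).summable]
    exact hs.tsum_le_tsum hle hC

lemma add (hF : HasNuclearBound R F C) (hG : HasNuclearBound R G D) :
    HasNuclearBound R (fun x y => F x y + G x y) (C + D) := by
  have := of_hasSum (R := R) (κ := Bool) (F := fun k => cond k F G) (C := fun k => cond k C D)
    (G := fun x y => F x y + G x y) (by rintro (_ | _); exacts [hG, hF])
    (hasSum_fintype _).summable fun x _ y _ => by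
      simpa using hasSum_fintype fun k : Bool => cond k F G x y
  simpa using this

lemma sum {K : ℕ} {F : ℕ → ℝ → ℝ → ℂ} (h : ∀ k < K, HasNuclearBound R (F k) C) :
    HasNuclearBound R (fun x y => ∑ k ∈ Finset.range K, F k x y) (K * C) := by
  have := of_hasSum (R := R) (κ := Fin K) (F := fun k => F k) (C := fun _ => C)
    (G := fun x y => ∑ k ∈ Finset.range K, F k x y) (fun k => h k k.2)
    (hasSum_fintype _).summable fun x _ y _ => by
      rw [← Fin.sum_univ_eq_sum_range fun k => F k x y]
      exact hasSum_fintype _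
  simpa using this

section Operators

variable {H : Type u} [NormedAddCommGroup H] [InnerProductSpace ℂ H] [CompleteSpace H]
  {E₁ E₂ : Set ℝ → H →L[ℂ] H} {A B : H →L[ℂ] H}

lemma norm_doubleStepOp_le (h : HasNuclearBound R F C) (hE₁ : IsSpectralOn E₁ A R)
    (hE₂ : IsSpectralOn E₂ B R) (N : ℕ) : ‖doubleStepOp E₁ E₂ R N 1 F‖ ≤ C := by
  obtain ⟨ι, a, b, c, d, h, hC⟩ := h
  refine le_trans ?_ hC
  rw [← (h.hasSum_doubleStepOp N (1 : H →L[ℂ] H)).tsum_eq]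
  refine tsum_of_norm_bounded h.summable.hasSum fun m => ?_
  rw [mul_one]
  exact (norm_mul_le _ _).trans (mul_le_mul
    (hE₁.norm_stepOp_le N (h.nonneg_left m) (h.norm_left m))
    (hE₂.norm_stepOp_le N (h.nonneg_right m) (h.norm_right m)) (norm_nonneg _) (h.nonneg_left m))

lemma exists_tendsto (h : HasNuclearBound R F C) (hE₁ : IsSpectralOn E₁ A R)
    (hE₂ : IsSpectralOn E₂ B R) :
    ∃ W, Tendsto (fun N => doubleStepOp E₁ E₂ R N 1 F) atTop (𝓝 W) := by
  obtain ⟨ι, a, b, c, d, h, -⟩ := h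
  exact ⟨_, h.tendsto_doubleStepOp hE₁ hE₂ 1⟩

end Operators

end HasNuclearBound

/-- Telescoping: for each interval of the subdivision, `x` is clamped to it, so the increments add
up to the one from `t 0` to `x`. The clamps keep every summand continuous. -/
lemma sum_clamp_sub {t : ℕ → ℝ} (ht : Monotone t) (g : ℝ → ℂ) {x : ℝ} (hx : t 0 ≤ x) (K : ℕ) :
    ∑ k ∈ Finset.range K, (g (max (t k) (min x (t (k + 1)))) - g (t k)) =
      g (min x (t K)) - g (t 0) := by
  induction K with
  | zero => simp [hx]
  | succ K ih =>
    rw [Finset.sum_range_succ, ih]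
    have h := ht (Nat.le_succ K)
    rcases le_total x (t K) with h1 | h1
    · rw [min_eq_left h1, min_eq_left (h1.trans h), max_eq_left h1]
      ring
    · rw [min_eq_right h1, max_eq_right (le_min h1 h)]
      ring

namespace IsExpType

variable {M G : ℝ} {g : ℝ → ℝ → ℂ} (hg : IsExpType M G g)
include hg

lemma nonneg : 0 ≤ G := by
  obtain ⟨d, hd, -, -⟩ := hg
  exact (norm_nonneg _).trans (hd 0 0 0)

lemma conj : IsExpType M G fun x y => starRingEnd ℂ (g x y) := by
  obtain ⟨d, h1, h2, h3⟩ := hg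
  refine ⟨fun c x y => starRingEnd ℂ (d c x y), fun c x y => ?_, fun c x => ?_, fun x s y => ?_⟩
  · rw [RCLike.norm_conj]; exact h1 c x y
  · exact Complex.continuous_conj.comp (h2 c x)
  · have := (h3 x s y).map (starRingEnd ℂ).toAddMonoidHom Complex.continuous_conj
    simpa [Function.comp_def, Complex.conj_ofReal] using this

/-- Taylor expansion about `t`. As `M δ ≤ 1`, one factor `M δ` is kept from each power, which makes
the bound linear in `δ`. -/
lemma hasNuclearBound_step (hM : 0 < M) {δ : ℝ} (hδ : M * δ ≤ 1) {R : ℕ} {t : ℝ} {γ : ℝ → ℝ}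
    (hγ : Continuous γ) (hγt : ∀ x, |γ x - t| ≤ δ) :
    HasNuclearBound R (fun x y => g (γ x) y - g t y) (M * δ * Real.exp 1 * G) := by
  have hG := hg.nonneg
  obtain ⟨d, h1, h2, h3⟩ := hg
  have hδ0 : 0 ≤ δ := (abs_nonneg _).trans (hγt 0)
  have he : HasSum (fun c : ℕ => M * δ * (1 / c ! : ℝ) * G) (M * δ * Real.exp 1 * G) := by
    have := NormedSpace.expSeries_div_hasSum_exp (𝔸 := ℝ) 1
    simp only [one_pow, ← Real.exp_eq_exp_ℝ] at this
    exact (this.mul_left _).mul_right _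
  refine ⟨ℕ, fun c x => (((M * (γ x - t)) ^ (c + 1) / (c + 1)! : ℝ) : ℂ), fun c => d (c + 1) t,
    fun c => M * δ * (1 / c ! : ℝ), fun _ => G,
    { continuous_left := fun c => by fun_prop
      continuous_right := fun c => h2 _ _
      norm_left := fun c x _ => ?_
      norm_right := fun c y _ => h1 _ _ _
      summable := he.summable
      hasSum := fun x _ y _ => ?_ }, he.tsum_eq.le⟩
  · have ha : |M * (γ x - t)| ≤ M * δ := by
      rw [abs_mul, abs_of_pos hM]
      gcongr
      exact hγt x
    rw [Complex.norm_real, Real.norm_eq_abs, abs_div, abs_pow, pow_succ', Nat.abs_cast,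
      mul_div_assoc]
    gcongr
    · exact pow_le_one₀ (abs_nonneg _) (ha.trans hδ)
    · exact Nat.le_succ c
  · have h4 := h3 t (M * (γ x - t)) y
    rw [mul_div_cancel_left₀ _ hM.ne', add_sub_cancel] at h4
    have h5 : d 0 t y = g t y := by
      have := (h3 t 0 y).unique (hasSum_single 0 fun c hc => by simp [hc])
      simpa using this.symm
    have h6 := (hasSum_nat_add_iff' 1).2 h4
    simpa [h5] using h6

/-- Short steps keep the bound linear in `M`, where a single Taylor series over the whole interval
would give an exponential. Linearity is what makes the bounds summable over the Littlewood–Paley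
pieces. -/
lemma hasNuclearBound (hM : 0 < M) (R : ℕ) :
    HasNuclearBound R (fun x y => g x y - g (-R) y) (2 * R * Real.exp 1 * (M * G)) := by
  -- This many pieces make the step `2R/K` satisfy `M δ ≤ 1`, and `K δ = 2R` removes `K` from the
  -- final bound.
  obtain ⟨K, hK⟩ := exists_nat_gt (M * (2 * R))
  have hK0 : 0 < (K : ℝ) := lt_of_le_of_lt (by positivity) hK
  set δ : ℝ := 2 * R / K with hδ
  have hδ0 : 0 ≤ δ := by positivity
  set t : ℕ → ℝ := fun k => -R + k * δ with ht
  have hmono : Monotone t := fun i j hij => by simp only [ht]; gcongr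
  have h1 : M * δ ≤ 1 := by
    rw [hδ, mul_div_assoc', div_le_one hK0]; exact hK.le
  have h2 : ∀ k < K, HasNuclearBound R
      (fun x y => g (max (t k) (min x (t (k + 1)))) y - g (t k) y) (M * δ * Real.exp 1 * G) := by
    intro k _
    refine hg.hasNuclearBound_step hM h1 (by fun_prop) fun x => ?_
    have h3 : t (k + 1) - t k = δ := by simp only [ht]; push_cast; ring
    rw [abs_of_nonneg (sub_nonneg.2 (le_max_left _ _)), sub_le_iff_le_add]
    exact max_le (by linarith) ((min_le_right _ _).trans (by linarith))
  have h3 := HasNuclearBound.sum h2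
  have e : (K : ℝ) * (M * δ * Real.exp 1 * G) = 2 * R * Real.exp 1 * (M * G) := by
    rw [hδ]; field_simp
  rw [e] at h3
  refine h3.congr fun x hx y _ => ?_
  have h4 : t K = R := by simp only [ht, hδ]; field_simp; ring
  have h5 : t 0 = -R := by simp [ht]
  rw [sum_clamp_sub hmono (fun z => g z y) (by rw [h5]; exact hx.1) K, h4, h5, min_eq_left hx.2]

lemma hasNuclearBound_sub (hg' : IsExpType M G fun y x => g x y) (hM : 0 < M) (R : ℕ) :
    HasNuclearBound R (fun x y => g x y - g (-R) (-R)) (4 * R * Real.exp 1 * (M * G)) := by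
  have h1 := hg.hasNuclearBound hM R
  have h2 := hg'.hasNuclearBound hM R
  have h3 : HasNuclearBound R (fun _ y => g (-R) y - g (-R) (-R)) (2 * R * Real.exp 1 * (M * G)) := by
    have hc : Continuous fun y => g (-R) y := by
      obtain ⟨d, -, hd, h⟩ := hg
      have : (fun y => g (-R) y) = d 0 (-R) := by
        funext y
        have := (h (-R) 0 y).unique (hasSum_single 0 fun c hc => by simp [hc])
        simpa using this
      rw [this]
      exact hd 0 (-R)
    refine HasNuclearBound.of_right (hc.sub continuous_const) fun y hy => ?_
    obtain ⟨ι, a, b, c, d, h, hC⟩ := h2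
    exact (h.norm_le hy (y := -R) (by simp)).trans hC
  have h4 := h1.add h3
  have e : 2 * R * Real.exp 1 * (M * G) + 2 * R * Real.exp 1 * (M * G) =
    4 * R * Real.exp 1 * (M * G) := by ring
  rw [e] at h4
  exact h4.congr fun x _ y _ => by ring

end IsExpType

end NuclearBounds

end NoncommFun

namespace NoncommFun

/-! ### Perturbation of functions of pairs, summed over pieces of exponential type. -/

section FunctionsOfPairs

open Filter Topology

variable {H : Type u} [NormedAddCommGroup H] [InnerProductSpace ℂ H]
  {E E' Q : Set ℝ → H →L[ℂ] H} {R : ℕ}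

lemma doubleStepOp_hasSum {κ : Type*} {F : κ → ℝ → ℝ → ℂ} {G : ℝ → ℝ → ℂ}
    (hF : ∀ x ∈ Icc (-R : ℝ) R, ∀ y ∈ Icc (-R : ℝ) R, HasSum (fun k => F k x y) (G x y)) (N : ℕ)
    (S : H →L[ℂ] H) :
    HasSum (fun k => doubleStepOp E Q R N S (F k)) (doubleStepOp E Q R N S G) :=
  hasSum_sum fun _ hi => hasSum_sum fun _ hj => (hF _ (node_mem hi) _ (node_mem hj)).smul_const _

lemma doubleStepOp_sub (N : ℕ) (S : H →L[ℂ] H) (F G : ℝ → ℝ → ℂ) :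
    doubleStepOp E Q R N S (fun x y => F x y - G x y) =
      doubleStepOp E Q R N S F - doubleStepOp E Q R N S G := by
  simp only [doubleStepOp, sub_smul, Finset.sum_sub_distrib]

variable [CompleteSpace H] {A A' B : H →L[ℂ] H}

lemma doubleStepOp_const (hE : IsSpectralOn E A R) (hQ : IsSpectralOn Q B R) (N : ℕ) (z : ℂ) :
    doubleStepOp E Q R N 1 (fun _ _ => z) = z • (1 : H →L[ℂ] H) := by
  have := doubleStepOp_mul E Q R N 1 (fun _ => z) (fun _ => 1)
  simp only [mul_one] at this
  rw [this]
  simp only [stepOp, one_smul, ← Finset.smul_sum, hE.sum_cell, hQ.sum_cell, mul_one]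

lemma star_doubleStepOp (hE : IsSpectralOn E A R) (hQ : IsSpectralOn Q B R) (N : ℕ)
    (F : ℝ → ℝ → ℂ) : star (doubleStepOp E Q R N 1 F) =
      doubleStepOp Q E R N 1 fun y x => starRingEnd ℂ (F x y) := by
  have hs : ∀ {E : Set ℝ → H →L[ℂ] H} {A : H →L[ℂ] H}, IsSpectralOn E A R → ∀ i,
      star (E (cell N i)) = E (cell N i) := fun hE i =>
    (hE.proj.proj _ (measurableSet_cell N i)).isSelfAdjoint
  simp only [doubleStepOp, star_sum, star_smul, star_mul, hs hE, hs hQ, mul_one]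
  rw [Finset.sum_comm]
  rfl

/-- The bound for the perturbation of the first operator in terms of the Schatten norm. -/
lemma IsExpType.diagNorm_sub_le_schattenNorm {M G p : ℝ} {g : ℝ → ℝ → ℂ} (hg : IsExpType M G g)
    (hM : 0 < M) (hp : p ∈ Icc (1 : ℝ) 2) (hE : IsSpectralOn E A R) (hE' : IsSpectralOn E' A' R)
    (hQ : IsSpectralOn Q B R) {W W' : H →L[ℂ] H}
    (hW : Tendsto (fun N => doubleStepOp E Q R N 1 g) atTop (𝓝 W))
    (hW' : Tendsto (fun N => doubleStepOp E' Q R N 1 g) atTop (𝓝 W'))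
    (hA : MemSchatten p (A - A')) :
    diagNorm p (W - W') ≤
      ENNReal.ofReal (M * G * schurConst) * (100 * schattenNorm p (A - A')) := by
  obtain ⟨ι, _, v, hv, h1, h2⟩ := exists_orthonormal_expansion hp (A - A') hA
  refine (hg.diagNorm_sub_le hM hp hE hE' hQ hW hW' hv h1).trans (mul_le_mul_right ?_ _)
  have hp0 : 0 < p := by linarith [hp.1]
  calc _ ≤ (100 * schattenNorm p (A - A') ^ p) ^ (1 / p) :=
        ENNReal.rpow_le_rpow h2 (by positivity)
    _ = 100 ^ (1 / p) * schattenNorm p (A - A') := by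
        rw [ENNReal.mul_rpow_of_nonneg _ _ (by positivity), ← ENNReal.rpow_mul,
          mul_one_div_cancel hp0.ne', ENNReal.rpow_one]
    _ ≤ 100 ^ (1 : ℝ) * schattenNorm p (A - A') := by
        gcongr
        · norm_num
        · rw [div_le_one hp0]; exact hp.1
    _ = _ := by rw [ENNReal.rpow_one]

/-- The bound for the perturbation of the second operator in terms of the Schatten norm. -/
lemma IsExpType.diagNorm_sub_le_schattenNorm_right {M G p : ℝ} {g : ℝ → ℝ → ℂ}
    (hg : IsExpType M G fun y x => g x y) (hM : 0 < M) (hp : p ∈ Icc (1 : ℝ) 2)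
    (hE : IsSpectralOn E A R) (hE' : IsSpectralOn E' A' R) (hQ : IsSpectralOn Q B R)
    {W W' : H →L[ℂ] H} (hW : Tendsto (fun N => doubleStepOp Q E R N 1 g) atTop (𝓝 W))
    (hW' : Tendsto (fun N => doubleStepOp Q E' R N 1 g) atTop (𝓝 W'))
    (hA : MemSchatten p (A - A')) :
    diagNorm p (W - W') ≤
      ENNReal.ofReal (M * G * schurConst) * (100 * schattenNorm p (A - A')) := by
  have h1 : Tendsto (fun N => doubleStepOp E Q R N 1 fun y x => starRingEnd ℂ (g x y)) atTop
      (𝓝 (star W)) := by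
    simp_rw [← star_doubleStepOp hQ hE]
    exact (continuous_star.tendsto _).comp hW
  have h2 : Tendsto (fun N => doubleStepOp E' Q R N 1 fun y x => starRingEnd ℂ (g x y)) atTop
      (𝓝 (star W')) := by
    simp_rw [← star_doubleStepOp hQ hE']
    exact (continuous_star.tendsto _).comp hW'
  have h3 := hg.conj.diagNorm_sub_le_schattenNorm hM hp hE hE' hQ h1 h2 hA
  rw [← star_sub] at h3
  have h4 := diagNorm_adjoint_le p (star (W - W'))
  rw [star_star] at h4
  exact h4.trans h3

/-- The limit of the Riemann sums of a sum of functions. -/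
lemma tendsto_doubleStepOp_tsum {κ : Type} {F : κ → ℝ → ℝ → ℂ} {C : κ → ℝ} {G : ℝ → ℝ → ℂ}
    (h : ∀ k, HasNuclearBound R (F k) (C k)) (hC : Summable C)
    (hF : ∀ x ∈ Icc (-R : ℝ) R, ∀ y ∈ Icc (-R : ℝ) R, HasSum (fun k => F k x y) (G x y))
    (hE : IsSpectralOn E A R) (hQ : IsSpectralOn Q B R) {W : κ → H →L[ℂ] H}
    (hW : ∀ k, Tendsto (fun N => doubleStepOp E Q R N 1 (F k)) atTop (𝓝 (W k))) :
    Summable W ∧ Tendsto (fun N => doubleStepOp E Q R N 1 G) atTop (𝓝 (∑' k, W k)) := by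
  constructor
  · refine Summable.of_norm (hC.of_nonneg_of_le (fun _ => norm_nonneg _) fun k => ?_)
    exact le_of_tendsto (hW k).norm (Eventually.of_forall ((h k).norm_doubleStepOp_le hE hQ))
  · simp_rw [← fun N => (doubleStepOp_hasSum (E := E) (Q := Q) hF N 1).tsum_eq]
    exact tendsto_tsum_of_dominated_convergence hC hW
      (Eventually.of_forall fun N k => (h k).norm_doubleStepOp_le hE hQ N)

/-- Functions of pairs for sums of functions of exponential type. -/
theorem functionOfPair_sub_le {p : ℝ} (hp : p ∈ Icc (1 : ℝ) 2) {f : Plane → ℂ} (hf : Continuous f)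
    {g : ℤ → ℝ → ℝ → ℂ} {M G : ℤ → ℝ} (hM : ∀ n, 0 < M n) (hg : ∀ n, IsExpType (M n) (G n) (g n))
    (hg' : ∀ n, IsExpType (M n) (G n) fun y x => g n x y) (hs : Summable fun n => M n * G n)
    (hsum : ∀ x y x' y', HasSum (fun n => g n x y - g n x' y') (f !₂[x, y] - f !₂[x', y']))
    {A₁ A₂ B₁ B₂ : H →L[ℂ] H} (hA₁ : IsSelfAdjoint A₁) (hA₂ : IsSelfAdjoint A₂)
    (hB₁ : IsSelfAdjoint B₁) (hB₂ : IsSelfAdjoint B₂) (hA : MemSchatten p (A₁ - A₂))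
    (hB : MemSchatten p (B₁ - B₂)) :
    IsFunctionOfPair f A₁ B₁ (functionOfPair f A₁ B₁) ∧
    IsFunctionOfPair f A₂ B₂ (functionOfPair f A₂ B₂) ∧
    schattenNorm p (functionOfPair f A₁ B₁ - functionOfPair f A₂ B₂) ≤
      800 * (∑' n, ENNReal.ofReal (M n * G n * schurConst)) *
        max (schattenNorm p (A₁ - A₂)) (schattenNorm p (B₁ - B₂)) := by
  obtain ⟨R, hR⟩ := exists_nat_ge (max (max ‖A₁‖ ‖A₂‖) (max ‖B₁‖ ‖B₂‖))
  simp only [max_le_iff] at hR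
  obtain ⟨⟨hRA₁, hRA₂⟩, hRB₁, hRB₂⟩ := hR
  -- Only differences of the series are known to converge, so the values at one corner of the square
  -- are subtracted throughout.
  set z := f !₂[(-R : ℝ), -R] with hz
  have hb : ∀ n, HasNuclearBound R (fun x y => g n x y - g n (-R) (-R))
      (4 * R * Real.exp 1 * (M n * G n)) := fun n => (hg n).hasNuclearBound_sub (hg' n) (hM n) R
  have hC : Summable fun n => 4 * R * Real.exp 1 * (M n * G n) := hs.mul_left _
  have hF : ∀ x ∈ Icc (-R : ℝ) R, ∀ y ∈ Icc (-R : ℝ) R,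
      HasSum (fun n => g n x y - g n (-R) (-R)) (f !₂[x, y] - z) := fun x _ y _ => hsum x y _ _
  obtain ⟨ι, a, b, c, d, hN, -⟩ : HasNuclearBound R (fun x y => f !₂[x, y]) _ :=
    ((HasNuclearBound.of_hasSum hb hC hF).add (HasNuclearBound.of_right
      (continuous_const (y := z)) fun _ _ => le_rfl)).congr fun x _ y _ => sub_add_cancel _ _
  have key : ∀ {A B : H →L[ℂ] H}, IsSelfAdjoint A → IsSelfAdjoint B → ‖A‖ ≤ R → ‖B‖ ≤ R →
      IsFunctionOfPair f A B (functionOfPair f A B) ∧ ∃ W : ℤ → H →L[ℂ] H,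
        (∀ n, Tendsto (fun N => doubleStepOp (spectralMeasure A) (spectralMeasure B) R N 1 (g n))
          atTop (𝓝 (W n))) ∧
        HasSum (fun n => W n - g n (-R) (-R) • (1 : H →L[ℂ] H)) (functionOfPair f A B - z • 1) := by
    intro A B hA hB hRA hRB
    have hEA := spectralMeasure_isSpectralOn hA hRA
    have hEB := spectralMeasure_isSpectralOn hB hRB
    obtain ⟨h1, h2⟩ := hN.functionOfPair_spec hf hA hB hRA hRB
    refine ⟨h1, ?_⟩
    choose V hV using fun n => (hb n).exists_tendsto hEA hEB
    obtain ⟨h3, h4⟩ := tendsto_doubleStepOp_tsum hb hC hF hEA hEB hV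
    refine ⟨fun n => V n + g n (-R) (-R) • 1, fun n => ?_, ?_⟩
    · have := (hV n).add_const (g n (-R) (-R) • (1 : H →L[ℂ] H))
      refine this.congr fun N => ?_
      rw [doubleStepOp_sub, doubleStepOp_const hEA hEB, sub_add_cancel]
    · simp_rw [add_sub_cancel_right]
      have h5 : functionOfPair f A B - z • 1 = ∑' n, V n := by
        refine tendsto_nhds_unique ?_ h4
        refine (h2.sub_const (z • (1 : H →L[ℂ] H))).congr fun N => ?_
        rw [doubleStepOp_sub, doubleStepOp_const hEA hEB]
      rw [h5]
      exact h3.hasSum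
  -- The intermediate pair `(A₂, B₁)` changes one operator at a time.
  obtain ⟨s11, W, hW, hWs⟩ := key hA₁ hB₁ hRA₁ hRB₁
  obtain ⟨-, V, hV, hVs⟩ := key hA₂ hB₁ hRA₂ hRB₁
  obtain ⟨s22, U, hU, hUs⟩ := key hA₂ hB₂ hRA₂ hRB₂
  refine ⟨s11, s22, ?_⟩
  set m := max (schattenNorm p (A₁ - A₂)) (schattenNorm p (B₁ - B₂)) with hm
  have hEA₁ := spectralMeasure_isSpectralOn hA₁ hRA₁
  have hEA₂ := spectralMeasure_isSpectralOn hA₂ hRA₂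
  have hEB₁ := spectralMeasure_isSpectralOn hB₁ hRB₁
  have hEB₂ := spectralMeasure_isSpectralOn hB₂ hRB₂
  have d1 : ∀ n, diagNorm p (W n - V n) ≤ ENNReal.ofReal (M n * G n * schurConst) * (100 * m) :=
    fun n => ((hg n).diagNorm_sub_le_schattenNorm (hM n) hp hEA₁ hEA₂ hEB₁ (hW n) (hV n) hA).trans
      (by gcongr; exact le_max_left _ _)
  have d2 : ∀ n, diagNorm p (V n - U n) ≤ ENNReal.ofReal (M n * G n * schurConst) * (100 * m) :=
    fun n => ((hg' n).diagNorm_sub_le_schattenNorm_right (hM n) hp hEB₁ hEB₂ hEA₂ (hV n) (hU n)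
      hB).trans (by gcongr; exact le_max_right _ _)
  -- The subtracted multiples of the identity cancel in the difference.
  have h1 := hWs.sub hUs
  simp only [sub_sub_sub_cancel_right] at h1
  calc _ ≤ 4 * diagNorm p (functionOfPair f A₁ B₁ - functionOfPair f A₂ B₂) :=
        schattenNorm_le_diagNorm hp.1 _
    _ ≤ 4 * ∑' n, diagNorm p (W n - U n) := by gcongr; exact diagNorm_tsum_le hp.1 h1
    _ ≤ 4 * ∑' n, ENNReal.ofReal (M n * G n * schurConst) * (200 * m) := by
        gcongr with n
        rw [← sub_add_sub_cancel (W n) (V n) (U n)]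
        refine (diagNorm_add_le hp.1 _ _).trans ((add_le_add (d1 n) (d2 n)).trans (le_of_eq ?_))
        ring
    _ = _ := by rw [ENNReal.tsum_mul_right]; ring

end FunctionsOfPairs

end NoncommFun

namespace NoncommFun

/-! ### Convolution of functions of polynomial growth with Schwartz functions. -/

section Convolution

open Filter Topology LineDeriv

/-- The convolution of a function of polynomial growth and a Schwartz function. -/
noncomputable def schwartzConv (f : Plane → ℂ) (k : 𝓢(Plane, ℂ)) : Plane → ℂ :=
  fun x => ∫ y, f (x - y) * k y

/-- `f` is continuous and `f(x) = O((1 + ‖x‖)^N)`. -/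
structure HasGrowth (f : Plane → ℂ) (N : ℕ) : Prop where
  continuous : Continuous f
  bound : ∃ M, ∀ x, ‖f x‖ ≤ M * (1 + ‖x‖) ^ N

lemma integrable_one_add_norm_pow_mul (k : 𝓢(Plane, ℂ)) (N : ℕ) :
    Integrable fun y => (1 + ‖y‖) ^ N * ‖k y‖ := by
  have e : (fun y => (1 + ‖y‖) ^ N * ‖k y‖) =
      fun y => ∑ m ∈ Finset.range (N + 1), (N.choose m : ℝ) * (‖y‖ ^ m * ‖k y‖) := by
    funext y
    rw [add_comm, add_pow, Finset.sum_mul]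
    exact Finset.sum_congr rfl fun m _ => by ring
  rw [e]
  exact integrable_finsetSum _ fun m _ => (k.integrable_pow_mul volume m).const_mul _

lemma one_add_norm_sub_pow_le (x y : Plane) (N : ℕ) :
    (1 + ‖x - y‖) ^ N ≤ (1 + ‖x‖) ^ N * (1 + ‖y‖) ^ N := by
  rw [← mul_pow]
  gcongr
  nlinarith [norm_sub_le x y, norm_nonneg x, norm_nonneg y]

namespace HasGrowth

variable {f : Plane → ℂ} {N : ℕ} (hf : HasGrowth f N) (k g : 𝓢(Plane, ℂ))
include hf

lemma exists_norm_sub_le : ∃ M, 0 ≤ M ∧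
    ∀ x y, ‖f (x - y)‖ ≤ M * (1 + ‖x‖) ^ N * (1 + ‖y‖) ^ N := by
  obtain ⟨M, hM⟩ := hf.bound
  have hM0 : 0 ≤ M := by simpa using (norm_nonneg _).trans (hM 0)
  refine ⟨M, hM0, fun x y => (hM _).trans ?_⟩
  rw [mul_assoc]
  gcongr
  exact one_add_norm_sub_pow_le x y N

lemma integrable_mul (x : Plane) : Integrable fun y => f (x - y) * k y := by
  obtain ⟨M, -, hM⟩ := hf.exists_norm_sub_le
  refine ((integrable_one_add_norm_pow_mul k N).const_mul (M * (1 + ‖x‖) ^ N)).mono'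
    (Continuous.aestronglyMeasurable ?_) (Eventually.of_forall fun y => ?_)
  · have := hf.continuous
    fun_prop
  · rw [norm_mul, ← mul_assoc]
    gcongr
    exact hM x y

lemma schwartzConv : HasGrowth (schwartzConv f k) N := by
  obtain ⟨M, hM0, hM⟩ := hf.exists_norm_sub_le
  have hc := hf.continuous
  have hle : ∀ x y, ‖f (x - y) * k y‖ ≤ M * (1 + ‖x‖) ^ N * ((1 + ‖y‖) ^ N * ‖k y‖) := by
    intro x y
    rw [norm_mul, ← mul_assoc]
    gcongr
    exact hM x y
  have hi := integrable_one_add_norm_pow_mul k N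
  constructor
  · refine continuous_iff_continuousAt.2 fun x₀ => ?_
    refine continuousAt_of_dominated (bound := fun y =>
      M * (1 + (‖x₀‖ + 1)) ^ N * ((1 + ‖y‖) ^ N * ‖k y‖))
      (Eventually.of_forall fun x => (hf.integrable_mul k x).aestronglyMeasurable) ?_
      (hi.const_mul _) (Eventually.of_forall fun y => by fun_prop)
    filter_upwards [Metric.ball_mem_nhds x₀ one_pos] with x hx
    refine Eventually.of_forall fun y => (hle x y).trans ?_
    have : ‖x‖ ≤ ‖x₀‖ + 1 := by
      have := norm_le_norm_add_norm_sub' x x₀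
      rw [← dist_eq_norm] at this
      linarith [Metric.mem_ball.1 hx]
    gcongr
  · refine ⟨M * ∫ y, (1 + ‖y‖) ^ N * ‖k y‖, fun x => ?_⟩
    refine (norm_integral_le_of_norm_le (hi.const_mul (M * (1 + ‖x‖) ^ N))
      (Eventually.of_forall fun y => hle x y)).trans (le_of_eq ?_)
    rw [integral_const_mul]
    ring

lemma integrable_mul_mul (x : Plane) :
    Integrable (fun q : Plane × Plane => f (x - q.1 - q.2) * g q.2 * k q.1)
      (volume.prod volume) := by
  obtain ⟨M, hM0, hM⟩ := hf.exists_norm_sub_le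
  have hc := hf.continuous
  have h1 := (integrable_one_add_norm_pow_mul k N).mul_prod (integrable_one_add_norm_pow_mul g N)
  refine (h1.const_mul (M * (1 + ‖x‖) ^ N)).mono' (Continuous.aestronglyMeasurable (by fun_prop))
    (Eventually.of_forall fun q => ?_)
  rw [norm_mul, norm_mul]
  calc _ ≤ M * ((1 + ‖x‖) ^ N * (1 + ‖q.1‖) ^ N) * (1 + ‖q.2‖) ^ N * ‖g q.2‖ * ‖k q.1‖ := by
        gcongr
        refine (hM _ _).trans ?_
        gcongr
        exact one_add_norm_sub_pow_le _ _ _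
    _ = _ := by ring

lemma schwartzConv_comm : NoncommFun.schwartzConv (NoncommFun.schwartzConv f g) k =
    NoncommFun.schwartzConv (NoncommFun.schwartzConv f k) g := by
  funext x
  simp only [NoncommFun.schwartzConv, ← integral_mul_const]
  rw [integral_integral_swap (hf.integrable_mul_mul k g x)]
  congr 1
  funext z
  congr 1
  funext y
  rw [sub_right_comm]
  ring

/-- Fubini after the shear `(y, u) ↦ (y, u - y)`; polynomial growth against Schwartz decay gives
integrability. -/
lemma schwartzConv_assoc : NoncommFun.schwartzConv (NoncommFun.schwartzConv f g) k =
    NoncommFun.schwartzConv f (SchwartzMap.convolution (ContinuousLinearMap.mul ℂ ℂ) k g) := by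
  funext x
  have h1 := (measurePreserving_prod_sub (volume : Measure Plane)
    (volume : Measure Plane)).integrable_comp_of_integrable (hf.integrable_mul_mul k g x)
  have h2 : Integrable (Function.uncurry fun y u : Plane => f (x - u) * g (u - y) * k y)
      (volume.prod volume) := by
    refine h1.congr (Eventually.of_forall fun q => ?_)
    simp [Function.uncurry, sub_sub]
  calc _ = ∫ y, ∫ u, f (x - u) * g (u - y) * k y := by
        simp only [NoncommFun.schwartzConv, ← integral_mul_const]
        congr 1
        funext y
        rw [← integral_sub_right_eq_self _ y]
        simp [sub_sub]
    _ = ∫ u, ∫ y, f (x - u) * g (u - y) * k y := integral_integral_swap h2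
    _ = _ := by
        simp only [NoncommFun.schwartzConv]
        congr 1
        funext u
        rw [SchwartzMap.convolution_apply, convolution_def, ← integral_const_mul]
        congr 1
        funext y
        simp only [ContinuousLinearMap.mul_apply']
        ring

end HasGrowth

lemma norm_schwartzConv_le {h : Plane → ℂ} {G : ℝ} (hG : ∀ x, ‖h x‖ ≤ G) (k : 𝓢(Plane, ℂ))
    (x : Plane) : ‖schwartzConv h k x‖ ≤ (∫ y, ‖k y‖) * G := by
  rw [mul_comm, ← integral_const_mul]
  refine norm_integral_le_of_norm_le (k.integrable.norm.const_mul G)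
    (Eventually.of_forall fun y => ?_)
  rw [norm_mul]
  gcongr
  exact hG _

lemma exists_norm_le_rpow (k : 𝓢(Plane, ℂ)) :
    ∃ C, 0 ≤ C ∧ ∀ x, ‖k x‖ ≤ C * (1 + ‖x‖) ^ (-3 : ℝ) := by
  refine ⟨2 ^ 3 * (Finset.Iic (3, 0)).sup (fun m => SchwartzMap.seminorm ℝ m.1 m.2) k,
    by positivity, fun x => ?_⟩
  have h := SchwartzMap.one_add_le_sup_seminorm_apply (𝕜 := ℝ) (m := (3, 0)) le_rfl le_rfl k x
  rw [norm_iteratedFDeriv_zero] at h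
  have h0 : 0 < 1 + ‖x‖ := by positivity
  rw [Real.rpow_neg h0.le, ← div_eq_mul_inv, le_div_iff₀ (by positivity), mul_comm]
  exact_mod_cast h

/-- The derivative is moved to the Schwartz factor; the dominating function decays with exponent 3,
which is integrable in the plane. -/
lemma hasDerivAt_schwartzConv {h : Plane → ℂ} (hc : Continuous h) {G : ℝ} (hG : ∀ x, ‖h x‖ ≤ G)
    (k : 𝓢(Plane, ℂ)) (e x : Plane) :
    HasDerivAt (fun t : ℝ => schwartzConv h k (x + t • e)) (schwartzConv h (∂_{e} k) x) 0 := by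
  have h1 : ∀ (k : 𝓢(Plane, ℂ)) x, schwartzConv h k x = ∫ y, h y * k (x - y) := fun k x => by
    rw [schwartzConv, ← integral_sub_left_eq_self _ _ x]
    simp
  obtain ⟨C, hC0, hC⟩ := exists_norm_le_rpow (∂_{e} k)
  have hG0 : 0 ≤ G := (norm_nonneg _).trans (hG 0)
  have hgr : HasGrowth h 0 := ⟨hc, G, by simpa using hG⟩
  have hi : ∀ (k : 𝓢(Plane, ℂ)) x, Integrable fun y => h y * k (x - y) := fun k x => by
    have := (hgr.integrable_mul k x).comp_sub_left x
    simpa using this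
  simp_rw [h1]
  have h3 : Integrable fun y : Plane =>
      G * (C * (1 + ‖e‖) ^ (3 : ℝ)) * (1 + ‖x - y‖) ^ (-3 : ℝ) := by
    refine Integrable.const_mul ?_ _
    have : Integrable fun y : Plane => (1 + ‖y‖) ^ (-3 : ℝ) := integrable_one_add_norm (by
      simp [Plane]; norm_num)
    exact this.comp_sub_left x
  have key := (hasDerivAt_integral_of_dominated_loc_of_deriv_le (μ := (volume : Measure Plane))
    (F := fun (t : ℝ) y => h y * k (x + t • e - y)) (F' := fun t y => h y * ∂_{e} k (x + t • e - y))
    (x₀ := 0) (Metric.ball_mem_nhds (0 : ℝ) one_pos)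
    (Eventually.of_forall fun t => (hi k _).aestronglyMeasurable) (hi k _)
    (hi (∂_{e} k) _).aestronglyMeasurable (Eventually.of_forall fun y t ht => ?_) h3
    (Eventually.of_forall fun y t ht => ?_)).2
  · simpa using key
  · rw [norm_mul, mul_assoc]
    refine mul_le_mul (hG y) ((hC _).trans ?_) (norm_nonneg _) hG0
    rw [mul_assoc]
    gcongr
    have ht1 : ‖t • e‖ ≤ ‖e‖ := by
      rw [norm_smul]
      have : ‖t‖ ≤ 1 := by simpa using (mem_ball_zero_iff.1 ht).le
      exact mul_le_of_le_one_left (norm_nonneg _) this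
    -- A shift by `t • e` with `|t| ≤ 1` changes the weight by a bounded factor, so the majorant is
    -- uniform in `t`.
    have h4 : 1 + ‖x - y‖ ≤ (1 + ‖e‖) * (1 + ‖x + t • e - y‖) := by
      have : x - y = (x + t • e - y) - t • e := by abel
      have h5 := norm_sub_le (x + t • e - y) (t • e)
      rw [← this] at h5
      nlinarith [norm_nonneg (x + t • e - y), norm_nonneg e]
    have h6 : 0 < 1 + ‖x - y‖ := by positivity
    have h7 : 0 < 1 + ‖x + t • e - y‖ := by positivity
    rw [Real.rpow_neg h6.le, Real.rpow_neg h7.le, ← div_eq_mul_inv, le_div_iff₀ (by positivity),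
      inv_mul_le_iff₀ (by positivity), mul_comm, ← Real.mul_rpow (by positivity) h7.le]
    exact Real.rpow_le_rpow h6.le h4 (by norm_num)
  · have h5 : HasDerivAt (fun t : ℝ => x + t • e - y) e t := by
      simpa using (((hasDerivAt_id t).smul_const e).const_add x).sub_const y
    exact ((k.hasFDerivAt (x + t • e - y)).comp_hasDerivAt t h5).const_mul (h y)

end Convolution

end NoncommFun

namespace NoncommFun

/-! ### Bernstein's inequality and Taylor series of band-limited functions. -/

section Bernstein

open Filter Topology LineDeriv
open scoped Nat

/-- The derivative of the remainder of order `n + 1` for `u c` is the remainder of order `n` for `u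
(c + 1)`; hence the induction runs over all `c` at once. -/
lemma norm_sub_taylor_le {u : ℕ → ℝ → ℂ} (hu : ∀ c t, HasDerivAt (u c) (u (c + 1) t) t) {M G : ℝ}
    (hG : ∀ c t, ‖u c t‖ ≤ M ^ c * G) (n : ℕ) : ∀ c s, 0 ≤ s →
    ‖u c s - ∑ j ∈ Finset.range n, ((s ^ j / j ! : ℝ) : ℂ) * u (c + j) 0‖ ≤
      M ^ (c + n) * G * (s ^ n / n !) := by
  induction n with
  | zero => intro c s _; simpa using hG c s
  | succ n ih =>
    intro c s hs
    have hp : ∀ j (t : ℝ), HasDerivAt (fun t : ℝ => t ^ (j + 1) / (j + 1)!) (t ^ j / j !) t := by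
      intro j t
      convert! (hasDerivAt_pow (j + 1) t).div_const ((j + 1)! : ℝ) using 1
      rw [Nat.factorial_succ]
      push_cast
      field_simp
    have h1 : ∀ t, HasDerivAt
        (fun t => u c t - ∑ j ∈ Finset.range (n + 1), ((t ^ j / j ! : ℝ) : ℂ) * u (c + j) 0)
        (u (c + 1) t - ∑ j ∈ Finset.range n, ((t ^ j / j ! : ℝ) : ℂ) * u (c + 1 + j) 0) t := by
      intro t
      refine (hu c t).sub ?_
      simp_rw [Finset.sum_range_succ']
      have h2 : HasDerivAt (fun t : ℝ => ∑ j ∈ Finset.range n,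
          ((t ^ (j + 1) / (j + 1)! : ℝ) : ℂ) * u (c + (j + 1)) 0)
          (∑ j ∈ Finset.range n, ((t ^ j / j ! : ℝ) : ℂ) * u (c + 1 + j) 0) t := by
        refine HasDerivAt.fun_sum fun j _ => ?_
        have := ((hp j t).ofReal_comp).mul_const (u (c + 1 + j) 0)
        rwa [show c + (j + 1) = c + 1 + j by ring]
      simpa using h2
    have h3 := image_norm_le_of_norm_deriv_right_le_deriv_boundary (a := 0) (b := s)
      (fun t _ => (h1 t).continuousAt.continuousWithinAt)
      (fun t _ => (h1 t).hasDerivWithinAt) (B := fun t => M ^ (c + (n + 1)) * G *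
        (t ^ (n + 1) / (n + 1)!)) (B' := fun t => M ^ (c + (n + 1)) * G * (t ^ n / n !))
      (by simp [Finset.sum_range_succ']) (fun t => (hp n t).const_mul _) (fun t ht => by
        have := ih (c + 1) t ht.1
        rwa [show c + 1 + n = c + (n + 1) by ring] at this)
    exact h3 (right_mem_Icc.2 hs)

lemma hasSum_taylor_of_nonneg {u : ℕ → ℝ → ℂ} (hu : ∀ c t, HasDerivAt (u c) (u (c + 1) t) t)
    {M G : ℝ} (hG : ∀ c t, ‖u c t‖ ≤ M ^ c * G) {s : ℝ} (hs : 0 ≤ s) :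
    HasSum (fun c => ((s ^ c / c ! : ℝ) : ℂ) * u c 0) (u 0 s) := by
  have hpow : ∀ n : ℕ, (M * s) ^ n / n ! * G = M ^ n * G * (s ^ n / n !) := fun n => by
    rw [mul_pow]; ring
  have hsum : Summable fun c => ((s ^ c / c ! : ℝ) : ℂ) * u c 0 := by
    refine Summable.of_norm (((Real.summable_pow_div_factorial (M * s)).mul_right G).of_nonneg_of_le
      (fun _ => norm_nonneg _) fun c => ?_)
    rw [norm_mul, Complex.norm_real, Real.norm_of_nonneg (by positivity), hpow, mul_comm]
    gcongr
    exact hG c 0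
  convert! hsum.hasSum using 1
  refine tendsto_nhds_unique ?_ hsum.hasSum.tendsto_sum_nat
  rw [tendsto_iff_norm_sub_tendsto_zero]
  have h0 := (FloorSemiring.tendsto_pow_div_factorial_atTop (M * s)).mul_const G
  rw [zero_mul] at h0
  refine squeeze_zero (fun _ => norm_nonneg _) (fun n => ?_) h0
  have := norm_sub_taylor_le hu hG n 0 s hs
  simp only [zero_add] at this
  rw [hpow, norm_sub_rev]
  exact this

lemma hasSum_taylor {u : ℕ → ℝ → ℂ} (hu : ∀ c t, HasDerivAt (u c) (u (c + 1) t) t)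
    {M G : ℝ} (hG : ∀ c t, ‖u c t‖ ≤ M ^ c * G) (s : ℝ) :
    HasSum (fun c => ((s ^ c / c ! : ℝ) : ℂ) * u c 0) (u 0 s) := by
  rcases le_total 0 s with hs | hs
  · exact hasSum_taylor_of_nonneg hu hG hs
  · have h1 := hasSum_taylor_of_nonneg (u := fun c t => (-1) ^ c * u c (-t)) (M := M) (G := G)
      (fun c t => ?_) (fun c t => by simpa using hG c (-t)) (neg_nonneg.2 hs)
    · convert! h1 using 1
      · funext c
        rw [neg_pow s]
        push_cast
        rw [neg_zero]
        have : ((-1 : ℂ)) ^ c * (-1) ^ c = 1 := by rw [← mul_pow]; simp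
        linear_combination (-(s : ℂ) ^ c / c ! * u c 0) * this
      · simp
    · have := ((hu c (-t)).scomp t (hasDerivAt_neg t)).const_mul ((-1 : ℂ) ^ c)
      convert! this using 1
      simp [pow_succ]

/-- Bounded continuous functions that are reproduced by the convolution with `Ψ`. -/
structure IsBandLimited (Ψ : 𝓢(Plane, ℂ)) (h : Plane → ℂ) (G : ℝ) : Prop where
  continuous : Continuous h
  bound : ∀ x, ‖h x‖ ≤ G
  conv : schwartzConv h Ψ = h

namespace IsBandLimited

variable {Ψ : 𝓢(Plane, ℂ)} {h : Plane → ℂ} {G M : ℝ} (hh : IsBandLimited Ψ h G) (e : Plane)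
include hh

lemma hasGrowth : HasGrowth h 0 := ⟨hh.continuous, G, by simpa using hh.bound⟩

/-- Differentiating `h = h * Ψ` falls on `Ψ` and costs its `L¹` norm. The derivative is again
reproduced by `Ψ` because convolutions commute, so the step can be iterated. -/
lemma lineDeriv (hM : ∫ y, ‖(∂_{e} Ψ) y‖ ≤ M) :
    IsBandLimited Ψ (schwartzConv h (∂_{e} Ψ)) (M * G) where
  continuous := (hh.hasGrowth.schwartzConv _).continuous
  bound x := (norm_schwartzConv_le hh.bound _ x).trans (by
    have := (norm_nonneg _).trans (hh.bound 0)
    gcongr)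
  conv := by rw [hh.hasGrowth.schwartzConv_comm, hh.conv]

lemma hasDerivAt (x : Plane) (t : ℝ) :
    HasDerivAt (fun t : ℝ => h (x + t • e)) (schwartzConv h (∂_{e} Ψ) (x + t • e)) t := by
  have h1 := hasDerivAt_schwartzConv hh.continuous hh.bound Ψ e (x + t • e)
  rw [hh.conv] at h1
  have h2 : HasDerivAt (fun r : ℝ => r - t) 1 t := (hasDerivAt_id t).sub_const t
  have h3 := h1.scomp_of_eq t h2 (sub_self t).symm
  simpa [Function.comp_def, add_assoc, ← add_smul] using h3

lemma iterate (hM : ∫ y, ‖(∂_{e} Ψ) y‖ ≤ M) (c : ℕ) :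
    IsBandLimited Ψ ((fun h => schwartzConv h (∂_{e} Ψ))^[c] h) (M ^ c * G) := by
  induction c with
  | zero => simpa using hh
  | succ c ih =>
    rw [Function.iterate_succ_apply', pow_succ', mul_assoc]
    exact ih.lineDeriv e hM

/-- The coefficients are `M^{-c}` times the iterated derivatives. The dilation `r` multiplies the
type and leaves the bound unchanged; it is later taken to be `2^n`. -/
lemma isExpType (hM0 : 0 < M) (hM : ∫ y, ‖(∂_{e} Ψ) y‖ ≤ M) (e' : Plane) {r : ℝ} (hr : 0 < r) :
    IsExpType (M * r) G fun x y => h (r • (x • e + y • e')) := by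
  set D : ℕ → Plane → ℂ := fun c => (fun h => schwartzConv h (∂_{e} Ψ))^[c] h with hD
  have hb : ∀ c, IsBandLimited Ψ (D c) (M ^ c * G) := hh.iterate e hM
  refine ⟨fun c x y => ((M ^ c)⁻¹ : ℝ) * D c (r • (x • e + y • e')), fun c x y => ?_, fun c x => ?_,
    fun x s y => ?_⟩
  · rw [norm_mul, Complex.norm_real, Real.norm_of_nonneg (by positivity),
      inv_mul_le_iff₀ (by positivity)]
    exact (hb c).bound _
  · have := (hb c).continuous
    fun_prop
  · have h1 := hasSum_taylor (u := fun c t => D c (r • (x • e + y • e') + t • e)) (M := M) (G := G)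
      (fun c t => ?_) (fun c t => (hb c).bound _) (s / M)
    · convert! h1 using 1
      · funext c
        rw [zero_smul, add_zero, div_pow]
        push_cast
        field_simp
      · simp only [hD, Function.iterate_zero, id]
        congr 1
        rw [add_smul, smul_add, smul_add, smul_add, smul_smul r (s / (M * r))]
        rw [show r * (s / (M * r)) = s / M by field_simp]
        abel
    · have := (hb c).hasDerivAt e (r • (x • e + y • e')) t
      have e1 : D (c + 1) = schwartzConv (D c) (∂_{e} Ψ) := Function.iterate_succ_apply' _ _ _
      simp only [e1]
      exact this

end IsBandLimited

end Bernstein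

end NoncommFun

namespace NoncommFun

/-! ### The Littlewood–Paley pieces are of exponential type. -/

section LittlewoodPaley

open Filter Topology LineDeriv

variable {w : ℝ → ℝ}

lemma IsCutoff.eq_zero (hw : IsCutoff w) {s : ℝ} (hs : s ∉ Icc (1 / 2 : ℝ) 2) : w s = 0 :=
  image_eq_zero_of_notMem_tsupport fun h => hs (hw.supp h)

/-- The symbol of the kernel `W_0`. -/
noncomputable def lpSymbol (w : ℝ → ℝ) : Plane → ℂ :=
  fun ξ => ((w (2 * Real.pi * ‖ξ‖ / 2 ^ (0 : ℤ)) : ℝ) : ℂ)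

lemma lpSymbol_eq_zero (hw : IsCutoff w) {ξ : Plane} (hξ : ξ ∉ Metric.closedBall (0 : Plane) 1) :
    lpSymbol w ξ = 0 := by
  rw [mem_closedBall_zero_iff, not_le] at hξ
  rw [lpSymbol, hw.eq_zero, Complex.ofReal_zero]
  rintro ⟨-, h⟩
  rw [zpow_zero, div_one] at h
  nlinarith [Real.pi_gt_three]

lemma hasCompactSupport_lpSymbol (hw : IsCutoff w) : HasCompactSupport (lpSymbol w) :=
  HasCompactSupport.intro (isCompact_closedBall 0 1) fun _ h => lpSymbol_eq_zero hw h

/-- The norm is not smooth at the origin, but `w` vanishes on a neighbourhood of `0`. -/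
lemma contDiff_lpSymbol (hw : IsCutoff w) :
    ContDiff ℝ ((⊤ : ℕ∞) : WithTop ℕ∞) (lpSymbol w) := by
  refine contDiff_iff_contDiffAt.2 fun ξ => ?_
  rcases eq_or_ne ξ 0 with rfl | hξ
  · refine (contDiffAt_const (c := (0 : ℂ))).congr_of_eventuallyEq ?_
    have hc : Continuous fun ξ : Plane => 2 * Real.pi * ‖ξ‖ / 2 ^ (0 : ℤ) := by fun_prop
    have h := hc.tendsto 0
    have h1 : ∀ᶠ ξ in 𝓝 (0 : Plane), 2 * Real.pi * ‖ξ‖ / 2 ^ (0 : ℤ) < 1 / 2 :=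
      h.eventually (gt_mem_nhds (by simp))
    filter_upwards [h1] with ξ h1
    rw [lpSymbol, hw.eq_zero fun h => absurd h.1 (not_le.2 h1), Complex.ofReal_zero]
  · refine Complex.ofRealCLM.contDiff.contDiffAt.comp ξ (hw.smooth.contDiffAt.comp ξ ?_)
    exact ((contDiffAt_norm ℝ hξ).const_smul (2 * Real.pi)).div_const _

/-- The kernel `W_0` is a Schwartz function, and it is reproduced by a Schwartz function. -/
lemma exists_reproducing_kernel (hw : IsCutoff w) : ∃ K Ψ : 𝓢(Plane, ℂ), kernelW w 0 = K ∧
    SchwartzMap.convolution (ContinuousLinearMap.mul ℂ ℂ) Ψ K = K := by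
  set m : 𝓢(Plane, ℂ) := (hasCompactSupport_lpSymbol hw).toSchwartzMap (contDiff_lpSymbol hw)
  have hm : ∀ ξ, m ξ = lpSymbol w ξ := fun _ => rfl
  -- This bump equals 1 on the unit ball, which contains the support of the symbol `m`; hence `χ m =
  -- m`, which the Fourier transform turns into the convolution identity.
  let χ : ContDiffBump (0 : Plane) := ⟨1, 2, one_pos, one_lt_two⟩
  have hχc : HasCompactSupport fun ξ => ((χ ξ : ℝ) : ℂ) :=
    χ.hasCompactSupport.comp_left (g := fun r : ℝ => (r : ℂ)) Complex.ofReal_zero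
  set q : 𝓢(Plane, ℂ) := hχc.toSchwartzMap (Complex.ofRealCLM.contDiff.comp χ.contDiff)
  have hq : ∀ ξ, q ξ = ((χ ξ : ℝ) : ℂ) := fun _ => rfl
  refine ⟨𝓕⁻ m, 𝓕⁻ q, ?_, ?_⟩
  · rw [SchwartzMap.fourierInv_coe]
    rfl
  · have h1 := SchwartzMap.fourier_convolution (ContinuousLinearMap.mul ℂ ℂ) (𝓕⁻ q) (𝓕⁻ m)
    rw [FourierTransform.fourier_fourierInv_eq, FourierTransform.fourier_fourierInv_eq] at h1
    rw [← FourierTransform.fourierInv_fourier_eq (E := 𝓢(Plane, ℂ)) (F := 𝓢(Plane, ℂ))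
      (SchwartzMap.convolution _ _ _), h1]
    congr 1
    ext ξ
    rw [SchwartzMap.pairing_apply_apply, ContinuousLinearMap.mul_apply', hq, hm]
    by_cases hξ : ξ ∈ Metric.closedBall (0 : Plane) 1
    · rw [χ.one_of_mem_closedBall hξ, Complex.ofReal_one, one_mul]
    · rw [lpSymbol_eq_zero hw hξ, mul_zero]

/-- A change of scale `W_n(y) = 4^n W_0(2^n y)`, so that one reproducing kernel serves all `n`. -/
lemma kernelW_eq (w : ℝ → ℝ) (n : ℤ) (y : Plane) :
    kernelW w n y = |(((2 ^ n : ℝ)⁻¹) ^ 2)⁻¹| • kernelW w 0 ((2 : ℝ) ^ n • y) := by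
  have hr : (0 : ℝ) < 2 ^ n := by positivity
  have h := Measure.integral_comp_smul (volume : Measure Plane)
    (fun ξ => Complex.exp ((2 * Real.pi * ⟪ξ, (2 : ℝ) ^ n • y⟫_ℝ : ℝ) * Complex.I) •
      ((w (2 * Real.pi * ‖ξ‖ / 2 ^ (0 : ℤ)) : ℝ) : ℂ)) (2 ^ n : ℝ)⁻¹
  simp only [finrank_euclideanSpace, Fintype.card_fin] at h
  rw [kernelW, kernelW, Real.fourierInv_eq', Real.fourierInv_eq', ← h]
  congr 1
  funext ξ
  rw [inner_smul_left, inner_smul_right, norm_smul, Real.norm_of_nonneg (by positivity)]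
  congr 3
  · simp only [conj_trivial]; field_simp
  · rw [zpow_zero, div_one]; field_simp

lemma lpPiece_eq {K : 𝓢(Plane, ℂ)} (hK : kernelW w 0 = K) (f : Plane → ℂ) (n : ℤ) (x : Plane) :
    lpPiece w f n x = schwartzConv (fun z => f ((2 ^ n : ℝ)⁻¹ • z)) K ((2 : ℝ) ^ n • x) := by
  have hr : (0 : ℝ) < 2 ^ n := by positivity
  have h := Measure.integral_comp_smul (volume : Measure Plane)
    (fun z => f (x - (2 ^ n : ℝ)⁻¹ • z) * K z) (2 ^ n : ℝ)
  simp only [finrank_euclideanSpace, Fintype.card_fin] at h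
  rw [lpPiece, schwartzConv]
  simp_rw [kernelW_eq w n, hK, smul_sub, inv_smul_smul₀ hr.ne'] at h ⊢
  simp_rw [mul_smul_comm]
  rw [integral_smul, h, smul_smul, abs_of_pos (by positivity), abs_of_pos (by positivity)]
  rw [show ((2 ^ n : ℝ)⁻¹ ^ 2)⁻¹ * ((2 ^ n : ℝ) ^ 2)⁻¹ = 1 by field_simp, one_smul]

/-- The bound holds on a set of full measure, which is dense, and continuity extends it to every
point. -/
lemma norm_le_eLpNorm_top {h : Plane → ℂ} (hc : Continuous h)
    (hfin : eLpNorm h ∞ volume ≠ ∞) (x : Plane) : ‖h x‖ ≤ (eLpNorm h ∞ volume).toReal := by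
  have h1 : ∀ᵐ x ∂(volume : Measure Plane), ‖h x‖ ≤ (eLpNorm h ∞ volume).toReal := by
    filter_upwards [ae_le_eLpNormEssSup (f := h) (μ := (volume : Measure Plane))] with x hx
    rw [← toReal_enorm]
    exact ENNReal.toReal_mono hfin (by rwa [eLpNorm_exponent_top])
  exact (isClosed_le hc.norm continuous_const).closure_subset
    ((Measure.dense_of_ae h1).closure_eq ▸ mem_univ x)

lemma MemBesov.eLpNorm_ne_top {f : Plane → ℂ} (hf : MemBesov w f) (n : ℤ) :
    eLpNorm (lpPiece w f n) ∞ volume ≠ ∞ := by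
  intro h
  have h1 := (ENNReal.le_tsum n).trans_lt hf.summable
  rw [h, ENNReal.mul_top (ENNReal.zpow_pos two_ne_zero ENNReal.ofNat_ne_top n).ne'] at h1
  exact h1.ne rfl

lemma MemBesov.hasGrowth_comp_smul {f : Plane → ℂ} (hf : MemBesov w f) (r : ℝ) :
    ∃ N, HasGrowth (fun z => f (r • z)) N := by
  obtain ⟨M, N, h⟩ := hf.growth
  have hM : 0 ≤ M := by simpa using (norm_nonneg _).trans (h 0)
  refine ⟨N, hf.continuous.comp (continuous_const_smul r), M * (1 + |r|) ^ N, fun z => ?_⟩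
  refine (h _).trans ?_
  rw [mul_assoc, ← mul_pow, norm_smul, Real.norm_eq_abs]
  gcongr
  nlinarith [abs_nonneg r, norm_nonneg z]

lemma MemBesov.continuous_lpPiece (hw : IsCutoff w) {f : Plane → ℂ} (hf : MemBesov w f) (n : ℤ) :
    Continuous (lpPiece w f n) := by
  obtain ⟨K, -, hK, -⟩ := exists_reproducing_kernel hw
  obtain ⟨N, hN⟩ := hf.hasGrowth_comp_smul (2 ^ n : ℝ)⁻¹
  rw [show lpPiece w f n = fun x => _ from funext (lpPiece_eq hK f n)]
  exact (hN.schwartzConv K).continuous.comp (continuous_const_smul _)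

/-- Bernstein's inequality: the Littlewood–Paley pieces are of exponential type. -/
theorem exists_isExpType_lpPiece (hw : IsCutoff w) : ∃ M : ℝ, 0 < M ∧
    ∀ (f : Plane → ℂ) (_ : MemBesov w f) (n : ℤ),
      IsExpType (M * 2 ^ n) (eLpNorm (lpPiece w f n) ∞ volume).toReal
        (fun x y => lpPiece w f n !₂[x, y]) ∧
      IsExpType (M * 2 ^ n) (eLpNorm (lpPiece w f n) ∞ volume).toReal
        (fun y x => lpPiece w f n !₂[x, y]) := by
  obtain ⟨K, Ψ, hK, hΨ⟩ := exists_reproducing_kernel hw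
  set e : Fin 2 → Plane := fun i => EuclideanSpace.single i 1 with he
  set I : Fin 2 → ℝ := fun i => ∫ y, ‖(∂_{e i} Ψ) y‖ with hI
  have hI0 : ∀ i, 0 ≤ I i := fun i => integral_nonneg fun _ => norm_nonneg _
  -- One positive constant dominating the `L¹` norms of both partial derivatives of `Ψ`.
  refine ⟨1 + I 0 + I 1, by linarith [hI0 0, hI0 1], fun f hf n => ?_⟩
  have hr : (0 : ℝ) < 2 ^ n := by positivity
  obtain ⟨N, hN⟩ := hf.hasGrowth_comp_smul (2 ^ n : ℝ)⁻¹
  set h := schwartzConv (fun z => f ((2 ^ n : ℝ)⁻¹ • z)) K with hh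
  have hb : IsBandLimited Ψ h (eLpNorm (lpPiece w f n) ∞ volume).toReal :=
    { continuous := (hN.schwartzConv K).continuous
      bound := fun z => by
        have := norm_le_eLpNorm_top (hf.continuous_lpPiece hw n) (hf.eLpNorm_ne_top n)
          ((2 ^ n : ℝ)⁻¹ • z)
        rwa [lpPiece_eq hK, smul_inv_smul₀ hr.ne'] at this
      conv := by rw [hh, hN.schwartzConv_assoc, hΨ] }
  have hxy : ∀ x y : ℝ, !₂[x, y] = x • e 0 + y • e 1 := fun x y => by
    ext i
    fin_cases i <;> simp [he]
  constructor
  · simp_rw [lpPiece_eq hK, hxy]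
    exact hb.isExpType (e 0) (by linarith [hI0 0, hI0 1]) (by linarith [hI0 1]) (e 1) hr
  · simp_rw [lpPiece_eq hK, hxy, add_comm (_ • e 0)]
    exact hb.isExpType (e 1) (by linarith [hI0 0, hI0 1]) (by linarith [hI0 0]) (e 0) hr

end LittlewoodPaley

end NoncommFun

namespace NoncommFun

/-! ### Recovering `f`, up to constants, from its Littlewood–Paley pieces. -/

section Reconstruction

open Filter Topology LineDeriv
open scoped Convolution

lemma plane_eq (z : Plane) : z = z 0 • EuclideanSpace.single (0 : Fin 2) (1 : ℝ) +
    z 1 • EuclideanSpace.single (1 : Fin 2) (1 : ℝ) := by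
  ext i
  fin_cases i <;> simp

lemma integral_lineDeriv_eq_zero (k : 𝓢(Plane, ℂ)) (e : Plane) :
    ∫ x, fderiv ℝ k x e = 0 := by
  have := integral_mul_fderiv_eq_neg_fderiv_mul_of_integrable (μ := (volume : Measure Plane))
    (f := fun _ : Plane => (1 : ℂ)) (g := k) (v := e) (by simp)
    (by simpa using (∂_{e} k).integrable) (by simpa using k.integrable)
    (fun _ _ => differentiableAt_const _) (fun x _ => k.differentiableAt)
  simpa using this

/-- A continuous function with vanishing distributional derivatives is constant. -/
lemma eq_of_distribPartial_eq_zero {u : Plane → ℂ} (hu : Continuous u)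
    (h : ∀ (j : Fin 2) (k : 𝓢(Plane, ℂ)), HasCompactSupport k → distribPartial u j k = 0)
    (z z' : Plane) : u z = u z' := by
  have hl : LocallyIntegrable u := hu.locallyIntegrable
  have key : ∀ B : ContDiffBump (0 : Plane), ∀ z z',
      (B.normed volume ⋆[ContinuousLinearMap.lsmul ℝ ℝ, volume] u) z =
        (B.normed volume ⋆[ContinuousLinearMap.lsmul ℝ ℝ, volume] u) z' := by
    intro B
    set b : Plane → ℝ := B.normed volume with hb
    have hbc : HasCompactSupport b := B.hasCompactSupport_normed
    have hbs : ContDiff ℝ ((⊤ : ℕ∞) : WithTop ℕ∞) b := B.contDiff_normed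
    have hb1 : ContDiff ℝ 1 b := hbs.of_le (by exact_mod_cast le_top)
    set L : ℂ →L[ℝ] ℝ →L[ℝ] ℂ := (ContinuousLinearMap.lsmul ℝ ℝ : ℝ →L[ℝ] ℂ →L[ℝ] ℂ).flip with hL
    have hflip : b ⋆[ContinuousLinearMap.lsmul ℝ ℝ, volume] u = u ⋆[L, volume] b :=
      (convolution_flip _).symm
    rw [hflip]
    have hd : ∀ x, HasFDerivAt (u ⋆[L, volume] b)
        ((u ⋆[L.precompR Plane, volume] fderiv ℝ b) x) x :=
      hbc.hasFDerivAt_convolution_right L hl hb1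
    -- The gradient of a mollification is `u` tested against a derivative of the translated and
    -- reflected bump, so it vanishes.
    have hcoord : ∀ (x : Plane) (j : Fin 2),
        (u ⋆[L.precompR Plane, volume] fderiv ℝ b) x (EuclideanSpace.single j 1) = 0 := by
      intro x j
      rw [convolution_precompR_apply L hl (hbc.fderiv ℝ) (hb1.continuous_fderiv one_ne_zero)]
      have hkc : HasCompactSupport fun t : Plane => ((b (x - t) : ℝ) : ℂ) :=
        (hbc.comp_homeomorph (Homeomorph.subLeft x)).comp_left (g := fun r : ℝ => (r : ℂ))
          Complex.ofReal_zero
      have hks : ContDiff ℝ ((⊤ : ℕ∞) : WithTop ℕ∞) fun t : Plane => ((b (x - t) : ℝ) : ℂ) :=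
        Complex.ofRealCLM.contDiff.comp (hbs.comp (contDiff_const.sub contDiff_id))
      have h1 := h j (hkc.toSchwartzMap hks) hkc
      have h2 : ∀ t : Plane, fderiv ℝ (hkc.toSchwartzMap hks) t (EuclideanSpace.single j 1) =
          -((fderiv ℝ b (x - t) (EuclideanSpace.single j 1) : ℝ) : ℂ) := by
        intro t
        have h3 : HasFDerivAt (fun t : Plane => x - t) (-ContinuousLinearMap.id ℝ Plane) t :=
          (hasFDerivAt_id t).const_sub x
        have h4 := (hb1.differentiable one_ne_zero (x - t)).hasFDerivAt.comp t h3
        have h5 := Complex.ofRealCLM.hasFDerivAt.comp t h4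
        have h6 : HasFDerivAt (hkc.toSchwartzMap hks) _ t := h5
        rw [h6.fderiv]
        simp
      rw [distribPartial, neg_eq_zero] at h1
      simp_rw [h2, mul_neg, integral_neg, neg_eq_zero] at h1
      rw [convolution_def, ← h1]
      congr 1
      funext t
      simp [hL, mul_comm]
    have hzero : ∀ x, fderiv ℝ (u ⋆[L, volume] b) x = 0 := by
      intro x
      rw [(hd x).fderiv]
      ext v
      · rw [plane_eq v, map_add, map_smul, map_smul, hcoord, hcoord]; simp
    exact is_const_of_fderiv_eq_zero (𝕜 := ℝ) (fun x => (hd x).differentiableAt) hzero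
  -- The mollifications with shrinking bumps are constant and converge pointwise to `u`.
  let B : ℕ → ContDiffBump (0 : Plane) := fun i =>
    ⟨1 / ((i : ℝ) + 1), 2 * (1 / ((i : ℝ) + 1)), by positivity, by
      have : 0 < 1 / ((i : ℝ) + 1) := by positivity
      linarith⟩
  have hB : Tendsto (fun i => (B i).rOut) atTop (𝓝 0) := by
    have := (tendsto_one_div_add_atTop_nhds_zero_nat (𝕜 := ℝ)).const_mul 2
    rwa [mul_zero] at this
  have ht : ∀ z, _ := fun z => ContDiffBump.convolution_tendsto_right_of_continuous
    (μ := (volume : Measure Plane)) hB hu z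
  exact tendsto_nhds_unique ((ht z).congr fun i => key (B i) z z') (ht z')

/-- A function is the sum of a locally uniformly convergent series, up to constants, if its
distributional derivatives are. -/
lemma hasSum_sub_of_hasSum_distribPartial {g : ℤ → Plane → ℂ} {f : Plane → ℂ}
    (hg : ∀ n, Continuous (g n)) (hf : Continuous f)
    (hb : ∀ R : ℕ, ∃ b : ℤ → ℝ, Summable b ∧ ∀ n z, ‖z‖ ≤ R → ‖g n z - g n 0‖ ≤ b n)
    (h : ∀ (j : Fin 2) (k : 𝓢(Plane, ℂ)),
      HasSum (fun n => distribPartial (g n) j k) (distribPartial f j k)) (z z' : Plane) :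
    HasSum (fun n => g n z - g n z') (f z - f z') := by
  have hs : ∀ z, Summable fun n => g n z - g n 0 := fun z => by
    obtain ⟨R, hR⟩ := exists_nat_ge ‖z‖
    obtain ⟨b, hbs, hb⟩ := hb R
    exact Summable.of_norm_bounded hbs fun n => hb n z hR
  -- The normalised series converges locally uniformly; it remains to see that `f - S` has zero
  -- distributional derivatives.
  set S : Plane → ℂ := fun z => ∑' n, (g n z - g n 0) with hS
  have hSc : Continuous S := by
    refine continuous_iff_continuousAt.2 fun z => ?_
    obtain ⟨R, hR⟩ := exists_nat_gt ‖z‖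
    obtain ⟨b, hbs, hb⟩ := hb R
    have : ContinuousOn S (Metric.ball 0 R) :=
      continuousOn_tsum (fun n => ((hg n).sub continuous_const).continuousOn) hbs fun n z hz =>
        hb n z (mem_ball_zero_iff.1 hz).le
    exact this.continuousAt (Metric.isOpen_ball.mem_nhds (mem_ball_zero_iff.2 hR))
  have hu : ∀ (j : Fin 2) (k : 𝓢(Plane, ℂ)), HasCompactSupport k →
      distribPartial (fun z => f z - S z) j k = 0 := by
    intro j k hk
    set e : Plane := EuclideanSpace.single j 1
    set D : Plane → ℂ := fun x => fderiv ℝ k x e with hD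
    have hDc : Continuous D := (∂_{e} k).continuous
    have hDs : HasCompactSupport D := (hk.fderiv ℝ).comp_left (g := fun T : Plane →L[ℝ] ℂ => T e) rfl
    have hint : ∀ v : Plane → ℂ, Continuous v → Integrable fun x => v x * D x := fun v hv =>
      (hv.mul hDc).integrable_of_hasCompactSupport hDs.mul_left
    obtain ⟨r, hr⟩ := hDs.isCompact.isBounded.subset_closedBall 0
    obtain ⟨R, hR⟩ := exists_nat_ge r
    obtain ⟨b, hbs, hb⟩ := hb R
    have hle : ∀ n x, ‖(g n x - g n 0) * D x‖ ≤ b n * ‖D x‖ := by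
      intro n x
      rw [norm_mul]
      by_cases hx : x ∈ tsupport D
      · gcongr
        exact hb n x ((mem_closedBall_zero_iff.1 (hr hx)).trans hR)
      · simp [image_eq_zero_of_notMem_tsupport hx]
    have hDi : Integrable D := by simpa using hint (fun _ => 1) continuous_const
    have h1 := hasSum_integral_of_summable_integral_norm
      (F := fun n x => (g n x - g n 0) * D x)
      (fun n => hint _ ((hg n).sub continuous_const))
      ((hbs.mul_right (∫ x, ‖D x‖)).of_nonneg_of_le
        (fun n => integral_nonneg fun _ => norm_nonneg _) fun n => by
          rw [← integral_const_mul]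
          exact integral_mono_of_nonneg (Eventually.of_forall fun _ => norm_nonneg _)
            (hDi.norm.const_mul _) (Eventually.of_forall (hle n)))
    -- The constants `g n 0` drop out because a derivative of a test function has integral zero.
    have h2 : ∀ n, ∫ x, (g n x - g n 0) * D x = ∫ x, g n x * D x := fun n => by
      simp_rw [sub_mul]
      rw [integral_sub (hint _ (hg n)) (hint _ continuous_const), integral_const_mul,
        integral_lineDeriv_eq_zero, mul_zero, sub_zero]
    simp_rw [h2, tsum_mul_right] at h1
    have h3 := (h j k).neg
    simp only [distribPartial, neg_neg] at h3 ⊢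
    rw [neg_eq_zero]
    simp_rw [sub_mul]
    rw [integral_sub (hint _ hf) (hint _ hSc), sub_eq_zero]
    exact h3.unique h1
  have hconst := eq_of_distribPartial_eq_zero (hf.sub hSc) hu z z'
  have h4 := (hs z).hasSum.sub (hs z').hasSum
  simp only [sub_sub_sub_cancel_right] at h4
  have h5 : f z - f z' = S z - S z' := by
    have h6 : f z - S z = f z' - S z' := hconst
    linear_combination h6
  rw [h5]
  exact h4

variable {w : ℝ → ℝ} {f : Plane → ℂ}

lemma toReal_two_zpow (n : ℤ) : ((2 : ℝ≥0∞) ^ n).toReal = 2 ^ n := by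
  have h : (2 : ℝ≥0∞) ^ n = (((2 : ℝ≥0) ^ n : ℝ≥0) : ℝ≥0∞) := by
    rw [ENNReal.coe_zpow two_ne_zero, ENNReal.coe_ofNat]
  rw [h, ENNReal.coe_toReal, NNReal.coe_zpow, NNReal.coe_ofNat]

lemma MemBesov.summable_toReal (hf : MemBesov w f) :
    Summable fun n : ℤ => (2 : ℝ) ^ n * (eLpNorm (lpPiece w f n) ∞ volume).toReal := by
  have := ENNReal.summable_toReal hf.summable.ne
  simpa only [ENNReal.toReal_mul, toReal_two_zpow] using this

/-- Nuclear bounds on the square also bound the functions themselves, so the Besov norm controls the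
increments of the pieces locally uniformly. -/
lemma MemBesov.hasSum_lpPiece_sub (hw : IsCutoff w) (hf : MemBesov w f) (z z' : Plane) :
    HasSum (fun n => lpPiece w f n z - lpPiece w f n z') (f z - f z') := by
  obtain ⟨M, hM, h⟩ := exists_isExpType_lpPiece hw
  refine hasSum_sub_of_hasSum_distribPartial (hf.continuous_lpPiece hw) hf.continuous
    (fun R => ?_) hf.derivs z z'
  refine ⟨fun n => 2 * (4 * R * Real.exp 1 *
    (M * 2 ^ n * (eLpNorm (lpPiece w f n) ∞ volume).toReal)), ?_, fun n z hz => ?_⟩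
  · have := ((hf.summable_toReal.mul_left M).mul_left (4 * R * Real.exp 1)).mul_left 2
    simpa only [mul_assoc] using this
  · obtain ⟨h1, h2⟩ := h f hf n
    obtain ⟨ι, a, b, c, d, h3, h4⟩ := h1.hasNuclearBound_sub h2 (by positivity) R
    have h5 : ∀ z : Plane, ‖z‖ ≤ R → ‖lpPiece w f n z - lpPiece w f n !₂[(-R : ℝ), -R]‖ ≤
        4 * R * Real.exp 1 * (M * 2 ^ n * (eLpNorm (lpPiece w f n) ∞ volume).toReal) := by
      intro z hz
      have hz' : !₂[z 0, z 1] = z := by ext i; fin_cases i <;> rfl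
      have h6 : ∀ i, z i ∈ Icc (-R : ℝ) R := fun i =>
        abs_le.1 ((PiLp.norm_apply_le z i).trans hz)
      have := (h3.norm_le (h6 0) (h6 1)).trans h4
      rwa [hz'] at this
    beta_reduce
    rw [two_mul, ← sub_sub_sub_cancel_right _ _ (lpPiece w f n !₂[(-R : ℝ), -R])]
    exact (norm_sub_le _ _).trans (add_le_add (h5 z hz) (h5 0 (by simp)))

end Reconstruction

end NoncommFun

theorem theorem7p2 (w : ℝ → ℝ) (hw : NoncommFun.IsCutoff w) (p : ℝ) (hp : p ∈ Set.Icc (1 : ℝ) 2) :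
    ∃ C : ℝ≥0, 0 < C ∧
      ∀ (H : Type u) [NormedAddCommGroup H] [InnerProductSpace ℂ H] [CompleteSpace H]
        (f : NoncommFun.Plane → ℂ) (A₁ A₂ B₁ B₂ : H →L[ℂ] H),
        NoncommFun.MemBesov w f →
        IsSelfAdjoint A₁ → IsSelfAdjoint A₂ → IsSelfAdjoint B₁ → IsSelfAdjoint B₂ →
        NoncommFun.MemSchatten p (A₂ - A₁) → NoncommFun.MemSchatten p (B₂ - B₁) →
        NoncommFun.IsFunctionOfPair f A₁ B₁ (NoncommFun.functionOfPair f A₁ B₁) ∧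
        NoncommFun.IsFunctionOfPair f A₂ B₂ (NoncommFun.functionOfPair f A₂ B₂) ∧
        NoncommFun.schattenNorm p
            (NoncommFun.functionOfPair f A₁ B₁ - NoncommFun.functionOfPair f A₂ B₂) ≤
          C * NoncommFun.besovNorm w f *
            max (NoncommFun.schattenNorm p (A₁ - A₂)) (NoncommFun.schattenNorm p (B₁ - B₂)) := by
  obtain ⟨M, hM, h⟩ := NoncommFun.exists_isExpType_lpPiece hw
  -- The absolute value and the added 1 in the next line make the constant positive without knowing
  -- the sign of `schurConst`.
  set s : ℝ≥0 := Real.toNNReal (M * |NoncommFun.schurConst|) with hs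
  refine ⟨800 * s + 1, by positivity, ?_⟩
  intro H _ _ _ f A₁ A₂ B₁ B₂ hf hA₁ hA₂ hB₁ hB₂ hA hB
  rw [NoncommFun.MemSchatten, ← NoncommFun.schattenNorm_neg, neg_sub] at hA hB
  have hsum : Summable fun n : ℤ => M * 2 ^ n *
      (eLpNorm (NoncommFun.lpPiece w f n) ∞ volume).toReal := by
    simpa only [mul_assoc] using hf.summable_toReal.mul_left M
  obtain ⟨h1, h2, h3⟩ := NoncommFun.functionOfPair_sub_le hp hf.continuous
    (g := fun n x y => NoncommFun.lpPiece w f n !₂[x, y]) (fun n => by positivity)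
    (fun n => (h f hf n).1) (fun n => (h f hf n).2) hsum
    (fun x y x' y' => hf.hasSum_lpPiece_sub hw _ _) hA₁ hA₂ hB₁ hB₂ hA hB
  refine ⟨h1, h2, h3.trans (mul_le_mul_left ?_ _)⟩
  have h4 : ∀ n : ℤ, ENNReal.ofReal (M * 2 ^ n *
      (eLpNorm (NoncommFun.lpPiece w f n) ∞ volume).toReal * NoncommFun.schurConst) ≤
      s * (2 ^ n * eLpNorm (NoncommFun.lpPiece w f n) ∞ volume) := by
    intro n
    refine ENNReal.ofReal_le_of_le_toReal ?_
    rw [ENNReal.toReal_mul, ENNReal.toReal_mul, NoncommFun.toReal_two_zpow, ENNReal.coe_toReal, hs,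
      Real.coe_toNNReal _ (by positivity)]
    calc _ ≤ M * 2 ^ n * (eLpNorm (NoncommFun.lpPiece w f n) ∞ volume).toReal *
          |NoncommFun.schurConst| := by gcongr; exact le_abs_self _
      _ = _ := by ring
  calc _ ≤ 800 * ∑' n : ℤ, s * ((2 : ℝ≥0∞) ^ n * eLpNorm (NoncommFun.lpPiece w f n) ∞ volume) := by
        gcongr with n
        exact h4 n
    _ = 800 * s * NoncommFun.besovNorm w f := by
        rw [ENNReal.tsum_mul_left, ← mul_assoc, NoncommFun.besovNorm]
    _ ≤ _ := by
        push_cast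
        gcongr
        exact le_self_add
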